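/- Let $N\ge 2$ be an integer and let $b,\alpha\in\mathbb R$ satisfy $$\min\{b,\ \alpha,\ N-\alpha,\ N-b,\ 1-2b+\alpha\}>0 .$$ Let $J_\alpha(x)=C_{N,\alpha}|x|^{\alpha-N}$ on $\mathbb R^N$, where $C_{N,\alpha}=\frac{\Gamma(\frac{N-\alpha}{2})}{\Gamma(\frac{\alpha}{2})\,\pi^{N/2}\,2^{\alpha}}$, and let $q\in\mathbb R$ satisfy $$\max\Big\{1,\,1+\frac{\alpha-2b}{N}\Big\}<q<1+\frac{1+\alpha-2b}{N}.$$ Let $w\in C([0,\infty),L^2(\mathbb R^N;\mathbb C))$ be a global solution of the inhomogeneous generalized Hartree equation $$i\partial_t w+\Delta w=|w|^{q-2}\big(J_\alpha*|\cdot|^{-b}|w|^q\big)|x|^{-b}w ,$$ in the following sense: for almost every $(t,x)\in(0,\infty)\times\mathbb R^N$ the integral defining $\big(J_\alpha*|\cdot|^{-b}|w(t)|^q\big)(x)$ converges, the right-hand side is locally integrable on $(0,\infty)\times\mathbb R^N$, and the equation holds in the sense of distributions on $(0,\infty)\times\mathbb R^N$ (the initial datum is $w(0)\in L^2$, which is arbitrary).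 Assume that there is $w_+\in L^2(\mathbb R^N;\mathbb C)$ such that $$\lim_{t\to\infty}\|w(t)-e^{it\Delta}w_+\|_{L^2}=0,$$ where $e^{it\Delta}f=\mathcal F^{-1}\big(e^{-it|\cdot|^2}\mathcal F f\big)$, with $\mathcal F$ the unitary Fourier transform $\mathcal F f(\xi)=(2\pi)^{-N/2}\int e^{-ix\cdot\xi}f(x)\,dx$ extended to $L^2$. Then $w_+=0$. -/

import Mathlib

open MeasureTheory Set Filter Topology
open scoped ContDiff FourierTransform Convolution

namespace Hartree

/-- The space `ℝ^N` with its Euclidean norm. -/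
abbrev Space (N : ℕ) : Type := EuclideanSpace ℝ (Fin N)

/-- The complex Hilbert space `L²(ℝ^N)`. -/
abbrev L2 (N : ℕ) : Type := Lp ℂ 2 (volume : Measure (Space N))

/-- The Fourier multiplier `ξ ↦ exp(-i t |2πξ|²)` of `e^{itΔ}`. The factor `2π` is due to Mathlib's
normalization `𝓕 f (ξ) = ∫ exp(-2πi⟨x, ξ⟩) f(x) dx`: the Laplacian is multiplication
by `-|2πξ|²`. -/
noncomputable def symbol {N : ℕ} (t : ℝ) (ξ : Space N) : ℂ :=
  Complex.exp (-Complex.I * ((t * (2 * Real.pi * ‖ξ‖) ^ 2 : ℝ) : ℂ))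

lemma norm_symbol {N : ℕ} (t : ℝ) (ξ : Space N) : ‖symbol t ξ‖ = 1 := by
  rw [symbol, Complex.norm_exp]
  simp [-Complex.ofReal_mul, -Complex.ofReal_pow]

lemma continuous_symbol {N : ℕ} (t : ℝ) : Continuous (symbol t : Space N → ℂ) := by
  unfold symbol
  fun_prop

lemma memLp_symbol_mul {N : ℕ} (t : ℝ) (g : L2 N) :
    MemLp (fun ξ => symbol t ξ * g ξ) 2 (volume : Measure (Space N)) := by
  refine (Lp.memLp g).of_le
    ((continuous_symbol t).aestronglyMeasurable.mul (Lp.aestronglyMeasurable g)) ?_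
  filter_upwards with ξ
  rw [norm_mul, norm_symbol, one_mul]

/-- The free Schrödinger propagator `e^{itΔ} f = 𝓕⁻¹ (symbol t · 𝓕 f)` on `L²(ℝ^N)`, with
the `L²` (Plancherel) Fourier transform. -/
noncomputable def freeSchrodinger {N : ℕ} (t : ℝ) (f : L2 N) : L2 N :=
  𝓕⁻ ((memLp_symbol_mul t (𝓕 f)).toLp (fun ξ => symbol t ξ * (𝓕 f : L2 N) ξ))

/-- The constant `C_{N,α} = Γ((N-α)/2) / (Γ(α/2) π^{N/2} 2^α)`. -/
noncomputable def rieszConst (N : ℕ) (α : ℝ) : ℝ :=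
  Real.Gamma (((N : ℝ) - α) / 2) /
    (Real.Gamma (α / 2) * Real.pi ^ ((N : ℝ) / 2) * (2 : ℝ) ^ α)

/-- The Riesz kernel `J_α(x) = C_{N,α} |x|^{α-N}`. -/
noncomputable def rieszKernel (N : ℕ) (α : ℝ) (x : Space N) : ℝ :=
  rieszConst N α * ‖x‖ ^ (α - (N : ℝ))

/-- The density `|x|^{-b} |f(x)|^q`. -/
noncomputable def density {N : ℕ} (b q : ℝ) (f : Space N → ℂ) (x : Space N) : ℝ :=
  ‖x‖ ^ (-b) * ‖f x‖ ^ q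

/-- The integral defining `(J_α * |·|^{-b}|f|^q)(x)` converges absolutely. -/
def PotentialExistsAt {N : ℕ} (b α q : ℝ) (f : Space N → ℂ) (x : Space N) : Prop :=
  ConvolutionExistsAt (rieszKernel N α) (density b q f) x (ContinuousLinearMap.mul ℝ ℝ) volume

/-- The potential `(J_α * |·|^{-b}|f|^q)(x)`. -/
noncomputable def potential {N : ℕ} (b α q : ℝ) (f : Space N → ℂ) (x : Space N) : ℝ :=
  (rieszKernel N α ⋆[ContinuousLinearMap.mul ℝ ℝ, volume] density b q f) x

/-- The nonlinearity `|f|^{q-2} (J_α * |·|^{-b}|f|^q) |x|^{-b} f`. -/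
noncomputable def nonlinearity {N : ℕ} (b α q : ℝ) (f : Space N → ℂ) (x : Space N) : ℂ :=
  ((‖f x‖ ^ (q - 2) * potential b α q f x * ‖x‖ ^ (-b) : ℝ) : ℂ) * f x

/-- Test functions on `(0,∞) × ℝ^N`: smooth, with compact support contained in that set. -/
structure IsTestFunction {N : ℕ} (φ : ℝ × Space N → ℂ) : Prop where
  smooth : ContDiff ℝ ∞ φ
  compact : HasCompactSupport φ
  support : tsupport φ ⊆ Ioi (0 : ℝ) ×ˢ (univ : Set (Space N))

/-- The transpose of `i∂_t + Δ` applied to `φ`, namely `-i∂_t φ + Δφ`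
(`Δ` acts on the space variable). -/
noncomputable def transposeSchrodinger {N : ℕ} (φ : ℝ × Space N → ℂ) (p : ℝ × Space N) : ℂ :=
  -Complex.I * deriv (fun t => φ (t, p.2)) p.1 +
    Laplacian.laplacian (fun x => φ (p.1, x)) p.2

/-- `w ∈ C([0,∞), L²(ℝ^N))` is a global solution, in the sense of distributions on
`(0,∞) × ℝ^N`, of `i∂_t w + Δw = |w|^{q-2} (J_α * |·|^{-b}|w|^q) |x|^{-b} w`, the initial datum
being `w 0`. Here `u` is a measurable function of `(t, x)` representing the curve `w`
(continuity of `w` makes one exist, unique up to null sets); the nonlinearity is required to make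
sense as a locally integrable function on `(0,∞) × ℝ^N`. -/
structure IsGlobalSolution {N : ℕ} (b α q : ℝ) (w : ℝ → L2 N) : Prop where
  continuousOn : ContinuousOn w (Ici 0)
  equation : ∃ u : ℝ × Space N → ℂ, Measurable u ∧
    (∀ᵐ t ∂(volume.restrict (Ioi (0 : ℝ))), (fun x => u (t, x)) =ᵐ[volume] w t) ∧
    (∀ᵐ p ∂((volume : Measure (ℝ × Space N)).restrict (Ioi 0 ×ˢ univ)),
      PotentialExistsAt b α q (fun x => u (p.1, x)) p.2) ∧
    LocallyIntegrableOn (fun p : ℝ × Space N => nonlinearity b α q (fun x => u (p.1, x)) p.2)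
      (Ioi 0 ×ˢ univ) volume ∧
    ∀ φ : ℝ × Space N → ℂ, IsTestFunction φ →
      ∫ p, u p * transposeSchrodinger φ p =
        ∫ p : ℝ × Space N, nonlinearity b α q (fun x => u (p.1, x)) p.2 * φ p

end Hartree

/-! Suppose the scattering state `wplus` is nonzero. In pseudoconformal coordinates the free flow
freezes: `pconf t` applied to `e^{itΔ} f` converges in L² to `asymptoticProfile f`, a unimodular
constant times `𝓕 f` (`tendsto_pconf_freeSchrodinger`). Scattering then forces v(t) = `pconf t (w
t)` to converge in L² to a nonzero profile g.

The equation is tested against `wavePacket θ χ L`, which lives on times L ≤ t ≤ 3L and carries the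
phase e^{-i|x|²/(4t)}. Phase, amplitude and dilation are matched so that the transposed operator
only leaves terms where a derivative falls on θ(·/L), or two fall on the slowly varying χ(x/(4πt))
(`transposeSchrodinger_wavePacket`). This gains a factor L⁻¹, which the length 2L of the time window
compensates, so the linear side stays bounded as L grows. On the nonlinear side, homogeneity
produces the factor (4πt)^{-P}, P = N(q-1)+2b-α, times the pairing of the nonlinearity of v(t) with
χ (`integral_nonlinearity_mul_wavePacket`). If the real part of that pairing is at least c₀ > 0 for
large t, the nonlinear side is at least of order L^{1-P}. Since 0 < P < 1, this is a contradiction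
as L → ∞.

The heart is the lower bound c₀ (`exists_lower_bound`). Closeness in L² does not control the
potential, so one cannot simply pass to the limit in the nonlinearity. Instead the main term and the
error are measured by one quantity M, the `weightedMass` of v. On bounded sets the potential is at
least a constant times M; integrated against a function a supported in an annulus it is at most
C(M+1) times the L^{2/(q-1)} norm of a (`exists_potential_bound`); and M ≥ M₀ > 0 for v near g
(`le_weightedMass`), so that M+1 ≤ (1+M₀⁻¹)M. By `coercive_pairing` the main term is |ψ|^q and the
error is |v-ψ|^{q-1}|ψ|, whose L^{2/(q-1)} norm only sees the L² distance of v and ψ weighted by a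
power of |ψ|. For ψ a smooth approximation of a truncation of g, the error is at most half of the
main term, whatever the size of M. -/

namespace Hartree

/-! ### Laplacians of modulated and dilated functions -/

lemma laplacian_eq_sum_fderiv {N : ℕ} {f : Space N → ℂ} (hf : ContDiff ℝ 2 f) (x : Space N) :
    Laplacian.laplacian f x = ∑ i, fderiv ℝ (fun y => fderiv ℝ f y (EuclideanSpace.basisFun _ ℝ i)) x
      (EuclideanSpace.basisFun (Fin N) ℝ i) := by
  rw [InnerProductSpace.laplacian_eq_iteratedFDeriv_orthonormalBasis f
    (EuclideanSpace.basisFun (Fin N) ℝ)]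
  refine Finset.sum_congr rfl fun i _ => ?_
  rw [iteratedFDeriv_two_apply]
  have h1 : Differentiable ℝ (fderiv ℝ f) :=
    (hf.fderiv_right (m := 1) (by norm_num)).differentiable (by norm_num)
  rw [fderiv_clm_apply (h1 x) (by fun_prop)]
  simp

lemma hasFDerivAt_cexp_norm_sq {N : ℕ} (c : ℂ) (y : Space N) :
    HasFDerivAt (fun x : Space N => Complex.exp (c * ((‖x‖ ^ 2 : ℝ) : ℂ)))
      ((2 * c * Complex.exp (c * ((‖y‖ ^ 2 : ℝ) : ℂ))) •
        (Complex.ofRealCLM.comp (innerSL ℝ y))) y := by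
  have h1 : HasFDerivAt (fun x : Space N => ‖x‖ ^ 2) (2 • innerSL ℝ y) y :=
    (hasStrictFDerivAt_norm_sq y).hasFDerivAt
  have h2 := (((Complex.ofRealCLM.hasFDerivAt).comp y h1).const_mul c).cexp
  convert! h2 using 1
  ext v
  simp
  ring

lemma contDiff_cexp_norm_sq {N : ℕ} (c : ℂ) {n : WithTop ℕ∞} :
    ContDiff ℝ n (fun x : Space N => Complex.exp (c * ((‖x‖ ^ 2 : ℝ) : ℂ))) := by
  have h : ContDiff ℝ n (fun x : Space N => ‖x‖ ^ 2) := contDiff_norm_sq ℝ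
  exact (contDiff_const.mul (Complex.ofRealCLM.contDiff.comp h)).cexp

/-- Used with c = -i/(4t): the term in |x|², the term in N and the radial derivative are then
cancelled by the time derivatives of the phase, of the amplitude t^{-N/2} and of the dilation. -/
lemma laplacian_cexp_mul {N : ℕ} (c : ℂ) {h : Space N → ℂ} (hh : ContDiff ℝ 2 h) (x : Space N) :
    Laplacian.laplacian (fun x : Space N => Complex.exp (c * ((‖x‖ ^ 2 : ℝ) : ℂ)) * h x) x =
      Complex.exp (c * ((‖x‖ ^ 2 : ℝ) : ℂ)) *
        ((4 * c ^ 2 * ((‖x‖ ^ 2 : ℝ) : ℂ) + 2 * c * N) * h x + 4 * c * fderiv ℝ h x x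
          + Laplacian.laplacian h x) := by
  have hE : ContDiff ℝ 2 (fun x : Space N => Complex.exp (c * ((‖x‖ ^ 2 : ℝ) : ℂ))) :=
    contDiff_cexp_norm_sq c
  rw [laplacian_eq_sum_fderiv (hE.mul hh), laplacian_eq_sum_fderiv hh]
  have hhd : Differentiable ℝ h := hh.differentiable (by norm_num)
  have hhd2 : Differentiable ℝ (fderiv ℝ h) :=
    (hh.fderiv_right (m := 1) (by norm_num)).differentiable (by norm_num)
  have key : ∀ v : Space N, fderiv ℝ (fun y => fderiv ℝ
      (fun x : Space N => Complex.exp (c * ((‖x‖ ^ 2 : ℝ) : ℂ)) * h x) y v) x v =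
      Complex.exp (c * ((‖x‖ ^ 2 : ℝ) : ℂ)) *
        (4 * c ^ 2 * ((inner ℝ x v : ℝ) : ℂ) ^ 2 * h x + 2 * c * ((inner ℝ v v : ℝ) : ℂ) * h x
          + 4 * c * (((inner ℝ x v : ℝ) : ℂ) * fderiv ℝ h x v)
          + fderiv ℝ (fun y => fderiv ℝ h y v) x v) := by
    intro v
    have e1 : (fun y => fderiv ℝ
      (fun x : Space N => Complex.exp (c * ((‖x‖ ^ 2 : ℝ) : ℂ)) * h x) y v) = fun y =>
        Complex.exp (c * ((‖y‖ ^ 2 : ℝ) : ℂ)) *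
          (2 * c * ((inner ℝ y v : ℝ) : ℂ) * h y + fderiv ℝ h y v) := by
      ext y
      rw [((hasFDerivAt_cexp_norm_sq c y).fun_mul (hhd y).hasFDerivAt).fderiv]
      simp
      ring
    have hv : Differentiable ℝ (fun y => fderiv ℝ h y v) := by fun_prop
    have hi : HasFDerivAt (fun y : Space N => ((inner ℝ y v : ℝ) : ℂ))
        (Complex.ofRealCLM.comp (innerSL ℝ v)) x := by
      have := (Complex.ofRealCLM.comp (innerSL ℝ v)).hasFDerivAt (x := x)
      refine this.congr_of_eventuallyEq (Eventually.of_forall fun y => ?_)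
      simp [real_inner_comm]
    rw [e1, ((hasFDerivAt_cexp_norm_sq c x).fun_mul
      (((hi.const_mul (2 * c)).fun_mul (hhd x).hasFDerivAt).fun_add (hv x).hasFDerivAt)).fderiv]
    simp
    ring
  have e2 : ∑ i, ((inner ℝ x (EuclideanSpace.basisFun (Fin N) ℝ i) : ℝ) : ℂ) *
      fderiv ℝ h x (EuclideanSpace.basisFun (Fin N) ℝ i) = fderiv ℝ h x x := by
    have e := congrArg (fderiv ℝ h x) ((EuclideanSpace.basisFun (Fin N) ℝ).sum_repr' x)
    rw [map_sum] at e
    rw [← e]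
    refine Finset.sum_congr rfl fun i _ => ?_
    rw [map_smul, real_inner_comm, Complex.real_smul]
  have e3 : ∑ i, ((inner ℝ x (EuclideanSpace.basisFun (Fin N) ℝ i) : ℝ) : ℂ) ^ 2 =
      ((‖x‖ ^ 2 : ℝ) : ℂ) := by
    rw [EuclideanSpace.real_norm_sq_eq]
    push_cast
    refine Finset.sum_congr rfl fun i _ => ?_
    rw [real_inner_comm, EuclideanSpace.basisFun_inner]
  simp_rw [key]
  rw [← Finset.mul_sum, Finset.sum_add_distrib, Finset.sum_add_distrib, Finset.sum_add_distrib,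
    ← Finset.mul_sum, e2, ← Finset.sum_mul, ← Finset.mul_sum, e3]
  congr 3
  simp
  ring

lemma laplacian_comp_smul {N : ℕ} (r : ℝ) {h : Space N → ℂ} (hh : ContDiff ℝ 2 h) (x : Space N) :
    Laplacian.laplacian (fun x : Space N => h (r • x)) x = (r : ℂ) ^ 2 *
      Laplacian.laplacian h (r • x) := by
  have hr : ContDiff ℝ 2 (fun x : Space N => h (r • x)) := hh.comp (contDiff_const_smul r)
  rw [laplacian_eq_sum_fderiv hr, laplacian_eq_sum_fderiv hh, Finset.mul_sum]
  refine Finset.sum_congr rfl fun i _ => ?_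
  have key : ∀ v, (fun y => fderiv ℝ (fun x : Space N => h (r • x)) y v) =
      fun y => (r : ℂ) * fderiv ℝ h (r • y) v := by
    intro v; ext y
    rw [fderiv_comp_smul]; simp
  have hhd2 : Differentiable ℝ (fderiv ℝ h) :=
    (hh.fderiv_right (m := 1) (by norm_num)).differentiable (by norm_num)
  rw [key]
  set v := EuclideanSpace.basisFun (Fin N) ℝ i
  have hd : Differentiable ℝ (fun y => fderiv ℝ h y v) := by fun_prop
  have := fderiv_comp_smul (𝕜 := ℝ) (f := fun y => fderiv ℝ h y v) (x := x) r
  have hd' : Differentiable ℝ (fun y => fderiv ℝ h (r • y) v) := by fun_prop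
  rw [fderiv_const_mul (hd' x), this]
  simp
  ring

/-! ### Pseudoconformal wave packets as test functions -/

/-- The pseudoconformal wave packet with profile `χ`, cut off in time by `θ(·/L)`. -/
noncomputable def wavePacket {N : ℕ} (θ : ℝ → ℝ) (χ : Space N → ℂ) (L : ℝ) (p : ℝ × Space N) : ℂ :=
  ((θ (p.1 / L) * (4 * Real.pi * p.1) ^ (-(N : ℝ) / 2) : ℝ) : ℂ) *
    (Complex.exp ((-Complex.I / (4 * (p.1 : ℂ))) * ((‖p.2‖ ^ 2 : ℝ) : ℂ)) *
      χ ((4 * Real.pi * p.1)⁻¹ • p.2))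

/-- All terms of order |x|²/t², N/t and (x·∇χ)/t cancel. What survives is of size L⁻¹ (derivative of
the cutoff) or t⁻² (Laplacian of the profile). -/
lemma transposeSchrodinger_wavePacket {N : ℕ} {θ : ℝ → ℝ} {χ : Space N → ℂ} (hθ : ContDiff ℝ ∞ θ)
    (hχ : ContDiff ℝ ∞ χ) {L t : ℝ} (ht : 0 < t) (x : Space N) :
    transposeSchrodinger (wavePacket θ χ L) (t, x) =
      (((4 * Real.pi * t) ^ (-(N : ℝ) / 2) : ℝ) : ℂ) *
      (Complex.exp ((-Complex.I / (4 * (t : ℂ))) * ((‖x‖ ^ 2 : ℝ) : ℂ)) *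
        (-Complex.I * ((deriv θ (t / L) / L : ℝ) : ℂ) * χ ((4 * Real.pi * t)⁻¹ • x) +
          ((θ (t / L) : ℝ) : ℂ) * (((4 * Real.pi * t)⁻¹ : ℝ) : ℂ) ^ 2 *
            Laplacian.laplacian χ ((4 * Real.pi * t)⁻¹ • x))) := by
  have hπ : 0 < 4 * Real.pi := by positivity
  have hχ2 : ContDiff ℝ 2 χ := hχ.of_le (by norm_cast)
  have hr : ContDiff ℝ 2 (fun x : Space N => χ ((4 * Real.pi * t)⁻¹ • x)) :=
    hχ2.comp (contDiff_const_smul _)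
  have htc : (t : ℂ) ≠ 0 := by exact_mod_cast ht.ne'
  have hπc : (Real.pi : ℂ) ≠ 0 := by exact_mod_cast Real.pi_pos.ne'
  -- time derivative
  have d1 : HasDerivAt (fun s : ℝ => ((θ (s / L) * (4 * Real.pi * s) ^ (-(N : ℝ) / 2) : ℝ) : ℂ))
      (((deriv θ (t / L) / L * (4 * Real.pi * t) ^ (-(N : ℝ) / 2) +
        θ (t / L) * (-(N : ℝ) / 2 * t⁻¹ * (4 * Real.pi * t) ^ (-(N : ℝ) / 2)) : ℝ)) : ℂ) t := by
    apply HasDerivAt.ofReal_comp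
    have a1 : HasDerivAt (fun s : ℝ => θ (s / L)) (deriv θ (t / L) / L) t := by
      have := (hθ.differentiable (by simp) (t / L)).hasDerivAt.comp t
        ((hasDerivAt_id t).div_const L)
      convert! this using 1
      simp [div_eq_mul_inv]
    have a2 : HasDerivAt (fun s : ℝ => (4 * Real.pi * s) ^ (-(N : ℝ) / 2))
        (-(N : ℝ) / 2 * t⁻¹ * (4 * Real.pi * t) ^ (-(N : ℝ) / 2)) t := by
      have := ((hasDerivAt_id t).const_mul (4 * Real.pi)).rpow_const (p := -(N : ℝ) / 2)
        (Or.inl (by simp; positivity))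
      convert! this using 1
      rw [id, Real.rpow_sub_one (by positivity)]
      field_simp
    exact a1.mul a2
  have d2 : HasDerivAt (fun s : ℝ => Complex.exp ((-Complex.I / (4 * (s : ℂ))) *
      ((‖x‖ ^ 2 : ℝ) : ℂ))) (Complex.exp ((-Complex.I / (4 * (t : ℂ))) * ((‖x‖ ^ 2 : ℝ) : ℂ)) *
        (Complex.I / (4 * (t : ℂ) ^ 2) * ((‖x‖ ^ 2 : ℝ) : ℂ))) t := by
    have b1 : HasDerivAt (fun s : ℝ => -Complex.I / (4 * (s : ℂ)))
        (Complex.I / (4 * (t : ℂ) ^ 2)) t := by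
      have := (((hasDerivAt_id t).ofReal_comp).const_mul (4 : ℂ)).fun_inv (by simp [htc])
      have := this.const_mul (-Complex.I)
      convert! this using 1
      simp
      field_simp
    exact (b1.mul_const _).cexp
  have d3 : HasDerivAt (fun s : ℝ => χ ((4 * Real.pi * s)⁻¹ • x))
      (-((t : ℂ)⁻¹ * fderiv ℝ χ ((4 * Real.pi * t)⁻¹ • x) ((4 * Real.pi * t)⁻¹ • x))) t := by
    have c1 : HasDerivAt (fun s : ℝ => (4 * Real.pi * s)⁻¹) (-(t⁻¹ * (4 * Real.pi * t)⁻¹)) t := by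
      have := ((hasDerivAt_id t).const_mul (4 * Real.pi)).fun_inv (by simp; positivity)
      convert! this using 1
      simp
      field_simp
    have c2 := ((hχ2.differentiable (by norm_num)
      ((4 * Real.pi * t)⁻¹ • x)).hasFDerivAt.comp_hasDerivAt t (c1.smul_const x))
    convert! c2 using 1
    simp only [map_smul, neg_smul, map_neg, mul_smul]
    simp
  have hd := (d1.fun_mul (d2.fun_mul d3)).deriv
  have e1 : deriv (fun s => wavePacket θ χ L (s, x)) t = _ := hd
  have hf : (fun y => wavePacket θ χ L (t, y)) =
      ((θ (t / L) * (4 * Real.pi * t) ^ (-(N : ℝ) / 2) : ℝ) : ℂ) •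
        (fun y : Space N => Complex.exp ((-Complex.I / (4 * (t : ℂ))) * ((‖y‖ ^ 2 : ℝ) : ℂ)) *
      χ ((4 * Real.pi * t)⁻¹ • y)) := by
    ext y; simp [wavePacket]
  have e2 := InnerProductSpace.laplacian_smul
    ((θ (t / L) * (4 * Real.pi * t) ^ (-(N : ℝ) / 2) : ℝ) : ℂ)
    ((contDiff_cexp_norm_sq (-Complex.I / (4 * (t : ℂ)))).mul hr).contDiffAt (x := x)
  rw [laplacian_cexp_mul _ hr, laplacian_comp_smul _ hχ2, fderiv_comp_smul] at e2
  simp only [transposeSchrodinger]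
  rw [e1, hf, e2]
  simp only [smul_eq_mul, _root_.smul_apply, map_smul, Complex.real_smul]
  push_cast
  field_simp
  ring_nf

lemma wavePacket_eq_zero {N : ℕ} {θ : ℝ → ℝ} {χ : Space N → ℂ} {L : ℝ} (hL : 0 < L)
    (hθ : ∀ s < 1, θ s = 0) {p : ℝ × Space N} (hp : p.1 < L) : wavePacket θ χ L p = 0 := by
  simp [wavePacket, hθ (p.1 / L) ((div_lt_one hL).2 hp)]

lemma transposeSchrodinger_wavePacket_eq_zero {N : ℕ} {θ : ℝ → ℝ} {χ : Space N → ℂ} {L : ℝ}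
    (hL : 0 < L) (hθ : ∀ s < 1, θ s = 0) {p : ℝ × Space N} (hp : p.1 < L) :
    transposeSchrodinger (wavePacket θ χ L) p = 0 := by
  have h1 : (fun t => wavePacket θ χ L (t, p.2)) =ᶠ[𝓝 p.1] fun _ => 0 := by
    filter_upwards [Iio_mem_nhds hp] with t ht
    exact wavePacket_eq_zero hL hθ ht
  have h2 : (fun x => wavePacket θ χ L (p.1, x)) = fun _ => 0 := by
    ext x
    exact wavePacket_eq_zero hL hθ hp
  rw [transposeSchrodinger, h1.deriv_eq, h2]
  simp

/-- The phase and the amplitude are singular at t = 0, but the cutoff vanishes for t < L; for L ≤ t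
≤ 3L the dilates of the support of χ stay in one ball. -/
lemma isTestFunction_wavePacket {N : ℕ} {θ : ℝ → ℝ} {χ : Space N → ℂ} (hθ : ContDiff ℝ ∞ θ)
    (hχ : ContDiff ℝ ∞ χ) (hχc : HasCompactSupport χ) (hθ1 : ∀ s < 1, θ s = 0)
    (hθ3 : ∀ s, 3 < s → θ s = 0) {L : ℝ} (hL : 0 < L) :
    IsTestFunction (wavePacket θ χ L) := by
  obtain ⟨R, hR⟩ := hχc.isCompact.isBounded.subset_closedBall (0 : Space N)
  have hR' : ∀ x : Space N, max R 0 < ‖x‖ → χ x = 0 := fun x hx => by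
    by_contra h
    have := hR (subset_tsupport _ h)
    rw [mem_closedBall_zero_iff] at this
    exact absurd (this.trans (le_max_left _ _)) (not_le.2 hx)
  have hsub : tsupport (wavePacket θ χ L) ⊆ Icc L (3 * L) ×ˢ
      Metric.closedBall (0 : Space N) (4 * Real.pi * (3 * L) * max R 0) := by
    refine closure_minimal ?_ (isClosed_Icc.prod Metric.isClosed_closedBall)
    rintro ⟨t, x⟩ hp
    have ht1 : L ≤ t := by
      by_contra! h
      exact hp (wavePacket_eq_zero hL hθ1 h)
    have ht3 : t ≤ 3 * L := by
      by_contra! h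
      exact hp (by simp [wavePacket, hθ3 (t / L) ((lt_div_iff₀ hL).2 h)])
    refine ⟨⟨ht1, ht3⟩, ?_⟩
    rw [mem_closedBall_zero_iff]
    by_contra! h
    have ht : 0 < 4 * Real.pi * t := by have := hL.trans_le ht1; positivity
    refine hp ?_
    have : χ ((4 * Real.pi * t)⁻¹ • x) = 0 := by
      refine hR' _ ?_
      rw [norm_smul, norm_inv, Real.norm_of_nonneg ht.le, inv_mul_eq_div, lt_div_iff₀ ht]
      refine lt_of_le_of_lt ?_ h
      rw [mul_comm]
      have : (0 : ℝ) ≤ max R 0 := le_max_right _ _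
      gcongr
    simp only [wavePacket, this, mul_zero]
  refine ⟨?_, (isCompact_Icc.prod (isCompact_closedBall _ _)).of_isClosed_subset
    (isClosed_tsupport _) hsub, hsub.trans (prod_mono (fun t ht => hL.trans_le ht.1)
      (subset_univ _))⟩
  rw [contDiff_iff_contDiffAt]
  rintro ⟨t, x⟩
  by_cases ht : t < L
  · refine (contDiffAt_const (c := (0 : ℂ))).congr_of_eventuallyEq ?_
    filter_upwards [(isOpen_Iio.preimage continuous_fst).mem_nhds
      (show (t, x) ∈ Prod.fst ⁻¹' Iio L from ht)] with p hp
    exact wavePacket_eq_zero hL hθ1 hp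
  have ht0 : 0 < t := hL.trans_le (not_lt.1 ht)
  have h1 : ContDiffAt ℝ ∞ (fun p : ℝ × Space N => 4 * Real.pi * p.1) (t, x) := by fun_prop
  have h1' : 4 * Real.pi * (t, x).1 ≠ 0 := by positivity
  have h2 : ContDiffAt ℝ ∞ (fun p : ℝ × Space N =>
      θ (p.1 / L) * (4 * Real.pi * p.1) ^ (-(N : ℝ) / 2)) (t, x) := by
    refine ContDiffAt.mul ?_ (h1.rpow_const_of_ne h1')
    exact hθ.contDiffAt.comp _ (contDiffAt_fst.div_const L)
  have h3 : ContDiffAt ℝ ∞ (fun p : ℝ × Space N => χ ((4 * Real.pi * p.1)⁻¹ • p.2)) (t, x) :=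
    hχ.contDiffAt.comp (t, x) ((h1.inv h1').smul contDiffAt_snd)
  have h4 : ContDiffAt ℝ ∞ (fun p : ℝ × Space N => -Complex.I / (4 * (p.1 : ℂ))) (t, x) := by
    have : ContDiffAt ℝ ∞ (fun p : ℝ × Space N => (4 * (p.1 : ℂ))) (t, x) :=
      contDiffAt_const.mul (Complex.ofRealCLM.contDiff.contDiffAt.comp _ contDiffAt_fst)
    have h := this.inv (by simpa using ht0.ne')
    simp only [div_eq_mul_inv]
    exact contDiffAt_const.mul h
  have h5 : ContDiffAt ℝ ∞ (fun p : ℝ × Space N => ((‖p.2‖ ^ 2 : ℝ) : ℂ)) (t, x) :=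
    Complex.ofRealCLM.contDiff.contDiffAt.comp _ (contDiffAt_snd.norm_sq ℝ)
  exact (Complex.ofRealCLM.contDiff.contDiffAt.comp _ h2).mul ((h4.mul h5).cexp.mul h3)

/-! ### The L² Fourier transform and the kernel of the free propagator -/

lemma integral_smul_fourier {N : ℕ} {φ g : Space N → ℂ} (hφ : Integrable φ) (hg : Integrable g) :
    ∫ x, φ x * 𝓕 g x = ∫ x, 𝓕 φ x * g x := by
  have h := VectorFourier.integral_fourierIntegral_smul_eq_flip (L := innerₗ (Space N)) (μ := volume)
    (ν := volume) Real.continuous_fourierChar continuous_inner hφ hg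
  rw [flip_innerₗ] at h
  exact h.symm

lemma ae_eq_of_forall_schwartz {N : ℕ} {f g : Space N → ℂ} (hf : LocallyIntegrable f)
    (hg : LocallyIntegrable g)
    (h : ∀ φ : SchwartzMap (Space N) ℂ, ∫ x, φ x * f x = ∫ x, φ x * g x) : f =ᵐ[volume] g := by
  refine ae_eq_of_integral_contDiff_smul_eq hf hg fun φ hφ hφc => ?_
  have h1 : HasCompactSupport (fun x => (φ x : ℂ)) := hφc.comp_left (g := fun r : ℝ => (r : ℂ)) rfl
  have h2 : ContDiff ℝ ∞ (fun x => (φ x : ℂ)) := Complex.ofRealCLM.contDiff.comp hφ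
  simpa using h (h1.toSchwartzMap h2)

/-- Both transforms satisfy the multiplication formula against Schwartz functions, and such pairings
determine a locally integrable function. -/
lemma fourier_toLp_ae {N : ℕ} {g : Space N → ℂ} (hg : Integrable g) (hg2 : MemLp g 2) :
    ((𝓕 (hg2.toLp g) : L2 N) : Space N → ℂ) =ᵐ[volume] 𝓕 g := by
  have hc : Continuous (𝓕 g) := VectorFourier.fourierIntegral_continuous
    Real.continuous_fourierChar continuous_inner hg
  refine ae_eq_of_forall_schwartz ((Lp.memLp _).locallyIntegrable (by norm_num))
    hc.locallyIntegrable fun φ => ?_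
  have h1 := congrArg (fun T => T φ) (Lp.fourier_toTemperedDistribution_eq (hg2.toLp g))
  simp only [TemperedDistribution.fourier_apply, Lp.toTemperedDistribution_apply, smul_eq_mul,
    SchwartzMap.fourier_coe] at h1
  rw [integral_smul_fourier φ.integrable hg, ← h1]
  refine integral_congr_ae ?_
  filter_upwards [hg2.coeFn_toLp] with x hx
  rw [hx]

lemma fourierInv_toLp_ae {N : ℕ} {g : Space N → ℂ} (hg : Integrable g) (hg2 : MemLp g 2) :
    ((𝓕⁻ (hg2.toLp g) : L2 N) : Space N → ℂ) =ᵐ[volume] 𝓕⁻ g := by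
  have hc : Continuous (𝓕⁻ g) := by
    rw [Real.fourierInv_eq_fourier_comp_neg]
    exact VectorFourier.fourierIntegral_continuous
      Real.continuous_fourierChar continuous_inner hg.comp_neg
  refine ae_eq_of_forall_schwartz ((Lp.memLp _).locallyIntegrable (by norm_num))
    hc.locallyIntegrable fun φ => ?_
  have h1 := congrArg (fun T => T φ) (Lp.fourierInv_toTemperedDistribution_eq (hg2.toLp g))
  simp only [TemperedDistribution.fourierInv_apply, Lp.toTemperedDistribution_apply, smul_eq_mul,
    SchwartzMap.fourierInv_coe] at h1
  have h2 : ∫ x, φ x * 𝓕⁻ g x = ∫ x, 𝓕⁻ (φ : Space N → ℂ) x * g x := by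
    rw [Real.fourierInv_eq_fourier_comp_neg (φ : Space N → ℂ), 
      ← integral_smul_fourier φ.integrable.comp_neg hg, ← integral_neg_eq_self]
    simp [Real.fourierInv_eq_fourier_neg]
  rw [h2, ← h1]
  refine integral_congr_ae ?_
  filter_upwards [hg2.coeFn_toLp] with x hx
  rw [hx]

/-- The multiplication formula moves the transform onto the Gaussian, which is integrable because Re
b > 0; the Schrödinger kernel is the limit of b towards the imaginary axis. -/
lemma regularized_kernel {N : ℕ} (f : SchwartzMap (Space N) ℂ) {b : ℂ} (hb : 0 < b.re)
    (x : Space N) :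
    ∫ ξ, Complex.exp (-b * ‖ξ‖ ^ 2 + 2 * Real.pi * Complex.I * (inner ℝ x ξ : ℝ)) *
        𝓕 (f : Space N → ℂ) ξ =
      (Real.pi / b) ^ (N / 2 : ℂ) * ∫ y, Complex.exp (-Real.pi ^ 2 * ‖x - y‖ ^ 2 / b) * f y := by
  rw [integral_smul_fourier _ f.integrable, ← integral_const_mul]
  · refine integral_congr_ae (Eventually.of_forall fun y => ?_)
    simp only
    rw [fourier_gaussian_innerProductSpace' hb]
    simp
    ring
  · have := GaussianFourier.integrable_cexp_neg_mul_sq_norm_add hb (2 * Real.pi * Complex.I) x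
    exact this

lemma norm_cexp_le_one {z : ℂ} (hz : z.re ≤ 0) : ‖Complex.exp z‖ ≤ 1 := by
  rw [Complex.norm_exp]
  exact Real.exp_le_one_iff.2 hz

lemma fourierInv_symbol_mul {N : ℕ} (f : SchwartzMap (Space N) ℂ) {t : ℝ} (ht : 0 < t)
    (x : Space N) :
    𝓕⁻ (fun ξ => symbol t ξ * 𝓕 (f : Space N → ℂ) ξ) x =
      (Real.pi / (4 * Real.pi ^ 2 * t * Complex.I)) ^ (N / 2 : ℂ) *
        ∫ y, Complex.exp (Complex.I * ((‖x - y‖ ^ 2 / (4 * t) : ℝ) : ℂ)) * f y := by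
  -- Damping ε > 0 makes the oscillating Gaussian integrable. Both sides of `regularized_kernel`
  -- converge as ε → 0 by dominated convergence, since the exponentials have modulus at most one.
  set b : ℝ → ℂ := fun ε => ε + 4 * Real.pi ^ 2 * t * Complex.I
  have hbre : ∀ ε, (b ε).re = ε := fun ε => by
    have : b ε = ε + ((4 * Real.pi ^ 2 * t : ℝ) : ℂ) * Complex.I := by simp [b]
    rw [this]; simp [-Complex.ofReal_mul]
  have hbim : ∀ ε, (b ε).im = 4 * Real.pi ^ 2 * t := fun ε => by
    have : b ε = ε + ((4 * Real.pi ^ 2 * t : ℝ) : ℂ) * Complex.I := by simp [b]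
    rw [this]; simp [-Complex.ofReal_mul]
  have hb0 : ∀ ε, b ε ≠ 0 := fun ε h => by
    have := hbim ε
    rw [h] at this
    simp at this
    exact absurd this ht.ne'
  have hbc : Continuous b := by fun_prop
  have hF : Integrable (𝓕 (f : Space N → ℂ)) := by
    rw [← SchwartzMap.fourier_coe]; exact (𝓕 f).integrable
  have l1 : Tendsto (fun ε : ℝ => ∫ ξ, Complex.exp (-b ε * ‖ξ‖ ^ 2 +
      2 * Real.pi * Complex.I * (inner ℝ x ξ : ℝ)) * 𝓕 (f : Space N → ℂ) ξ) (𝓝[>] 0)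
      (𝓝 (∫ ξ, Complex.exp (-b 0 * ‖ξ‖ ^ 2 +
      2 * Real.pi * Complex.I * (inner ℝ x ξ : ℝ)) * 𝓕 (f : Space N → ℂ) ξ)) := by
    refine tendsto_integral_filter_of_dominated_convergence (fun ξ => ‖𝓕 (f : Space N → ℂ) ξ‖)
      ?_ ?_ hF.norm ?_
    · refine Eventually.of_forall fun ε => AEStronglyMeasurable.mul ?_ hF.1
      exact Continuous.aestronglyMeasurable (by fun_prop)
    · filter_upwards [self_mem_nhdsWithin] with ε hε
      refine Eventually.of_forall fun ξ => ?_
      rw [norm_mul]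
      refine mul_le_of_le_one_left (norm_nonneg _) (norm_cexp_le_one ?_)
      have : (-b ε * ‖ξ‖ ^ 2 + 2 * Real.pi * Complex.I * (inner ℝ x ξ : ℝ)) =
        -(b ε * ((‖ξ‖ ^ 2 : ℝ) : ℂ)) + ((2 * Real.pi * inner ℝ x ξ : ℝ) : ℂ) * Complex.I := by
        push_cast; ring
      rw [this, Complex.add_re, Complex.neg_re, Complex.re_mul_ofReal, Complex.re_ofReal_mul, hbre]
      have hε' : (0 : ℝ) < ε := hε
      simp
      positivity
    · refine Eventually.of_forall fun ξ => Tendsto.mono_left ?_ nhdsWithin_le_nhds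
      exact Continuous.tendsto (by fun_prop) 0
  have l2 : Tendsto (fun ε : ℝ => ∫ y, Complex.exp (-Real.pi ^ 2 * ‖x - y‖ ^ 2 / b ε) * f y)
      (𝓝[>] 0) (𝓝 (∫ y, Complex.exp (-Real.pi ^ 2 * ‖x - y‖ ^ 2 / b 0) * f y)) := by
    refine tendsto_integral_filter_of_dominated_convergence (fun y => ‖f y‖)
      ?_ ?_ f.integrable.norm ?_
    · refine Eventually.of_forall fun ε => AEStronglyMeasurable.mul ?_ f.integrable.1
      exact Continuous.aestronglyMeasurable (by fun_prop)
    · filter_upwards [self_mem_nhdsWithin] with ε hε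
      refine Eventually.of_forall fun y => ?_
      rw [norm_mul]
      refine mul_le_of_le_one_left (norm_nonneg _) (norm_cexp_le_one ?_)
      have : (-Real.pi ^ 2 * ‖x - y‖ ^ 2 / b ε) =
        ((-(Real.pi ^ 2 * ‖x - y‖ ^ 2) : ℝ) : ℂ) * (b ε)⁻¹ := by
        push_cast; ring
      rw [this, Complex.re_ofReal_mul, Complex.inv_re, hbre]
      have hε' : (0 : ℝ) < ε := hε
      have : 0 ≤ Real.pi ^ 2 * ‖x - y‖ ^ 2 * (ε / Complex.normSq (b ε)) :=
        mul_nonneg (by positivity) (div_nonneg hε'.le (Complex.normSq_nonneg _))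
      linarith
    · refine Eventually.of_forall fun y => Tendsto.mono_left ?_ nhdsWithin_le_nhds
      refine Continuous.tendsto (f := fun ε => Complex.exp (-Real.pi ^ 2 * ‖x - y‖ ^ 2 / b ε) * f y) ?_ 0
      exact ((continuous_const.div hbc hb0).cexp).mul continuous_const
  -- The imaginary part of π / b(0) is nonzero, so the limit avoids the branch cut of the complex
  -- power.
  have l3 : Tendsto (fun ε : ℝ => (Real.pi / b ε : ℂ) ^ (N / 2 : ℂ)) (𝓝[>] 0)
      (𝓝 ((Real.pi / b 0 : ℂ) ^ (N / 2 : ℂ))) := by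
    refine Tendsto.mono_left ?_ nhdsWithin_le_nhds
    refine ContinuousAt.cpow ((continuous_const.div hbc hb0).continuousAt) continuousAt_const ?_
    refine Or.inr ?_
    rw [div_eq_mul_inv, Complex.im_ofReal_mul, Complex.inv_im, hbim]
    have h1 : 0 < Complex.normSq (b 0) := Complex.normSq_pos.2 (hb0 0)
    have := Real.pi_pos
    refine mul_ne_zero this.ne' (div_ne_zero (neg_ne_zero.2 (by positivity)) h1.ne')
  have key := tendsto_nhds_unique (l1.congr' (by
    filter_upwards [self_mem_nhdsWithin] with ε hε
    exact regularized_kernel f (by rw [hbre]; exact hε) x)) (l3.mul l2)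
  have e0 : b 0 = 4 * Real.pi ^ 2 * t * Complex.I := by simp [b]
  have htc : (t : ℂ) ≠ 0 := by exact_mod_cast ht.ne'
  have hπc : (Real.pi : ℂ) ≠ 0 := by exact_mod_cast Real.pi_pos.ne'
  rw [e0] at key
  rw [Real.fourierInv_eq']
  convert! key using 1
  · refine integral_congr_ae (Eventually.of_forall fun ξ => ?_)
    simp only [symbol, smul_eq_mul]
    rw [← mul_assoc, ← Complex.exp_add, real_inner_comm]
    congr 2
    push_cast
    ring
  · congr 2
    ext y
    congr 2
    push_cast
    field_simp
    rw [Complex.I_sq, neg_one_mul]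

/-! ### The pseudoconformal transform and the asymptotics of the free flow -/

/-- The pseudoconformal transformation at time `t`, up to a constant phase. -/
noncomputable def pconf {N : ℕ} (t : ℝ) (h : Space N → ℂ) (ξ : Space N) : ℂ :=
  (((4 * Real.pi * t) ^ ((N : ℝ) / 2) : ℝ) : ℂ) *
    (Complex.exp (-Complex.I * ((4 * Real.pi ^ 2 * t * ‖ξ‖ ^ 2 : ℝ) : ℂ)) *
      h ((4 * Real.pi * t) • ξ))

lemma norm_pconf {N : ℕ} {t : ℝ} (ht : 0 < t) (h : Space N → ℂ) (ξ : Space N) :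
    ‖pconf t h ξ‖ = (4 * Real.pi * t) ^ ((N : ℝ) / 2) * ‖h ((4 * Real.pi * t) • ξ)‖ := by
  rw [pconf, norm_mul, norm_mul, Complex.norm_exp, Complex.norm_of_nonneg (by positivity)]
  simp [-Complex.ofReal_mul, -Complex.ofReal_pow]

lemma pconf_sub {N : ℕ} (t : ℝ) (h k : Space N → ℂ) :
    pconf t (fun x => h x - k x) = fun ξ => pconf t h ξ - pconf t k ξ := by
  ext ξ; simp only [pconf]; ring

lemma lintegral_comp_smul {N : ℕ} {r : ℝ} (hr : 0 < r) (F : Space N → ENNReal) :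
    ENNReal.ofReal (r ^ N) * ∫⁻ ξ, F (r • ξ) = ∫⁻ x, F x := by
  have h := (Homeomorph.smulOfNeZero r hr.ne' : Space N ≃ₜ Space N).measurableEmbedding.lintegral_map
    (μ := volume) F
  have h2 : Measure.map (Homeomorph.smulOfNeZero r hr.ne' : Space N ≃ₜ Space N) volume =
    ENNReal.ofReal |(r ^ N)⁻¹| • (volume : Measure (Space N)) := by
    have := Measure.map_addHaar_smul (volume : Measure (Space N)) hr.ne'
    simpa using this
  rw [h2, lintegral_smul_measure] at h
  simp only [Homeomorph.smulOfNeZero_apply] at h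
  rw [← h, smul_eq_mul, ← mul_assoc, ← ENNReal.ofReal_mul (by positivity),
    abs_of_pos (by positivity), mul_inv_cancel₀ (by positivity)]
  simp

lemma eLpNorm_two_sq {N : ℕ} (f : Space N → ℂ) :
    eLpNorm f 2 volume ^ 2 = ∫⁻ x, ‖f x‖ₑ ^ 2 := by
  have := eLpNorm_nnreal_pow_eq_lintegral (p := 2) (f := f) (μ := volume) two_ne_zero
  simpa using this

lemma eLpNorm_pconf {N : ℕ} {t : ℝ} (ht : 0 < t) (h : Space N → ℂ) :
    eLpNorm (pconf t h) 2 volume = eLpNorm h 2 volume := by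
  have hr : 0 < 4 * Real.pi * t := by positivity
  have key : eLpNorm (pconf t h) 2 volume ^ 2 = eLpNorm h 2 volume ^ 2 := by
    rw [eLpNorm_two_sq, eLpNorm_two_sq, ← lintegral_comp_smul hr (fun x => ‖h x‖ₑ ^ 2),
      ← lintegral_const_mul' _ _ ENNReal.ofReal_ne_top]
    refine lintegral_congr fun ξ => ?_
    rw [← ofReal_norm, ← ofReal_norm, norm_pconf ht,
      ENNReal.ofReal_mul (by positivity), mul_pow,
      ← ENNReal.ofReal_pow (by positivity), ← Real.rpow_mul_natCast hr.le, ← Real.rpow_natCast]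
    congr 3
    push_cast
    ring
  exact (ENNReal.pow_right_strictMono two_ne_zero).injective key

lemma pconf_congr_ae {N : ℕ} {t : ℝ} (ht : 0 < t) {h k : Space N → ℂ} (hk : h =ᵐ[volume] k) :
    pconf t h =ᵐ[volume] pconf t k := by
  have hr : 0 < 4 * Real.pi * t := by positivity
  have := (Measure.quasiMeasurePreserving_smul (volume : Measure (Space N)) hr.ne').ae hk
  filter_upwards [this] with ξ hξ
  rw [pconf, pconf, hξ]

lemma aestronglyMeasurable_pconf {N : ℕ} {t : ℝ} (ht : 0 < t) {h : Space N → ℂ}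
    (hh : AEStronglyMeasurable h) : AEStronglyMeasurable (pconf t h) := by
  have hr : 0 < 4 * Real.pi * t := by positivity
  refine AEStronglyMeasurable.const_mul (AEStronglyMeasurable.mul ?_ ?_) _
  · exact Continuous.aestronglyMeasurable (by fun_prop)
  · exact hh.comp_quasiMeasurePreserving
      (Measure.quasiMeasurePreserving_smul (volume : Measure (Space N)) hr.ne')

/-- Multiplication by the quadratic phase `exp(i|y|²/(4t))`. -/
noncomputable def chirp {N : ℕ} (t : ℝ) (f : Space N → ℂ) (y : Space N) : ℂ :=
  Complex.exp (Complex.I * ((‖y‖ ^ 2 / (4 * t) : ℝ) : ℂ)) * f y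

lemma norm_chirp {N : ℕ} (t : ℝ) (f : Space N → ℂ) (y : Space N) : ‖chirp t f y‖ = ‖f y‖ := by
  rw [chirp, norm_mul, Complex.norm_exp]
  simp [-Complex.ofReal_mul, -Complex.ofReal_pow, -Complex.ofReal_div]

lemma aestronglyMeasurable_chirp {N : ℕ} (t : ℝ) {f : Space N → ℂ}
    (hf : AEStronglyMeasurable f) : AEStronglyMeasurable (chirp t f) :=
  AEStronglyMeasurable.mul (Continuous.aestronglyMeasurable (by fun_prop)) hf

/-- Expand |4πtξ - y|²/(4t) in the kernel: the |ξ|² term is the phase removed by `pconf`, the cross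
term is the Fourier kernel, and the |y|² term is the chirp. -/
lemma pconf_fourierInv_symbol {N : ℕ} (f : SchwartzMap (Space N) ℂ) {t : ℝ} (ht : 0 < t)
    (ξ : Space N) :
    pconf t (𝓕⁻ (fun ξ => symbol t ξ * 𝓕 (f : Space N → ℂ) ξ)) ξ =
      (-Complex.I) ^ (N / 2 : ℂ) * 𝓕 (chirp t f) ξ := by
  have hr : 0 < 4 * Real.pi * t := by positivity
  have htc : (t : ℂ) ≠ 0 := by exact_mod_cast ht.ne'
  have hπc : (Real.pi : ℂ) ≠ 0 := by exact_mod_cast Real.pi_pos.ne'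
  rw [pconf, fourierInv_symbol_mul f ht]
  have e1 : (Real.pi / (4 * Real.pi ^ 2 * t * Complex.I) : ℂ) =
      (((4 * Real.pi * t)⁻¹ : ℝ) : ℂ) * (-Complex.I) := by
    push_cast
    field_simp
    simp
  have e2 : ((((4 * Real.pi * t)⁻¹ : ℝ) : ℂ) * (-Complex.I)) ^ (N / 2 : ℂ) =
      (((4 * Real.pi * t) ^ ((N : ℝ) / 2) : ℝ) : ℂ)⁻¹ * (-Complex.I) ^ (N / 2 : ℂ) := by
    have : (((4 * Real.pi * t)⁻¹ : ℝ) : ℂ) ^ (N / 2 : ℂ) =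
        (((4 * Real.pi * t) ^ ((N : ℝ) / 2) : ℝ) : ℂ)⁻¹ := by
      rw [← Complex.ofReal_inv, ← Real.inv_rpow hr.le, Complex.ofReal_cpow (by positivity)]
      simp
    rw [← this]
    by_cases hN : (N / 2 : ℂ) = 0
    · simp [hN]
    rw [Complex.cpow_def_of_ne_zero (by simp [htc, hπc]), Complex.cpow_def_of_ne_zero
      (by simp [htc, hπc]), Complex.cpow_def_of_ne_zero (by simp), ← Complex.exp_add,
      Complex.log_ofReal_mul (by positivity) (by simp), Complex.ofReal_log (by positivity)]
    ring_nf
  have hr' : (((4 * Real.pi * t) ^ ((N : ℝ) / 2) : ℝ) : ℂ) ≠ 0 := by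
    exact_mod_cast (Real.rpow_pos_of_pos hr _).ne'
  rw [e1, e2, Real.fourier_eq']
  rw [show ∀ a b c d e : ℂ, a * (b * (c * d * e)) = (a * c) * d * (b * e) by intros; ring,
    mul_inv_cancel₀ hr', one_mul, ← integral_const_mul]
  congr 1
  refine integral_congr_ae (Eventually.of_forall fun y => ?_)
  simp only [chirp, smul_eq_mul]
  rw [← mul_assoc, ← mul_assoc, ← Complex.exp_add, ← Complex.exp_add]
  congr 2
  have e3 : ‖(4 * Real.pi * t) • ξ - y‖ ^ 2 = (4 * Real.pi * t) ^ 2 * ‖ξ‖ ^ 2 -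
      2 * (4 * Real.pi * t) * inner ℝ y ξ + ‖y‖ ^ 2 := by
    rw [norm_sub_sq_real, norm_smul, Real.norm_of_nonneg hr.le, inner_smul_left, real_inner_comm]
    simp
    ring
  rw [e3]
  push_cast
  field_simp
  ring

lemma norm_phase (N : ℕ) : ‖(-Complex.I) ^ (N / 2 : ℂ)‖ = 1 := by
  have : (N / 2 : ℂ) = (((N : ℝ) / 2 : ℝ) : ℂ) := by push_cast; ring
  rw [this, Complex.norm_cpow_real]
  simp

lemma freeSchrodinger_toLp_ae {N : ℕ} (f : SchwartzMap (Space N) ℂ) (t : ℝ) :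
    (freeSchrodinger t (f.toLp 2) : Space N → ℂ) =ᵐ[volume]
      𝓕⁻ (fun ξ => symbol t ξ * 𝓕 (f : Space N → ℂ) ξ) := by
  have hF : Integrable (𝓕 (f : Space N → ℂ)) := by
    rw [← SchwartzMap.fourier_coe]; exact (𝓕 f).integrable
  have hF2 : MemLp (𝓕 (f : Space N → ℂ)) 2 := by
    rw [← SchwartzMap.fourier_coe]; exact (𝓕 f).memLp 2
  have h1 : Integrable (fun ξ => symbol t ξ * 𝓕 (f : Space N → ℂ) ξ) := by
    refine hF.mono ((continuous_symbol t).aestronglyMeasurable.mul hF.1) ?_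
    exact Eventually.of_forall fun ξ => by rw [norm_mul, norm_symbol, one_mul]
  have h2 : MemLp (fun ξ => symbol t ξ * 𝓕 (f : Space N → ℂ) ξ) 2 := by
    refine hF2.of_le ((continuous_symbol t).aestronglyMeasurable.mul hF.1) ?_
    exact Eventually.of_forall fun ξ => by rw [norm_mul, norm_symbol, one_mul]
  have h3 : freeSchrodinger t (f.toLp 2) = 𝓕⁻ (h2.toLp _) := by
    rw [freeSchrodinger]
    congr 1
    rw [MemLp.toLp_eq_toLp_iff, SchwartzMap.toLp_fourier_eq]
    filter_upwards [(𝓕 f).coeFn_toLp 2 volume] with ξ hξ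
    rw [hξ, SchwartzMap.fourier_coe]
  rw [h3]
  exact fourierInv_toLp_ae h1 h2

lemma norm_fourier_sub {N : ℕ} (u v : L2 N) : ‖(𝓕 u : L2 N) - 𝓕 v‖ = ‖u - v‖ := by
  have := (Lp.fourierTransformₗᵢ (Space N) ℂ).norm_map (u - v)
  rw [map_sub] at this
  exact this

lemma norm_freeSchrodinger_sub {N : ℕ} (t : ℝ) (f g : L2 N) :
    ‖freeSchrodinger t f - freeSchrodinger t g‖ = ‖f - g‖ := by
  have e1 : freeSchrodinger t f - freeSchrodinger t g =
      (Lp.fourierTransformₗᵢ (Space N) ℂ).symm ((memLp_symbol_mul t (𝓕 f)).toLp _ -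
        (memLp_symbol_mul t (𝓕 g)).toLp _) := by
    rw [map_sub]; rfl
  rw [e1, LinearIsometryEquiv.norm_map, ← norm_fourier_sub f g, ← MemLp.toLp_sub, Lp.norm_toLp, Lp.norm_def]
  congr 1
  refine eLpNorm_congr_norm_ae ?_
  filter_upwards [Lp.coeFn_sub (𝓕 f : L2 N) (𝓕 g)] with ξ hξ
  rw [hξ, Pi.sub_apply, Pi.sub_apply, ← mul_sub, norm_mul, norm_symbol, one_mul]

lemma tendsto_chirp {N : ℕ} {f : Space N → ℂ} (hf : MemLp f 2) :
    Tendsto (fun t : ℝ => eLpNorm (fun y => chirp t f y - f y) 2 volume) atTop (𝓝 0) := by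
  have h : Tendsto (fun t : ℝ => ∫⁻ y, ‖chirp t f y - f y‖ₑ ^ 2) atTop (𝓝 (∫⁻ _ : Space N, 0)) := by
    refine tendsto_lintegral_filter_of_dominated_convergence' (fun y => 4 * ‖f y‖ₑ ^ 2) ?_ ?_ ?_ ?_
    · exact Eventually.of_forall fun t =>
        ((aestronglyMeasurable_chirp t hf.1).sub hf.1).enorm.pow_const 2
    · refine Eventually.of_forall fun t => Eventually.of_forall fun y => ?_
      calc ‖chirp t f y - f y‖ₑ ^ 2 ≤ (‖chirp t f y‖ₑ + ‖f y‖ₑ) ^ 2 := by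
            gcongr; exact enorm_sub_le
        _ = 4 * ‖f y‖ₑ ^ 2 := by
            rw [← ofReal_norm (chirp t f y), norm_chirp, ofReal_norm]; ring
    · rw [lintegral_const_mul' _ _ (by norm_num), ← eLpNorm_two_sq]
      exact ENNReal.mul_ne_top (by norm_num) (ENNReal.pow_ne_top hf.2.ne)
    · refine Eventually.of_forall fun y => ?_
      have h1 : Tendsto (fun t : ℝ => chirp t f y) atTop (𝓝 (f y)) := by
        have : Tendsto (fun t : ℝ => ‖y‖ ^ 2 / (4 * t)) atTop (𝓝 0) :=
          tendsto_const_nhds.div_atTop (tendsto_id.const_mul_atTop (by norm_num))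
        have h2 := ((Complex.continuous_ofReal.tendsto 0).comp this).const_mul Complex.I
        have h3 := (h2.cexp).mul_const (f y)
        simpa [chirp] using h3
      have h4 := ENNReal.Tendsto.pow (n := 2) ((h1.sub_const (f y)).enorm)
      simpa using h4
  simp only [lintegral_const, zero_mul] at h
  have h5 := h.ennrpow_const (1 / 2)
  rw [ENNReal.zero_rpow_of_pos (by norm_num)] at h5
  refine h5.congr fun t => ?_
  rw [← eLpNorm_two_sq, ← ENNReal.rpow_natCast, ← ENNReal.rpow_mul]
  norm_num

lemma eLpNorm_coe_sub {N : ℕ} (u v : L2 N) :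
    eLpNorm (fun x => u x - v x) 2 volume = ENNReal.ofReal ‖u - v‖ := by
  rw [Lp.norm_def, ENNReal.ofReal_toReal (Lp.eLpNorm_ne_top _)]
  exact eLpNorm_congr_ae (Lp.coeFn_sub u v).symm

lemma eLpNorm_fourier_sub {N : ℕ} (u v : L2 N) :
    eLpNorm (fun ξ => (𝓕 u : L2 N) ξ - (𝓕 v : L2 N) ξ) 2 volume =
      eLpNorm (fun x => u x - v x) 2 volume := by
  rw [eLpNorm_coe_sub, eLpNorm_coe_sub, norm_fourier_sub]

/-- By `pconf_fourierInv_symbol` and Plancherel the error is exactly the L² norm of `chirp t f - f`.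
-/
lemma tendsto_pconf_schwartz {N : ℕ} (f : SchwartzMap (Space N) ℂ) :
    Tendsto (fun t : ℝ => eLpNorm (fun ξ => pconf t (freeSchrodinger t (f.toLp 2)) ξ -
      (-Complex.I) ^ (N / 2 : ℂ) * (𝓕 (f.toLp 2) : L2 N) ξ) 2 volume) atTop (𝓝 0) := by
  have hf2 : MemLp (f : Space N → ℂ) 2 := f.memLp 2
  refine (tendsto_chirp hf2).congr' ?_
  filter_upwards [eventually_gt_atTop 0] with t ht
  have hc1 : Integrable (chirp t f) := f.integrable.mono
    (aestronglyMeasurable_chirp t f.integrable.1) (Eventually.of_forall fun y => (norm_chirp t f y).le)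
  have hc2 : MemLp (chirp t f) 2 := hf2.of_le (aestronglyMeasurable_chirp t f.integrable.1)
    (Eventually.of_forall fun y => (norm_chirp t f y).le)
  calc _ = eLpNorm (fun x => (hc2.toLp _ : L2 N) x - (f.toLp 2 volume : L2 N) x) 2 volume := by
        refine eLpNorm_congr_ae ?_
        filter_upwards [hc2.coeFn_toLp, f.coeFn_toLp 2 volume] with y h2 h3
        rw [h2, h3]
    _ = _ := (eLpNorm_fourier_sub _ _).symm
    _ = _ := by
        refine eLpNorm_congr_norm_ae ?_
        filter_upwards [fourier_toLp_ae hc1 hc2,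
          pconf_congr_ae ht (freeSchrodinger_toLp_ae f t)] with ξ h2 h3
        rw [h2, h3, pconf_fourierInv_symbol f ht, ← mul_sub, norm_mul, norm_phase, one_mul]

/-- Asymptotics of the free Schrödinger evolution. -/
lemma tendsto_pconf_freeSchrodinger {N : ℕ} (f : L2 N) :
    Tendsto (fun t : ℝ => eLpNorm (fun ξ => pconf t (freeSchrodinger t f) ξ -
      (-Complex.I) ^ (N / 2 : ℂ) * (𝓕 f : L2 N) ξ) 2 volume) atTop (𝓝 0) := by
  rw [ENNReal.tendsto_nhds_zero]
  intro ε hε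
  by_cases hεt : ε = ⊤
  · simp [hεt]
  have hε3 : 0 < (ε / 3).toReal := ENNReal.toReal_pos (by simp [hε.ne'])
    (ENNReal.div_ne_top hεt (by norm_num))
  -- Schwartz functions are dense and all the maps involved are L² isometries, so replacing f by S
  -- costs ε/3 on each side, uniformly in t.
  obtain ⟨S, hS, hlim⟩ : ∃ S : L2 N, ‖f - S‖ < (ε / 3).toReal ∧
      Tendsto (fun t : ℝ => eLpNorm (fun ξ => pconf t (freeSchrodinger t S) ξ -
      (-Complex.I) ^ (N / 2 : ℂ) * (𝓕 S : L2 N) ξ) 2 volume) atTop (𝓝 0) := by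
    obtain ⟨s, hs⟩ := (SchwartzMap.denseRange_toLpCLM (E := Space N) (F := ℂ) (p := 2)
      (μ := volume) ENNReal.ofNat_ne_top).exists_dist_lt f hε3
    rw [SchwartzMap.toLpCLM_apply, dist_eq_norm] at hs
    exact ⟨_, hs, tendsto_pconf_schwartz s⟩
  have hle : ENNReal.ofReal ‖f - S‖ ≤ ε / 3 := ENNReal.ofReal_le_of_le_toReal hS.le
  have h1 := ENNReal.tendsto_nhds_zero.1 hlim (ε / 3) (by simpa using hε.ne')
  filter_upwards [h1, eventually_gt_atTop 0] with t h1 ht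
  have h2 : eLpNorm (fun ξ => pconf t (freeSchrodinger t f) ξ -
      pconf t (freeSchrodinger t S) ξ) 2 volume ≤ ε / 3 := by
    rw [← pconf_sub, eLpNorm_pconf ht, eLpNorm_coe_sub, norm_freeSchrodinger_sub]
    exact hle
  have h3 : eLpNorm (fun ξ => (-Complex.I) ^ (N / 2 : ℂ) * (𝓕 S : L2 N) ξ -
      (-Complex.I) ^ (N / 2 : ℂ) * (𝓕 f : L2 N) ξ) 2 volume ≤ ε / 3 := by
    rw [norm_sub_rev, ← norm_fourier_sub, ← eLpNorm_coe_sub] at hle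
    refine le_trans (le_of_eq ?_) hle
    refine eLpNorm_congr_norm_ae (Eventually.of_forall fun ξ => ?_)
    rw [← mul_sub, norm_mul, norm_phase, one_mul]
  have m1 := aestronglyMeasurable_pconf ht (Lp.aestronglyMeasurable (freeSchrodinger t f))
  have m2 := aestronglyMeasurable_pconf ht (Lp.aestronglyMeasurable (freeSchrodinger t S))
  have m3 := (Lp.aestronglyMeasurable (𝓕 S : L2 N)).const_mul ((-Complex.I) ^ (N / 2 : ℂ))
  have m4 := (Lp.aestronglyMeasurable (𝓕 f : L2 N)).const_mul ((-Complex.I) ^ (N / 2 : ℂ))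
  calc _ = eLpNorm ((fun ξ => pconf t (freeSchrodinger t f) ξ -
      pconf t (freeSchrodinger t S) ξ) + ((fun ξ => pconf t (freeSchrodinger t S) ξ -
      (-Complex.I) ^ (N / 2 : ℂ) * (𝓕 S : L2 N) ξ) +
      fun ξ => (-Complex.I) ^ (N / 2 : ℂ) * (𝓕 S : L2 N) ξ -
      (-Complex.I) ^ (N / 2 : ℂ) * (𝓕 f : L2 N) ξ)) 2 volume := by
        congr 1; ext ξ; simp
    _ ≤ ε / 3 + (ε / 3 + ε / 3) := by
        refine (eLpNorm_add_le (m1.sub m2) ((m2.sub m3).add (m3.sub m4)) one_le_two).trans ?_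
        exact add_le_add h2 ((eLpNorm_add_le (m2.sub m3) (m3.sub m4) one_le_two).trans
          (add_le_add h1 h3))
    _ = ε := by rw [← add_assoc]; exact ENNReal.add_thirds ε

/-! ### Young's inequality and two-sided control of the Riesz potential -/

/-- A form of Young's convolution inequality. -/
lemma lintegral_trilinear_le {N : ℕ} {f k e : Space N → ENNReal} (hf : Measurable f)
    (hk : Measurable k) (he : Measurable e) {x y z : ℝ} (hx : 0 ≤ x) (hy : 0 ≤ y) (hz : 0 ≤ z)
    (h : x + y + z = 1) (hA : 0 < x + y) (hB : 0 < x + z) (hC : 0 < y + z) :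
    ∫⁻ ξ, ∫⁻ ζ, f ζ * k (ξ - ζ) * e ξ ≤
      (∫⁻ ζ, f ζ ^ (x + y)⁻¹) ^ (x + y) * (∫⁻ ζ, k ζ ^ (y + z)⁻¹) ^ (y + z) *
        (∫⁻ ζ, e ζ ^ (x + z)⁻¹) ^ (x + z) := by
  set F := ∫⁻ ζ, f ζ ^ (x + y)⁻¹
  set K := ∫⁻ ζ, k ζ ^ (y + z)⁻¹
  set E := ∫⁻ ζ, e ζ ^ (x + z)⁻¹
  -- Each of f, k, e is shared between two of the products X, Y, Z, so that the integrand equals X^y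
  -- Y^x Z^z. Hölder with weights of sum one applies, and the integrals of X, Y, Z factor by
  -- translation invariance.
  let X : Space N × Space N → ENNReal := fun p => f p.2 ^ (x + y)⁻¹ * k (p.1 - p.2) ^ (y + z)⁻¹
  let Y : Space N × Space N → ENNReal := fun p => f p.2 ^ (x + y)⁻¹ * e p.1 ^ (x + z)⁻¹
  let Z : Space N × Space N → ENNReal := fun p => k (p.1 - p.2) ^ (y + z)⁻¹ * e p.1 ^ (x + z)⁻¹
  have hX : Measurable X := by fun_prop
  have hY : Measurable Y := by fun_prop
  have hZ : Measurable Z := by fun_prop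
  have iX : ∫⁻ p, X p ∂(volume.prod volume) = F * K := by
    rw [lintegral_prod_symm _ hX.aemeasurable]
    simp only [X]
    rw [← lintegral_mul_const _ (by fun_prop)]
    refine lintegral_congr fun ζ => ?_
    rw [lintegral_const_mul _ (by fun_prop),
      lintegral_sub_right_eq_self (fun u => k u ^ (y + z)⁻¹) ζ]
  have iY : ∫⁻ p, Y p ∂(volume.prod volume) = F * E := by
    rw [lintegral_prod_symm _ hY.aemeasurable]
    simp only [Y]
    rw [← lintegral_mul_const _ (by fun_prop)]
    refine lintegral_congr fun ζ => ?_
    rw [lintegral_const_mul _ (by fun_prop)]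
  have iZ : ∫⁻ p, Z p ∂(volume.prod volume) = K * E := by
    rw [lintegral_prod _ hZ.aemeasurable]
    simp only [Z]
    rw [← lintegral_const_mul _ (by fun_prop)]
    refine lintegral_congr fun ξ => ?_
    rw [lintegral_mul_const _ (by fun_prop),
      lintegral_sub_left_eq_self (fun u => k u ^ (y + z)⁻¹) ξ]
  have hol := ENNReal.lintegral_prod_norm_pow_le (μ := (volume : Measure (Space N)).prod volume)
    Finset.univ (f := ![X, Y, Z]) (p := ![y, x, z])
    (by intro i _; fin_cases i <;> simp [hX.aemeasurable, hY.aemeasurable, hZ.aemeasurable])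
    (by simp [Fin.sum_univ_three]; linarith)
    (by intro i _; fin_cases i <;> simp [hx, hy, hz])
  simp only [Fin.prod_univ_three, Matrix.cons_val_zero, Matrix.cons_val_one, Matrix.cons_val] at hol
  have hpt : ∀ p : Space N × Space N, f p.2 * k (p.1 - p.2) * e p.1 =
      X p ^ y * Y p ^ x * Z p ^ z := by
    intro p
    simp only [X, Y, Z]
    rw [ENNReal.mul_rpow_of_nonneg _ _ hy, ENNReal.mul_rpow_of_nonneg _ _ hx,
      ENNReal.mul_rpow_of_nonneg _ _ hz]
    have e1 : f p.2 = (f p.2 ^ (x + y)⁻¹) ^ x * (f p.2 ^ (x + y)⁻¹) ^ y := by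
      rw [← ENNReal.rpow_add_of_nonneg _ _ hx hy, ← ENNReal.rpow_mul, inv_mul_cancel₀ hA.ne',
        ENNReal.rpow_one]
    have e2 : k (p.1 - p.2) = (k (p.1 - p.2) ^ (y + z)⁻¹) ^ y * (k (p.1 - p.2) ^ (y + z)⁻¹) ^ z := by
      rw [← ENNReal.rpow_add_of_nonneg _ _ hy hz, ← ENNReal.rpow_mul, inv_mul_cancel₀ hC.ne',
        ENNReal.rpow_one]
    have e3 : e p.1 = (e p.1 ^ (x + z)⁻¹) ^ x * (e p.1 ^ (x + z)⁻¹) ^ z := by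
      rw [← ENNReal.rpow_add_of_nonneg _ _ hx hz, ← ENNReal.rpow_mul, inv_mul_cancel₀ hB.ne',
        ENNReal.rpow_one]
    conv_lhs => rw [e1, e2, e3]
    ring
  calc ∫⁻ ξ, ∫⁻ ζ, f ζ * k (ξ - ζ) * e ξ
      = ∫⁻ p : Space N × Space N, f p.2 * k (p.1 - p.2) * e p.1 ∂(volume.prod volume) := by
        rw [lintegral_prod _ (by fun_prop)]
    _ = ∫⁻ p, X p ^ y * Y p ^ x * Z p ^ z ∂(volume.prod volume) := lintegral_congr hpt
    _ ≤ (F * K) ^ y * (F * E) ^ x * (K * E) ^ z := by rw [← iX, ← iY, ← iZ]; exact hol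
    _ = _ := by
        rw [ENNReal.mul_rpow_of_nonneg _ _ hy, ENNReal.mul_rpow_of_nonneg _ _ hx,
          ENNReal.mul_rpow_of_nonneg _ _ hz, ENNReal.rpow_add_of_nonneg _ _ hx hy,
          ENNReal.rpow_add_of_nonneg _ _ hy hz, ENNReal.rpow_add_of_nonneg _ _ hx hz]
        ring

lemma rieszConst_pos {N : ℕ} {α : ℝ} (hα : 0 < α) (hαN : 0 < (N : ℝ) - α) :
    0 < rieszConst N α := by
  unfold rieszConst
  have h1 := Real.Gamma_pos_of_pos (half_pos hα)
  have h2 := Real.Gamma_pos_of_pos (half_pos hαN)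
  positivity

lemma rieszKernel_nonneg {N : ℕ} {α : ℝ} (hα : 0 < α) (hαN : 0 < (N : ℝ) - α) (x : Space N) :
    0 ≤ rieszKernel N α x :=
  mul_nonneg (rieszConst_pos hα hαN).le (by positivity)

lemma measurable_rieszKernel (N : ℕ) (α : ℝ) : Measurable (rieszKernel N α) := by
  unfold rieszKernel
  fun_prop

lemma measurable_density {N : ℕ} (b q : ℝ) {v : Space N → ℂ} (hv : Measurable v) :
    Measurable (density b q v) := by
  unfold density
  fun_prop

lemma density_nonneg {N : ℕ} (b q : ℝ) (v : Space N → ℂ) (x : Space N) : 0 ≤ density b q v x := by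
  unfold density; positivity

/-- The Riesz potential of the density, as an extended nonnegative number. -/
noncomputable def potentialE {N : ℕ} (b α q : ℝ) (v : Space N → ℂ) (ξ : Space N) : ENNReal :=
  ∫⁻ ζ, ENNReal.ofReal (density b q v ζ) * ENNReal.ofReal (rieszKernel N α (ξ - ζ))

/-- The mass of the density with weight `(1+|ζ|)^{α-N}`. -/
noncomputable def weightedMass {N : ℕ} (b α q : ℝ) (v : Space N → ℂ) : ENNReal :=
  ∫⁻ ζ, ENNReal.ofReal (density b q v ζ) * ENNReal.ofReal ((1 + ‖ζ‖) ^ (α - (N : ℝ)))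

lemma potentialE_eq {N : ℕ} {b α q : ℝ} (hα : 0 < α) (hαN : 0 < (N : ℝ) - α) (v : Space N → ℂ)
    (ξ : Space N) : potentialE b α q v ξ =
      ∫⁻ t, ENNReal.ofReal (rieszKernel N α t * density b q v (ξ - t)) := by
  rw [potentialE, ← lintegral_sub_left_eq_self _ ξ]
  refine lintegral_congr fun t => ?_
  rw [sub_sub_cancel, ENNReal.ofReal_mul (rieszKernel_nonneg hα hαN t), mul_comm]

lemma potentialE_ne_top {N : ℕ} {b α q : ℝ} (hα : 0 < α) (hαN : 0 < (N : ℝ) - α)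
    {v : Space N → ℂ} {ξ : Space N} (h : PotentialExistsAt b α q v ξ) :
    potentialE b α q v ξ ≠ ⊤ := by
  rw [potentialE_eq hα hαN]
  have : Integrable (fun t => rieszKernel N α t * density b q v (ξ - t)) := h
  exact this.lintegral_lt_top.ne

lemma ofReal_potential {N : ℕ} {b α q : ℝ} (hα : 0 < α) (hαN : 0 < (N : ℝ) - α)
    {v : Space N → ℂ} {ξ : Space N} (h : PotentialExistsAt b α q v ξ) :
    ENNReal.ofReal (potential b α q v ξ) = potentialE b α q v ξ := by
  have h' : Integrable (fun t => rieszKernel N α t * density b q v (ξ - t)) := h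
  rw [potentialE_eq hα hαN, potential, convolution]
  simp only [ContinuousLinearMap.mul_apply']
  exact ofReal_integral_eq_lintegral_ofReal h' (Eventually.of_forall fun t =>
    mul_nonneg (rieszKernel_nonneg hα hαN t) (density_nonneg _ _ _ _))

lemma potential_nonneg {N : ℕ} {b α q : ℝ} (hα : 0 < α) (hαN : 0 < (N : ℝ) - α)
    (v : Space N → ℂ) (ξ : Space N) : 0 ≤ potential b α q v ξ := by
  rw [potential, convolution]
  exact integral_nonneg fun t => mul_nonneg (rieszKernel_nonneg hα hαN t) (density_nonneg _ _ _ _)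

lemma measurable_potentialE {N : ℕ} (b α q : ℝ) {v : Space N → ℂ} (hv : Measurable v) :
    Measurable (potentialE b α q v) := by
  have h1 := measurable_density b q hv
  have h2 := measurable_rieszKernel N α
  exact Measurable.lintegral_prod_right' (f := fun p : Space N × Space N =>
    ENNReal.ofReal (density b q v p.2) * ENNReal.ofReal (rieszKernel N α (p.1 - p.2)))
    (by fun_prop)

/-- Off the diagonal the Riesz kernel dominates the product weight. -/
lemma weight_le_rieszKernel {N : ℕ} {α : ℝ} (hα : 0 < α) (hαN : 0 < (N : ℝ) - α)
    {ξ ζ : Space N} (hne : ξ ≠ ζ) :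
    rieszConst N α * (1 + ‖ξ‖) ^ (α - (N : ℝ)) * (1 + ‖ζ‖) ^ (α - (N : ℝ)) ≤
      rieszKernel N α (ξ - ζ) := by
  have h1 : 0 < ‖ξ - ζ‖ := norm_pos_iff.2 (sub_ne_zero.2 hne)
  rw [rieszKernel, mul_assoc, ← Real.mul_rpow (by positivity) (by positivity)]
  refine mul_le_mul_of_nonneg_left ?_ (rieszConst_pos hα hαN).le
  refine Real.rpow_le_rpow_of_nonpos h1 ?_ (by linarith)
  have := norm_sub_le ξ ζ
  nlinarith [norm_nonneg ξ, norm_nonneg ζ, mul_nonneg (norm_nonneg ξ) (norm_nonneg ζ)]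

/-- For bounded ξ and |ξ-ζ| ≥ r, the distance |ξ-ζ| is bounded below by a multiple of 1+|ζ|. Hence
`weightedMass` controls the part of the potential away from the singularity. -/
lemma rieszKernel_le_weight {N : ℕ} {α : ℝ} (hα : 0 < α) (hαN : 0 < (N : ℝ) - α)
    {ξ ζ : Space N} {r ρ : ℝ} (hr : 0 < r) (hξ : ‖ξ‖ ≤ ρ) (h : r ≤ ‖ξ - ζ‖) :
    rieszKernel N α (ξ - ζ) ≤ rieszConst N α * (r⁻¹ + 1) ^ ((N : ℝ) - α) * (1 + ρ) ^ ((N : ℝ) - α) *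
      (1 + ‖ζ‖) ^ (α - (N : ℝ)) := by
  have hρ : 0 ≤ ρ := (norm_nonneg _).trans hξ
  have h1 : 0 < ‖ξ - ζ‖ := hr.trans_le h
  have h2 : 1 + ‖ζ‖ ≤ (r⁻¹ + 1) * (1 + ρ) * ‖ξ - ζ‖ := by
    have a1 : ‖ζ‖ ≤ ‖ξ‖ + ‖ξ - ζ‖ := by
      have := norm_sub_le ξ (ξ - ζ); rwa [sub_sub_cancel] at this
    have a2 : 1 ≤ r⁻¹ * ‖ξ - ζ‖ := by rw [inv_mul_eq_div, one_le_div hr]; exact h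
    nlinarith [mul_nonneg hρ h1.le]
  have h3 : ‖ξ - ζ‖ ^ (α - (N : ℝ)) ≤ (r⁻¹ + 1) ^ ((N : ℝ) - α) * (1 + ρ) ^ ((N : ℝ) - α) *
      (1 + ‖ζ‖) ^ (α - (N : ℝ)) := by
    have e : (1 + ‖ζ‖) ^ ((N : ℝ) - α) ≤ (r⁻¹ + 1) ^ ((N : ℝ) - α) * (1 + ρ) ^ ((N : ℝ) - α) *
        ‖ξ - ζ‖ ^ ((N : ℝ) - α) := by
      rw [← Real.mul_rpow (by positivity) (by positivity), ← Real.mul_rpow (by positivity)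
        (by positivity)]
      exact Real.rpow_le_rpow (by positivity) h2 hαN.le
    rw [show α - (N : ℝ) = -((N : ℝ) - α) by ring, Real.rpow_neg h1.le,
      Real.rpow_neg (by positivity), ← div_eq_mul_inv, inv_eq_one_div, div_le_div_iff₀
      (by positivity) (by positivity), one_mul]
    exact e
  rw [rieszKernel]
  calc _ ≤ _ := mul_le_mul_of_nonneg_left h3 (rieszConst_pos hα hαN).le
    _ = _ := by ring

/-- Lower bound of the potential tested against a function with bounded support. -/
lemma mul_weightedMass_le {N : ℕ} {b α q : ℝ} (hα : 0 < α) (hαN : 0 < (N : ℝ) - α) (hN : 1 ≤ N)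
    {v : Space N → ℂ} (hv : Measurable v) {ξ : Space N} {ρ : ℝ} (hξ : ‖ξ‖ ≤ ρ) :
    ENNReal.ofReal (rieszConst N α * (1 + ρ) ^ (α - (N : ℝ))) * weightedMass b α q v ≤
      potentialE b α q v ξ := by
  have : Nonempty (Fin N) := ⟨⟨0, hN⟩⟩
  have hD := measurable_density b q hv
  rw [weightedMass, ← lintegral_const_mul _ (by fun_prop)]
  refine lintegral_mono_ae ?_
  -- On the diagonal the kernel takes the junk value 0 (a real power of 0 with nonzero exponent), so
  -- the comparison fails there; the point is null because N ≥ 1.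
  have hne : ∀ᵐ ζ : Space N, ζ ≠ ξ := by
    have : volume ({ξ} : Set (Space N)) = 0 := measure_singleton ξ
    filter_upwards [compl_mem_ae_iff.2 this] with ζ hζ using hζ
  filter_upwards [hne] with ζ hζ
  rw [mul_left_comm, ← ENNReal.ofReal_mul (mul_nonneg (rieszConst_pos hα hαN).le (by
    have := (norm_nonneg ξ).trans hξ; positivity))]
  gcongr
  refine le_trans ?_ (weight_le_rieszKernel hα hαN hζ.symm)
  have := (rieszConst_pos hα hαN).le
  have h2 : (1 + ρ) ^ (α - (N : ℝ)) ≤ (1 + ‖ξ‖) ^ (α - (N : ℝ)) :=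
    Real.rpow_le_rpow_of_nonpos (by positivity) (by linarith) (by linarith)
  gcongr

/-- Convergence of the potential at a single point suffices, because the kernel centred there
dominates a multiple of the weight. -/
lemma weightedMass_ne_top {N : ℕ} {b α q : ℝ} (hα : 0 < α) (hαN : 0 < (N : ℝ) - α) (hN : 1 ≤ N)
    {v : Space N → ℂ} (hv : Measurable v) {ξ : Space N} (h : PotentialExistsAt b α q v ξ) :
    weightedMass b α q v ≠ ⊤ := by
  have h1 := mul_weightedMass_le (b := b) (q := q) hα hαN hN hv (le_refl ‖ξ‖)
  have h2 := potentialE_ne_top hα hαN h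
  intro h3
  rw [h3, ENNReal.mul_top] at h1
  · exact h2 (top_le_iff.1 h1)
  · have := rieszConst_pos hα hαN
    exact (ENNReal.ofReal_pos.2 (by positivity)).ne'

/-- The condition on c says (N-α)/c < N, which is local integrability of |x|^{(α-N)/c} at the
origin. -/
lemma lintegral_near_kernel_lt_top {N : ℕ} {α c : ℝ} (hα : 0 < α) (hαN : 0 < (N : ℝ) - α)
    (hN : 1 ≤ N) (hc : 0 < c) (hcα : 1 - α / N < c) (r : ℝ) :
    ∫⁻ x : Space N, ((Metric.ball (0 : Space N) r).indicator
      (fun x => ENNReal.ofReal (rieszKernel N α x)) x) ^ c⁻¹ < ⊤ := by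
  have hN' : (0 : ℝ) < N := by exact_mod_cast hN
  have h0 := (rieszConst_pos hα hαN).le
  have hint : IntegrableOn (fun x : Space N => rieszKernel N α x ^ c⁻¹) (Metric.ball 0 r) := by
    refine integrableOn_ball_of_norm_le_rpow (α := ((N : ℝ) - α) * c⁻¹)
      (C := rieszConst N α ^ c⁻¹) (by simpa using hN) ?_ ?_ ?_
    · rw [finrank_euclideanSpace_fin, mul_inv_lt_iff₀ hc]
      have : 1 - α / N = ((N : ℝ) - α) / N := by field_simp
      rw [this, div_lt_iff₀ hN'] at hcα
      linarith
    · refine Eventually.of_forall fun x => le_of_eq ?_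
      rw [Real.norm_of_nonneg (Real.rpow_nonneg (rieszKernel_nonneg hα hαN x) _), rieszKernel,
        Real.mul_rpow h0 (by positivity), ← Real.rpow_mul (norm_nonneg _)]
      congr 2
      ring
    · exact ((measurable_rieszKernel N α).pow_const _).aestronglyMeasurable
  have := hint.lintegral_lt_top
  rw [← lintegral_indicator Metric.isOpen_ball.measurableSet] at this
  refine lt_of_eq_of_lt (lintegral_congr fun x => ?_) this
  by_cases hx : x ∈ Metric.ball (0 : Space N) r
  · rw [indicator_of_mem hx, indicator_of_mem hx,
      ENNReal.ofReal_rpow_of_nonneg (rieszKernel_nonneg hα hαN x) (by positivity)]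
  · rw [indicator_of_notMem hx, indicator_of_notMem hx, ENNReal.zero_rpow_of_pos (by positivity)]

/-- Exponents for `lintegral_trilinear_le`: the density is taken in L^{1/(x+y)}, the near kernel in
L^{1/(y+z)}, the test function in L^{2/(q-1)}. If N(q-1) < 2α, the density in L¹, controlled by
`weightedMass`, suffices. Otherwise q < 2, and the L² bound on v gives local integrability of the
density up to the exponent 2/q; the kernel condition then follows from q < 3/2 + α/N, where 1/N ≤
1/2 enters. -/
lemma exists_exponents {N : ℕ} (hN : 2 ≤ N) {b α q : ℝ} (hb : 0 < b) (hα : 0 < α)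
    (hαN : 0 < (N : ℝ) - α) (hq1 : 1 < q) (hq₂ : q < 1 + (1 + α - 2 * b) / (N : ℝ)) :
    ∃ x y z : ℝ, 0 ≤ x ∧ 0 ≤ y ∧ 0 ≤ z ∧ x + y + z = 1 ∧ x + z = (q - 1) / 2 ∧ 0 < x + y ∧
      0 < y + z ∧ 1 - α / N < y + z ∧ (x + y = 1 ∨ q ≤ 2 * (x + y)) := by
  have hN2 : (2 : ℝ) ≤ N := by exact_mod_cast hN
  have hN' : (0 : ℝ) < N := by linarith
  have hαN1 : α / N < 1 := by rw [div_lt_one hN']; linarith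
  have hαN0 : 0 < α / N := by positivity
  have hinv : 1 / (N : ℝ) ≤ 1 / 2 := one_div_le_one_div_of_le (by norm_num) hN2
  have hq3 : q < 3 / 2 + α / N := by
    have : (1 + α - 2 * b) / (N : ℝ) = 1 / N + α / N - 2 * b / N := by ring
    have h2 : 0 < 2 * b / N := by positivity
    linarith
  by_cases hA : (N : ℝ) * (q - 1) < 2 * α
  · have h1 : (q - 1) / 2 < α / N := by
      rw [div_lt_div_iff₀ (by norm_num) hN']; linarith
    exact ⟨(q - 1) / 2, 1 - (q - 1) / 2, 0, by linarith, by linarith, le_rfl, by ring, by ring,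
      by linarith, by linarith, by linarith, Or.inl (by ring)⟩
  · have hq2 : q < 2 := by
      have h1 : (N : ℝ) * (q - 1) < 1 + α - 2 * b := by
        have := (lt_div_iff₀ hN').1 (show q - 1 < (1 + α - 2 * b) / N by linarith)
        linarith
      nlinarith
    -- Putting the density exactly in L^{2/q}, that is x+y = q/2, would give y+z = 5/2 - q; capping
    -- y+z at 1 keeps x nonnegative.
    refine ⟨1 - min 1 (5 / 2 - q), 1 - (q - 1) / 2, min 1 (5 / 2 - q) - 1 + (q - 1) / 2, ?_,
      by linarith, ?_,
      by ring, by ring, ?_, ?_, ?_, Or.inr ?_⟩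
    all_goals
      rcases le_total 1 (5 / 2 - q) with h | h
      · simp only [min_eq_left h]; linarith
      · simp only [min_eq_right h]; linarith

/-- The part of the density at distance between `r` and `ρ + r` of the origin. -/
noncomputable def annularDensity {N : ℕ} (b q r ρ : ℝ) (v : Space N → ℂ) (ζ : Space N) : ENNReal :=
  {ζ : Space N | r ≤ ‖ζ‖ ∧ ‖ζ‖ ≤ ρ + r}.indicator (fun ζ => ENNReal.ofReal (density b q v ζ)) ζ

lemma measurableSet_annulus {N : ℕ} (r ρ : ℝ) :
    MeasurableSet {ζ : Space N | r ≤ ‖ζ‖ ∧ ‖ζ‖ ≤ ρ} :=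
  ((isClosed_le continuous_const continuous_norm).inter
    (isClosed_le continuous_norm continuous_const)).measurableSet

lemma volume_annulus_lt_top {N : ℕ} (r ρ : ℝ) :
    volume {ζ : Space N | r ≤ ‖ζ‖ ∧ ‖ζ‖ ≤ ρ} < ⊤ :=
  lt_of_le_of_lt (measure_mono fun _ hζ => mem_closedBall_zero_iff.2 hζ.2)
    (measure_closedBall_lt_top (x := (0 : Space N)) (r := ρ))

lemma measurable_annularDensity {N : ℕ} (b q r ρ : ℝ) {v : Space N → ℂ} (hv : Measurable v) :
    Measurable (annularDensity b q r ρ v) :=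
  (measurable_density b q hv).ennreal_ofReal.indicator (measurableSet_annulus _ _)

lemma lintegral_annularDensity_le {N : ℕ} {b α q r ρ : ℝ} (hαN : 0 < (N : ℝ) - α) (hr : 0 < r)
    (hρ : 0 < ρ) {v : Space N → ℂ} (hv : Measurable v) :
    ∫⁻ ζ, annularDensity b q r ρ v ζ ≤
      ENNReal.ofReal ((1 + (ρ + r)) ^ ((N : ℝ) - α)) * weightedMass b α q v := by
  have hD := measurable_density b q hv
  rw [weightedMass, ← lintegral_const_mul _ (by fun_prop)]
  refine lintegral_mono fun ζ => ?_
  by_cases hζ : r ≤ ‖ζ‖ ∧ ‖ζ‖ ≤ ρ + r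
  swap
  · rw [annularDensity, indicator_of_notMem (by exact hζ)]
    exact zero_le
  rw [annularDensity, indicator_of_mem (by exact hζ), mul_left_comm, ← ENNReal.ofReal_mul (by positivity)]
  refine le_mul_of_one_le_right' (ENNReal.one_le_ofReal.2 ?_)
  have h1 : (1 + ‖ζ‖) ^ ((N : ℝ) - α) ≤ (1 + (ρ + r)) ^ ((N : ℝ) - α) :=
    Real.rpow_le_rpow (by positivity) (by linarith [hζ.2]) hαN.le
  rw [show α - (N : ℝ) = -((N : ℝ) - α) by ring, Real.rpow_neg (by positivity), ← div_eq_mul_inv,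
    one_le_div (by positivity)]
  exact h1

/-- Away from the origin |ζ|^{-b} is bounded, and |v|^{qA} ≤ 1 + |v|² because qA ≤ 2. -/
lemma lintegral_annularDensity_rpow_le {N : ℕ} {b q r ρ A : ℝ} (hb : 0 < b) (hr : 0 < r)
    (hA : 0 < A) (hqA : q * A ≤ 2) (hq : 0 < q) {v : Space N → ℂ} (hv : Measurable v) :
    ∫⁻ ζ, annularDensity b q r ρ v ζ ^ A ≤
      ENNReal.ofReal ((r ^ (-b)) ^ A) * (volume (Metric.closedBall (0 : Space N) (ρ + r)) +
        ∫⁻ ζ, ‖v ζ‖ₑ ^ 2) := by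
  have hpt : ∀ ζ, annularDensity b q r ρ v ζ ^ A ≤ ENNReal.ofReal ((r ^ (-b)) ^ A) *
      ((Metric.closedBall (0 : Space N) (ρ + r)).indicator (fun _ => 1) ζ + ‖v ζ‖ₑ ^ 2) := by
    intro ζ
    by_cases hζ : r ≤ ‖ζ‖ ∧ ‖ζ‖ ≤ ρ + r
    · rw [annularDensity, indicator_of_mem (by exact hζ), indicator_of_mem
        (mem_closedBall_zero_iff.2 hζ.2), ENNReal.ofReal_rpow_of_nonneg (density_nonneg _ _ _ _) hA.le,
        ← ofReal_norm, ← ENNReal.ofReal_pow (norm_nonneg _), ← ENNReal.ofReal_one,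
        ← ENNReal.ofReal_add (by norm_num) (by positivity), ← ENNReal.ofReal_mul (by positivity)]
      refine ENNReal.ofReal_le_ofReal ?_
      rw [density, Real.mul_rpow (by positivity) (by positivity), ← Real.rpow_mul (norm_nonneg (v ζ))]
      have h1 : ‖ζ‖ ^ (-b) ≤ r ^ (-b) := Real.rpow_le_rpow_of_nonpos hr hζ.1 (by linarith)
      have h2 : ‖v ζ‖ ^ (q * A) ≤ 1 + ‖v ζ‖ ^ 2 := by
        rcases le_total ‖v ζ‖ 1 with h | h
        · have := Real.rpow_le_one (norm_nonneg (v ζ)) h (by positivity : 0 ≤ q * A)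
          nlinarith [sq_nonneg ‖v ζ‖]
        · have := Real.rpow_le_rpow_of_exponent_le h hqA
          rw [Real.rpow_two] at this
          linarith
      gcongr
    · rw [annularDensity, indicator_of_notMem (by exact hζ), ENNReal.zero_rpow_of_pos hA]
      exact zero_le
  refine (lintegral_mono hpt).trans ?_
  rw [lintegral_const_mul _ (by
      refine Measurable.add (measurable_const.indicator Metric.isClosed_closedBall.measurableSet) ?_
      fun_prop),
    lintegral_add_right _ (by fun_prop), lintegral_indicator_const
      Metric.isClosed_closedBall.measurableSet, one_mul]

/-- The Riesz kernel near its singularity. -/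
noncomputable def nearKernel (N : ℕ) (α r : ℝ) (x : Space N) : ENNReal :=
  (Metric.ball (0 : Space N) r).indicator (fun x => ENNReal.ofReal (rieszKernel N α x)) x

lemma measurable_nearKernel (N : ℕ) (α r : ℝ) : Measurable (nearKernel N α r) :=
  (measurable_rieszKernel N α).ennreal_ofReal.indicator Metric.isOpen_ball.measurableSet

/-- The two regimes of `exists_exponents` give a bound linear in the weighted mass and one depending
only on the L² bound Q; the factor `weightedMass + 1` covers both. -/
lemma exists_near_bound {N : ℕ} (hN : 2 ≤ N) {b α q : ℝ} (hb : 0 < b) (hα : 0 < α)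
    (hαN : 0 < (N : ℝ) - α) (hq1 : 1 < q) (hq₂ : q < 1 + (1 + α - 2 * b) / (N : ℝ))
    {r ρ : ℝ} (hr : 0 < r) (hρ : 0 < ρ) {Q : ENNReal} (hQ : Q ≠ ⊤) :
    ∃ C : ENNReal, C ≠ ⊤ ∧ ∀ v : Space N → ℂ, Measurable v → ∫⁻ ζ, ‖v ζ‖ₑ ^ 2 ≤ Q →
      ∀ a : Space N → ENNReal, Measurable a →
      ∫⁻ ξ, ∫⁻ ζ, annularDensity b q r ρ v ζ * nearKernel N α r (ξ - ζ) * a ξ ≤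
        C * (weightedMass b α q v + 1) * (∫⁻ ξ, a ξ ^ ((q - 1) / 2)⁻¹) ^ ((q - 1) / 2) := by
  obtain ⟨x, y, z, hx, hy, hz, hsum, hxz, hxy, hyz, hyzα, hAq⟩ :=
    exists_exponents hN hb hα hαN hq1 hq₂
  have hK := lintegral_near_kernel_lt_top hα hαN (by omega) hyz hyzα r
  set K := ∫⁻ ζ : Space N, nearKernel N α r ζ ^ (y + z)⁻¹ with hKdef
  have hKt : K ^ (y + z) ≠ ⊤ := ENNReal.rpow_ne_top_of_nonneg hyz.le hK.ne
  have main : ∀ v : Space N → ℂ, Measurable v → ∀ a : Space N → ENNReal, Measurable a →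
      ∫⁻ ξ, ∫⁻ ζ, annularDensity b q r ρ v ζ * nearKernel N α r (ξ - ζ) * a ξ ≤
      (∫⁻ ζ, annularDensity b q r ρ v ζ ^ (x + y)⁻¹) ^ (x + y) * K ^ (y + z) *
        (∫⁻ ξ, a ξ ^ ((q - 1) / 2)⁻¹) ^ ((q - 1) / 2) := by
    intro v hv a ha
    have := lintegral_trilinear_le (measurable_annularDensity b q r ρ hv)
      (measurable_nearKernel N α r) ha hx hy hz hsum hxy (by linarith) hyz
    rwa [hxz] at this
  rcases hAq with hA | hA
  · refine ⟨ENNReal.ofReal ((1 + (ρ + r)) ^ ((N : ℝ) - α)) * K ^ (y + z),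
      ENNReal.mul_ne_top ENNReal.ofReal_ne_top hKt, fun v hv hvQ a ha => (main v hv a ha).trans ?_⟩
    refine mul_le_mul_left ?_ _
    rw [hA]
    simp only [inv_one, ENNReal.rpow_one]
    calc _ ≤ ENNReal.ofReal ((1 + (ρ + r)) ^ ((N : ℝ) - α)) * weightedMass b α q v * K ^ (y + z) := by
          gcongr
          exact lintegral_annularDensity_le hαN hr hρ hv
      _ = ENNReal.ofReal ((1 + (ρ + r)) ^ ((N : ℝ) - α)) * K ^ (y + z) * weightedMass b α q v := by
          ring
      _ ≤ _ := mul_le_mul_right le_self_add _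
  · set G := (ENNReal.ofReal ((r ^ (-b)) ^ (x + y)⁻¹) *
      (volume (Metric.closedBall (0 : Space N) (ρ + r)) + Q)) ^ (x + y)
    have hG : G ≠ ⊤ := ENNReal.rpow_ne_top_of_nonneg hxy.le (ENNReal.mul_ne_top ENNReal.ofReal_ne_top
      (ENNReal.add_ne_top.2 ⟨measure_closedBall_lt_top.ne, hQ⟩))
    refine ⟨G * K ^ (y + z), ENNReal.mul_ne_top hG hKt, fun v hv hvQ a ha =>
      (main v hv a ha).trans ?_⟩
    refine mul_le_mul_left ?_ _
    refine le_trans ?_ (le_mul_of_one_le_right' le_add_self)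
    refine mul_le_mul_left (ENNReal.rpow_le_rpow ?_ hxy.le) _
    refine (lintegral_annularDensity_rpow_le hb hr (by positivity) ?_ (by linarith) hv).trans ?_
    · rw [mul_inv_le_iff₀ hxy]; exact hA
    · gcongr

/-- Upper bound of the potential tested against a function supported in an annulus. -/
lemma exists_potential_bound {N : ℕ} (hN : 2 ≤ N) {b α q : ℝ} (hb : 0 < b) (hα : 0 < α)
    (hαN : 0 < (N : ℝ) - α) (hq1 : 1 < q) (hq₂ : q < 1 + (1 + α - 2 * b) / (N : ℝ))
    {r ρ : ℝ} (hr : 0 < r) (hρ : 0 < ρ) {Q : ENNReal} (hQ : Q ≠ ⊤) :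
    ∃ C : ENNReal, C ≠ ⊤ ∧ ∀ v : Space N → ℂ, Measurable v → ∫⁻ ζ, ‖v ζ‖ₑ ^ 2 ≤ Q →
      ∀ a : Space N → ENNReal, Measurable a → (∀ ξ, a ξ ≠ 0 → 2 * r ≤ ‖ξ‖ ∧ ‖ξ‖ ≤ ρ) →
      ∫⁻ ξ, potentialE b α q v ξ * a ξ ≤
        C * (weightedMass b α q v + 1) * (∫⁻ ξ, a ξ ^ ((q - 1) / 2)⁻¹) ^ ((q - 1) / 2) := by
  obtain ⟨C, hC, hnear⟩ := exists_near_bound hN hb hα hαN hq1 hq₂ hr hρ hQ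
  set β := (q - 1) / 2 with hβ
  have hβ0 : 0 < β := by rw [hβ]; linarith
  have hβ1 : β < 1 := by
    have hN2 : (2 : ℝ) ≤ N := by exact_mod_cast hN
    have : (1 + α - 2 * b) / (N : ℝ) < 2 := by rw [div_lt_iff₀ (by linarith)]; linarith
    rw [hβ]; linarith
  set c1 := ENNReal.ofReal (rieszConst N α * (r⁻¹ + 1) ^ ((N : ℝ) - α) * (1 + ρ) ^ ((N : ℝ) - α))
  set V := volume {ζ : Space N | 2 * r ≤ ‖ζ‖ ∧ ‖ζ‖ ≤ ρ}
  have hV : V ^ (1 - β) ≠ ⊤ :=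
    ENNReal.rpow_ne_top_of_nonneg (by linarith) (volume_annulus_lt_top _ _).ne
  refine ⟨C + c1 * V ^ (1 - β), ENNReal.add_ne_top.2 ⟨hC, ENNReal.mul_ne_top
    ENNReal.ofReal_ne_top hV⟩, fun v hv hvQ a ha hsupp => ?_⟩
  have hD := measurable_density b q hv
  have hk := measurable_rieszKernel N α
  have hk' := measurable_nearKernel N α r
  have hf := measurable_annularDensity b q r ρ hv
  -- If |ξ-ζ| < r, then 2r ≤ |ξ| ≤ ρ forces r ≤ |ζ| ≤ ρ+r, so the singularity of |ζ|^{-b} is not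
  -- met. If |ξ-ζ| ≥ r, the kernel is bounded by the weight.
  have hpt : ∀ ξ ζ, ENNReal.ofReal (density b q v ζ) * ENNReal.ofReal (rieszKernel N α (ξ - ζ)) *
      a ξ ≤ annularDensity b q r ρ v ζ * nearKernel N α r (ξ - ζ) * a ξ +
        c1 * (ENNReal.ofReal (density b q v ζ) * ENNReal.ofReal ((1 + ‖ζ‖) ^ (α - (N : ℝ)))) *
          a ξ := by
    intro ξ ζ
    by_cases haξ : a ξ = 0
    · simp [haξ]
    obtain ⟨h1, h2⟩ := hsupp ξ haξ
    by_cases hnr : ‖ξ - ζ‖ < r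
    · refine le_trans (le_of_eq ?_) le_self_add
      rw [nearKernel, indicator_of_mem (mem_ball_zero_iff.2 hnr), annularDensity, indicator_of_mem]
      have a1 := norm_sub_le ξ (ξ - ζ)
      have a2 := norm_sub_norm_le ξ ζ
      rw [sub_sub_cancel] at a1
      exact ⟨by linarith, by linarith⟩
    · refine le_trans ?_ le_add_self
      have hfar : ENNReal.ofReal (rieszKernel N α (ξ - ζ)) ≤
          c1 * ENNReal.ofReal ((1 + ‖ζ‖) ^ (α - (N : ℝ))) := by
        rw [← ENNReal.ofReal_mul (mul_nonneg (mul_nonneg (rieszConst_pos hα hαN).le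
          (by positivity)) (by positivity))]
        exact ENNReal.ofReal_le_ofReal (rieszKernel_le_weight hα hαN hr h2 (not_lt.1 hnr))
      rw [mul_left_comm c1]
      exact mul_le_mul_left (mul_le_mul_right hfar _) _
  -- Hölder on the annulus, where β = (q-1)/2 < 1 by the upper bound on q.
  have hL1 : ∫⁻ ξ, a ξ ≤ (∫⁻ ξ, a ξ ^ β⁻¹) ^ β * V ^ (1 - β) := by
    have hh := ENNReal.lintegral_mul_norm_pow_le (μ := volume) (f := fun ξ => a ξ ^ β⁻¹)
      (g := {ζ : Space N | 2 * r ≤ ‖ζ‖ ∧ ‖ζ‖ ≤ ρ}.indicator (fun _ => 1)) (by fun_prop)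
      (measurable_const.indicator (measurableSet_annulus _ _)).aemeasurable
      hβ0.le (by linarith : 0 ≤ 1 - β) (by ring)
    rw [lintegral_indicator_const (measurableSet_annulus _ _), one_mul] at hh
    refine le_trans (lintegral_mono fun ξ => ?_) hh
    by_cases haξ : a ξ = 0
    · simp [haξ]
    simp only
    rw [indicator_of_mem (by exact hsupp ξ haξ), ENNReal.one_rpow, mul_one, ← ENNReal.rpow_mul,
      inv_mul_cancel₀ hβ0.ne', ENNReal.rpow_one]
  calc ∫⁻ ξ, potentialE b α q v ξ * a ξ
      = ∫⁻ ξ, ∫⁻ ζ, ENNReal.ofReal (density b q v ζ) *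
          ENNReal.ofReal (rieszKernel N α (ξ - ζ)) * a ξ := by
        refine lintegral_congr fun ξ => ?_
        rw [potentialE, lintegral_mul_const _ (by fun_prop)]
    _ ≤ ∫⁻ ξ, ((∫⁻ ζ, annularDensity b q r ρ v ζ * nearKernel N α r (ξ - ζ) * a ξ) +
          c1 * weightedMass b α q v * a ξ) := by
        refine lintegral_mono fun ξ => ?_
        refine (lintegral_mono (hpt ξ)).trans (le_of_eq ?_)
        rw [lintegral_add_left (by fun_prop), lintegral_mul_const _ (by fun_prop),
          lintegral_mul_const _ (by fun_prop), lintegral_const_mul _ (by fun_prop), weightedMass]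
    _ = (∫⁻ ξ, ∫⁻ ζ, annularDensity b q r ρ v ζ * nearKernel N α r (ξ - ζ) * a ξ) +
          c1 * weightedMass b α q v * ∫⁻ ξ, a ξ := by
        rw [lintegral_add_right _ (by fun_prop), lintegral_const_mul _ ha]
    _ ≤ C * (weightedMass b α q v + 1) * (∫⁻ ξ, a ξ ^ β⁻¹) ^ β +
          c1 * (weightedMass b α q v + 1) * ((∫⁻ ξ, a ξ ^ β⁻¹) ^ β * V ^ (1 - β)) := by
        gcongr
        · exact hnear v hv hvQ a ha
        · exact le_self_add
    _ = _ := by ring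

/-! ### Coercivity of the nonlinearity near a nonzero profile -/

/-- If |v-ψ| ≤ |ψ|/2, then v points along ψ and |v| is comparable to |ψ|, so the pairing alone
dominates |ψ|^q whatever the sign of q-2. Otherwise |v| and |ψ| are both at most 3|v-ψ|, and the
error term absorbs everything. -/
lemma coercive_pairing {q : ℝ} (hq : 1 < q) (v ψ : ℂ) :
    (1 / 2) ^ q * (2 / 9) * ‖ψ‖ ^ q ≤ ‖v‖ ^ (q - 2) * (v * (starRingEnd ℂ) ψ).re +
      2 * 3 ^ (q - 1) * (‖v - ψ‖ ^ (q - 1) * ‖ψ‖) := by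
  rcases eq_or_ne ψ 0 with rfl | hψ
  · simp [Real.zero_rpow (by linarith : q ≠ 0)]
  have hψ0 : 0 < ‖ψ‖ := norm_pos_iff.2 hψ
  by_cases h : ‖v - ψ‖ ≤ ‖ψ‖ / 2
  · have h1 : ‖ψ‖ / 2 ≤ ‖v‖ := by
      have := norm_sub_norm_le ψ v
      rw [norm_sub_rev] at this
      linarith
    have h2 : ‖v‖ ≤ 3 / 2 * ‖ψ‖ := by
      have := norm_sub_norm_le v ψ
      linarith
    have hv0 : 0 < ‖v‖ := by linarith
    have h3 : ‖ψ‖ ^ 2 / 2 ≤ (v * (starRingEnd ℂ) ψ).re := by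
      have e : v * (starRingEnd ℂ) ψ = (v - ψ) * (starRingEnd ℂ) ψ + ((‖ψ‖ ^ 2 : ℝ) : ℂ) := by
        rw [Complex.ofReal_pow, ← Complex.mul_conj']; ring
      have e2 := Complex.abs_re_le_norm ((v - ψ) * (starRingEnd ℂ) ψ)
      rw [norm_mul, RCLike.norm_conj] at e2
      rw [e, Complex.add_re, Complex.ofReal_re]
      have := (abs_le.1 e2).1
      nlinarith
    have h4 : (1 / 2) ^ q * (4 / 9) * ‖ψ‖ ^ q / ‖ψ‖ ^ 2 ≤ ‖v‖ ^ (q - 2) := by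
      rw [Real.rpow_sub hv0, Real.rpow_two, div_le_div_iff₀ (by positivity) (by positivity)]
      have a1 : (1 / 2) ^ q * ‖ψ‖ ^ q ≤ ‖v‖ ^ q := by
        rw [← Real.mul_rpow (by norm_num) (by positivity)]
        exact Real.rpow_le_rpow (by positivity) (by linarith) (by linarith)
      have a2 : 4 / 9 * ‖v‖ ^ 2 ≤ ‖ψ‖ ^ 2 := by nlinarith
      calc (1 / 2) ^ q * (4 / 9) * ‖ψ‖ ^ q * ‖v‖ ^ 2 =
            ((1 / 2) ^ q * ‖ψ‖ ^ q) * (4 / 9 * ‖v‖ ^ 2) := by ring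
        _ ≤ _ := by gcongr
    have h5 : (1 / 2) ^ q * (2 / 9) * ‖ψ‖ ^ q ≤ ‖v‖ ^ (q - 2) * (v * (starRingEnd ℂ) ψ).re := by
      calc (1 / 2) ^ q * (2 / 9) * ‖ψ‖ ^ q =
            ((1 / 2) ^ q * (4 / 9) * ‖ψ‖ ^ q / ‖ψ‖ ^ 2) * (‖ψ‖ ^ 2 / 2) := by
              field_simp; norm_num
        _ ≤ _ := by gcongr
    have : 0 ≤ 2 * 3 ^ (q - 1) * (‖v - ψ‖ ^ (q - 1) * ‖ψ‖) := by positivity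
    linarith
  · push Not at h
    have hd0 : 0 < ‖v - ψ‖ := by linarith
    have h1 : ‖v‖ ≤ 3 * ‖v - ψ‖ := by
      have := norm_sub_norm_le v ψ
      linarith
    have h2 : -(‖v‖ ^ (q - 1) * ‖ψ‖) ≤ ‖v‖ ^ (q - 2) * (v * (starRingEnd ℂ) ψ).re := by
      rcases eq_or_ne v 0 with rfl | hv
      · simp [Real.zero_rpow (by linarith : q - 1 ≠ 0)]
      have hv0 : 0 < ‖v‖ := norm_pos_iff.2 hv
      have e2 := Complex.abs_re_le_norm (v * (starRingEnd ℂ) ψ)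
      rw [norm_mul, RCLike.norm_conj] at e2
      have e3 : ‖v‖ ^ (q - 1) = ‖v‖ ^ (q - 2) * ‖v‖ := by
        rw [← Real.rpow_add_one hv0.ne']; congr 1; ring
      have := mul_le_mul_of_nonneg_left (abs_le.1 e2).1 (Real.rpow_nonneg hv0.le (q - 2))
      rw [e3]; linarith
    have h3 : ‖v‖ ^ (q - 1) ≤ 3 ^ (q - 1) * ‖v - ψ‖ ^ (q - 1) := by
      rw [← Real.mul_rpow (by norm_num) (by positivity)]
      exact Real.rpow_le_rpow (by positivity) h1 (by linarith)
    have h4 : ‖ψ‖ ^ (q - 1) ≤ 3 ^ (q - 1) * ‖v - ψ‖ ^ (q - 1) := by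
      rw [← Real.mul_rpow (by norm_num) (by positivity)]
      exact Real.rpow_le_rpow (by positivity) (by linarith) (by linarith)
    have h5 : ‖ψ‖ ^ q = ‖ψ‖ ^ (q - 1) * ‖ψ‖ := by
      rw [← Real.rpow_add_one hψ0.ne']; congr 1; ring
    have h6 : (1 / 2 : ℝ) ^ q * (2 / 9) ≤ 1 := by
      have := Real.rpow_le_one (by norm_num : (0 : ℝ) ≤ 1 / 2) (by norm_num) (by linarith : 0 ≤ q)
      linarith
    have h7 : (1 / 2 : ℝ) ^ q * (2 / 9) * ‖ψ‖ ^ q ≤ ‖ψ‖ ^ q :=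
      mul_le_of_le_one_left (by positivity) h6
    have h8 := mul_le_mul_of_nonneg_right h3 hψ0.le
    have h9 := mul_le_mul_of_nonneg_right h4 hψ0.le
    rw [h5] at h7 ⊢
    nlinarith

lemma exists_good_set {N : ℕ} (hN : 1 ≤ N) {g : Space N → ℂ} (hne : ¬ g =ᵐ[volume] 0) :
    ∃ k : ℕ, 0 < volume {ζ : Space N | (((k : ℝ) + 1)⁻¹ ≤ ‖ζ‖ ∧ ‖ζ‖ ≤ k) ∧
      (((k : ℝ) + 1)⁻¹ ≤ ‖g ζ‖ ∧ ‖g ζ‖ ≤ k)} := by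
  have : Nonempty (Fin N) := ⟨⟨0, hN⟩⟩
  by_contra! h
  apply hne
  have h1 : ∀ᵐ ζ, ∀ k : ℕ, ζ ∉ {ζ : Space N | (((k : ℝ) + 1)⁻¹ ≤ ‖ζ‖ ∧ ‖ζ‖ ≤ k) ∧
      (((k : ℝ) + 1)⁻¹ ≤ ‖g ζ‖ ∧ ‖g ζ‖ ≤ k)} := by
    rw [ae_all_iff]
    intro k
    exact compl_mem_ae_iff.2 (le_antisymm (h k) zero_le)
  have h2 : ∀ᵐ ζ : Space N, ζ ≠ 0 := compl_mem_ae_iff.2 (measure_singleton (0 : Space N))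
  filter_upwards [h1, h2] with ζ hζ hζ0
  by_contra hgζ
  have p1 : 0 < ‖ζ‖ := norm_pos_iff.2 hζ0
  have p2 : 0 < ‖g ζ‖ := norm_pos_iff.2 hgζ
  obtain ⟨k, hk⟩ := exists_nat_ge (max (max ‖ζ‖ ‖g ζ‖) (max ‖ζ‖⁻¹ ‖g ζ‖⁻¹))
  have hk1 : ‖ζ‖ ≤ k := (le_max_left _ _).trans ((le_max_left _ _).trans hk)
  have hk2 : ‖g ζ‖ ≤ k := (le_max_right _ _).trans ((le_max_left _ _).trans hk)
  have hk3 : ‖ζ‖⁻¹ ≤ k := (le_max_left _ _).trans ((le_max_right _ _).trans hk)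
  have hk4 : ‖g ζ‖⁻¹ ≤ k := (le_max_right _ _).trans ((le_max_right _ _).trans hk)
  refine hζ k ⟨⟨?_, hk1⟩, ?_, hk2⟩
  · exact inv_le_of_inv_le₀ p1 (by linarith)
  · exact inv_le_of_inv_le₀ p2 (by linarith)

/-- Smooth approximation of the truncation of a function to a bounded set away from the origin. -/
lemma exists_smooth_approx {N : ℕ} (hN : 1 ≤ N) {g : Space N → ℂ} (hg : Measurable g)
    (hne : ¬ g =ᵐ[volume] 0) :
    ∃ (r ρ m R : ℝ) (A : Set (Space N)) (ψ : ℕ → Space N → ℂ), 0 < r ∧ 0 < ρ ∧ 0 < m ∧ 0 < R ∧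
      MeasurableSet A ∧ 0 < volume A ∧ (∀ ζ ∈ A, 2 * r ≤ ‖ζ‖ ∧ ‖ζ‖ ≤ ρ) ∧
      (∀ ζ ∈ A, m ≤ ‖g ζ‖ ∧ ‖g ζ‖ ≤ R) ∧
      (∀ n, ContDiff ℝ ∞ (ψ n)) ∧ (∀ n ξ, ψ n ξ ≠ 0 → 2 * r ≤ ‖ξ‖ ∧ ‖ξ‖ ≤ ρ) ∧
      (∀ n ξ, ‖ψ n ξ‖ ≤ R) ∧ ∀ᵐ ξ, Tendsto (fun n => ψ n ξ) atTop (𝓝 (A.indicator g ξ)) := by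
  obtain ⟨k, hk⟩ := exists_good_set hN hne
  set A := {ζ : Space N | (((k : ℝ) + 1)⁻¹ ≤ ‖ζ‖ ∧ ‖ζ‖ ≤ k) ∧
      (((k : ℝ) + 1)⁻¹ ≤ ‖g ζ‖ ∧ ‖g ζ‖ ≤ k)} with hA
  have hAm : MeasurableSet A := by
    refine (measurableSet_annulus _ _).inter ?_
    exact (measurableSet_le measurable_const hg.norm).inter
      (measurableSet_le hg.norm measurable_const)
  have hk0 : (0 : ℝ) < (k : ℝ) + 1 := by positivity
  have hbound : ∀ ζ, ‖A.indicator g ζ‖ ≤ (k : ℝ) + 1 := fun ζ => by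
    by_cases hζ : ζ ∈ A
    · rw [indicator_of_mem hζ]; linarith [hζ.2.2]
    · rw [indicator_of_notMem hζ]; simp; positivity
  have hAb : volume A < ⊤ := lt_of_le_of_lt (measure_mono fun ζ hζ => hζ.1) 
    (volume_annulus_lt_top (((k : ℝ) + 1)⁻¹) (k : ℝ))
  have hGi : Integrable (A.indicator g) := by
    refine Integrable.mono' (g := A.indicator fun _ => (k : ℝ) + 1)
      ((integrable_indicator_iff hAm).2 (integrableOn_const hAb.ne)) 
      (hg.indicator hAm).aestronglyMeasurable (Eventually.of_forall fun ζ => ?_)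
    by_cases hζ : ζ ∈ A
    · rw [indicator_of_mem hζ, indicator_of_mem hζ]; linarith [hζ.2.2]
    · rw [indicator_of_notMem hζ, indicator_of_notMem hζ]; simp
  -- Mollification radii of at most half the inner radius (k+1)⁻¹ of A: the mollified functions keep
  -- distance (2(k+1))⁻¹ = 2r from the origin, with r = (4(k+1))⁻¹.
  set s : ℕ → ℝ := fun n => (2 * ((k : ℝ) + 1))⁻¹ * (1 / ((n : ℝ) + 1)) with hs
  have hs0 : ∀ n, 0 < s n := fun n => by positivity
  have hs1 : ∀ n, s n ≤ (2 * ((k : ℝ) + 1))⁻¹ := fun n => by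
    refine mul_le_of_le_one_right (by positivity) ?_
    rw [div_le_one (by positivity)]
    have : (0 : ℝ) ≤ n := Nat.cast_nonneg n
    linarith
  let φ : ℕ → ContDiffBump (0 : Space N) := fun n => ⟨s n / 2, s n, half_pos (hs0 n),
    half_lt_self (hs0 n)⟩
  let ψ : ℕ → Space N → ℂ := fun n =>
    ((φ n).normed volume ⋆[ContinuousLinearMap.lsmul ℝ ℝ, volume] A.indicator g)
  have hinv : ((k : ℝ) + 1)⁻¹ = 2 * (2 * ((k : ℝ) + 1))⁻¹ := by field_simp
  refine ⟨(4 * ((k : ℝ) + 1))⁻¹, (k : ℝ) + 1, ((k : ℝ) + 1)⁻¹, (k : ℝ) + 1, A, ψ, by positivity,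
    hk0, by positivity, hk0, hAm, hk, ?_, ?_, ?_, ?_, ?_, ?_⟩
  · intro ζ hζ
    refine ⟨?_, by linarith [hζ.1.2]⟩
    have h1 := hζ.1.1
    have : 2 * (4 * ((k : ℝ) + 1))⁻¹ ≤ ((k : ℝ) + 1)⁻¹ := by
      have : 2 * (4 * ((k : ℝ) + 1))⁻¹ = ((k : ℝ) + 1)⁻¹ / 2 := by field_simp; norm_num
      have h0 : 0 < ((k : ℝ) + 1)⁻¹ := by positivity
      linarith
    linarith
  · exact fun ζ hζ => ⟨hζ.2.1, by linarith [hζ.2.2]⟩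
  · exact fun n => (φ n).hasCompactSupport_normed.contDiff_convolution_left _
      (φ n).contDiff_normed hGi.locallyIntegrable
  · intro n ξ hξ
    have hmem : ξ ∈ Function.support (ψ n) := hξ
    have := support_convolution_subset _ hmem
    obtain ⟨x, hx, y, hy, rfl⟩ := mem_add.1 this
    rw [(φ n).support_normed_eq, mem_ball_zero_iff] at hx
    have hx' : ‖x‖ ≤ (2 * ((k : ℝ) + 1))⁻¹ := hx.le.trans (hs1 n)
    have hyA : y ∈ A := by
      by_contra h
      exact hy (indicator_of_notMem h g)
    have h1 := hyA.1.1
    have h2 := hyA.1.2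
    have h3 := norm_add_le x y
    have h4 : ‖y‖ - ‖x‖ ≤ ‖x + y‖ := by
      have := norm_sub_le (x + y) x
      rw [add_sub_cancel_left] at this
      linarith
    have h5 : (2 * ((k : ℝ) + 1))⁻¹ ≤ 1 := inv_le_one_of_one_le₀ (by
      have : (0 : ℝ) ≤ k := Nat.cast_nonneg k
      linarith)
    have h6 : 2 * (4 * ((k : ℝ) + 1))⁻¹ = (2 * ((k : ℝ) + 1))⁻¹ := by field_simp; norm_num
    exact ⟨by linarith, by linarith⟩
  · intro n ξ
    simp only [ψ, convolution, ContinuousLinearMap.lsmul_apply]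
    calc ‖∫ t, (φ n).normed volume t • A.indicator g (ξ - t)‖
        ≤ ∫ t, (φ n).normed volume t * ((k : ℝ) + 1) := by
          refine norm_integral_le_of_norm_le ((φ n).integrable_normed.mul_const _)
            (Eventually.of_forall fun t => ?_)
          rw [norm_smul, Real.norm_of_nonneg ((φ n).nonneg_normed t)]
          exact mul_le_mul_of_nonneg_left (hbound _) ((φ n).nonneg_normed t)
      _ = (k : ℝ) + 1 := by
          rw [integral_mul_const, (φ n).integral_normed, one_mul]
  · refine ContDiffBump.ae_convolution_tendsto_right_of_locallyIntegrable (K := 2) ?_ ?_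
      hGi.locallyIntegrable
    · have := (tendsto_one_div_add_atTop_nhds_zero_nat (𝕜 := ℝ)).const_mul
        (2 * ((k : ℝ) + 1))⁻¹
      rw [mul_zero] at this
      exact this
    · exact Eventually.of_forall fun n => by
        change s n ≤ 2 * (s n / 2)
        linarith

/-- Up to m/4 each, x is bounded by a multiple of x^q and d by d²/m. This turns |g| ≥ m into a lower
bound for |v|^q with a quadratic error in v-g. -/
lemma half_le_rpow_add_sq {m q x d y : ℝ} (hm : 0 < m) (hq : 1 < q) (hx : 0 ≤ x)
    (hy : m ≤ y) (hyx : y ≤ x + d) :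
    m / 2 ≤ (m / 4) ^ (1 - q) * x ^ q + m⁻¹ * d ^ 2 := by
  have h1 : x ≤ m / 4 + (m / 4) ^ (1 - q) * x ^ q := by
    rcases le_total x (m / 4) with h | h
    · have : 0 ≤ (m / 4) ^ (1 - q) * x ^ q := by positivity
      linarith
    · have hx0 : 0 < x := by linarith
      have e : x = x ^ (1 - q) * x ^ q := by
        rw [← Real.rpow_add hx0]; simp
      have e2 : x ^ (1 - q) ≤ (m / 4) ^ (1 - q) :=
        Real.rpow_le_rpow_of_nonpos (by positivity) h (by linarith)
      have e3 : x ^ (1 - q) * x ^ q ≤ (m / 4) ^ (1 - q) * x ^ q := by gcongr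
      linarith
  have h2 : d ≤ m / 4 + m⁻¹ * d ^ 2 := by
    have : m⁻¹ * (d - m / 2) ^ 2 = m⁻¹ * d ^ 2 - d + m / 4 := by field_simp; ring
    have h3 : 0 ≤ m⁻¹ * (d - m / 2) ^ 2 := by positivity
    linarith
  linarith

/-- Integrate `half_le_rpow_add_sq` over A, where the weights |ζ|^{-b} and (1+|ζ|)^{α-N} are bounded
below. The weighted mass thus cannot degenerate when v is close to g in L². -/
lemma le_weightedMass {N : ℕ} {b α q : ℝ} (hb : 0 < b) (hαN : 0 < (N : ℝ) - α)
    (hq1 : 1 < q) {r ρ m : ℝ} (hr : 0 < r) (hρ : 0 < ρ) (hm : 0 < m) {A : Set (Space N)}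
    (hA : MeasurableSet A) (hAr : ∀ ζ ∈ A, 2 * r ≤ ‖ζ‖ ∧ ‖ζ‖ ≤ ρ) {g v : Space N → ℂ}
    (hg : Measurable g) (hgA : ∀ ζ ∈ A, m ≤ ‖g ζ‖) (hv : Measurable v) :
    ENNReal.ofReal (m / 2) * volume A ≤
      ENNReal.ofReal ((m / 4) ^ (1 - q) * (ρ ^ b * (1 + ρ) ^ ((N : ℝ) - α))) *
        weightedMass b α q v + ENNReal.ofReal m⁻¹ * ∫⁻ ζ, ‖v ζ - g ζ‖ₑ ^ 2 := by
  have hD := measurable_density b q hv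
  rw [← setLIntegral_const, weightedMass, ← lintegral_const_mul _ (by fun_prop),
    ← lintegral_const_mul _ (by fun_prop), ← lintegral_add_right _ (by fun_prop)]
  refine le_trans ?_ (setLIntegral_le_lintegral A _)
  refine setLIntegral_mono' hA fun ζ hζ => ?_
  obtain ⟨h1, h2⟩ := hAr ζ hζ
  have hζ0 : 0 < ‖ζ‖ := by linarith
  rw [← ofReal_norm, ← ENNReal.ofReal_pow (norm_nonneg _), ← ENNReal.ofReal_mul
    (density_nonneg _ _ _ _), ← ENNReal.ofReal_mul (by positivity), ← ENNReal.ofReal_mul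
    (by positivity), ← ENNReal.ofReal_add (by
      have := density_nonneg b q v ζ; positivity) (by positivity)]
  refine ENNReal.ofReal_le_ofReal ((half_le_rpow_add_sq hm hq1 (norm_nonneg (v ζ)) (hgA ζ hζ)
    (d := ‖v ζ - g ζ‖) ?_).trans ?_)
  · have := norm_sub_le (v ζ) (v ζ - g ζ); rwa [sub_sub_cancel] at this
  · refine add_le_add ?_ le_rfl
    rw [mul_assoc]
    refine mul_le_mul_of_nonneg_left ?_ (by positivity)
    have e1 : 1 ≤ ρ ^ b * ‖ζ‖ ^ (-b) := by
      rw [Real.rpow_neg hζ0.le, ← div_eq_mul_inv, one_le_div (by positivity)]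
      exact Real.rpow_le_rpow hζ0.le h2 hb.le
    have e2 : 1 ≤ (1 + ρ) ^ ((N : ℝ) - α) * (1 + ‖ζ‖) ^ (α - (N : ℝ)) := by
      rw [show α - (N : ℝ) = -((N : ℝ) - α) by ring, Real.rpow_neg (by positivity),
        ← div_eq_mul_inv, one_le_div (by positivity)]
      exact Real.rpow_le_rpow (by positivity) (by linarith) hαN.le
    calc ‖v ζ‖ ^ q ≤ (ρ ^ b * ‖ζ‖ ^ (-b)) * ((1 + ρ) ^ ((N : ℝ) - α) * (1 + ‖ζ‖) ^ (α - (N : ℝ))) *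
          ‖v ζ‖ ^ q := le_mul_of_one_le_left (by positivity) (one_le_mul_of_one_le_of_one_le e1 e2)
      _ = _ := by rw [density]; ring

lemma enorm_sub_sq_le (x y z : ℂ) : ‖x - z‖ₑ ^ 2 ≤ 2 * (‖x - y‖ₑ ^ 2 + ‖y - z‖ₑ ^ 2) := by
  rw [← ofReal_norm, ← ofReal_norm, ← ofReal_norm, ← ENNReal.ofReal_pow (norm_nonneg _),
    ← ENNReal.ofReal_pow (norm_nonneg _), ← ENNReal.ofReal_pow (norm_nonneg _),
    ← ENNReal.ofReal_add (by positivity) (by positivity), ← ENNReal.ofReal_ofNat,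
    ← ENNReal.ofReal_mul (by norm_num)]
  refine ENNReal.ofReal_le_ofReal ?_
  have h : ‖x - z‖ ≤ ‖x - y‖ + ‖y - z‖ := norm_sub_le_norm_sub_add_norm_sub x y z
  calc ‖x - z‖ ^ 2 ≤ (‖x - y‖ + ‖y - z‖) ^ 2 := by gcongr
    _ ≤ _ := by nlinarith [sq_nonneg (‖x - y‖ - ‖y - z‖)]

/-- The functions ψₙ approximate only g restricted to A, so g - ψₙ need not be small in L². The
weight |ψₙ|^B removes the complement of A in the limit, and on A the difference tends to zero. -/
lemma tendsto_lintegral_approx {N : ℕ} {g : Space N → ℂ} (hg : Measurable g)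
    (hg2 : ∫⁻ ζ, ‖g ζ‖ₑ ^ 2 ≠ ⊤) {ρ R B : ℝ} (hB : 0 < B) {A : Set (Space N)}
    {ψ : ℕ → Space N → ℂ} (hψm : ∀ n, Measurable (ψ n)) (hψs : ∀ n ξ, ψ n ξ ≠ 0 → ‖ξ‖ ≤ ρ)
    (hψR : ∀ n ξ, ‖ψ n ξ‖ ≤ R)
    (hlim : ∀ᵐ ξ, Tendsto (fun n => ψ n ξ) atTop (𝓝 (A.indicator g ξ))) :
    Tendsto (fun n => ∫⁻ ξ, ‖ψ n ξ‖ₑ ^ B * ‖g ξ - ψ n ξ‖ₑ ^ 2) atTop (𝓝 0) := by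
  have h0 : ∫⁻ ξ, ‖A.indicator g ξ‖ₑ ^ B * ‖g ξ - A.indicator g ξ‖ₑ ^ 2 = 0 := by
    rw [← lintegral_zero (μ := (volume : Measure (Space N)))]
    refine lintegral_congr fun ξ => ?_
    by_cases hξ : ξ ∈ A
    · simp [indicator_of_mem hξ]
    · simp [indicator_of_notMem hξ, ENNReal.zero_rpow_of_pos hB]
  rw [← h0]
  refine tendsto_lintegral_of_dominated_convergence'
    (fun ξ => (Metric.closedBall (0 : Space N) ρ).indicator (fun ξ =>
      ENNReal.ofReal R ^ B * (2 * (‖g ξ‖ₑ ^ 2 + ENNReal.ofReal R ^ 2))) ξ) ?_ ?_ ?_ ?_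
  · intro n
    have := hψm n
    fun_prop
  · refine fun n => Eventually.of_forall fun ξ => ?_
    by_cases hψ : ψ n ξ = 0
    · simp [hψ, ENNReal.zero_rpow_of_pos hB]
    · beta_reduce
      rw [indicator_of_mem (mem_closedBall_zero_iff.2 (hψs n ξ hψ))]
      have h1 : ‖ψ n ξ‖ₑ ≤ ENNReal.ofReal R := by
        rw [← ofReal_norm]; exact ENNReal.ofReal_le_ofReal (hψR n ξ)
      have h2 := enorm_sub_sq_le (g ξ) 0 (ψ n ξ)
      rw [sub_zero, zero_sub, enorm_neg] at h2
      exact mul_le_mul' (ENNReal.rpow_le_rpow h1 hB.le) (h2.trans (by gcongr))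
  · rw [lintegral_indicator Metric.isClosed_closedBall.measurableSet]
    rw [lintegral_const_mul' _ _ (ENNReal.rpow_ne_top_of_nonneg hB.le ENNReal.ofReal_ne_top),
      lintegral_const_mul' _ _ (by norm_num), lintegral_add_right _ measurable_const,
      setLIntegral_const]
    refine ENNReal.mul_ne_top (ENNReal.rpow_ne_top_of_nonneg hB.le ENNReal.ofReal_ne_top)
      (ENNReal.mul_ne_top (by norm_num) (ENNReal.add_ne_top.2 ⟨?_, ENNReal.mul_ne_top
        (ENNReal.pow_ne_top ENNReal.ofReal_ne_top) measure_closedBall_lt_top.ne⟩))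
    exact ((setLIntegral_le_lintegral _ _).trans_lt (lt_top_iff_ne_top.2 hg2)).ne
  · filter_upwards [hlim] with ξ hξ
    have h1 := (ENNReal.continuous_rpow_const (y := B)).tendsto _ |>.comp hξ.enorm
    have h2 := ENNReal.Tendsto.pow (n := 2) (hξ.const_sub (g ξ)).enorm
    refine ENNReal.Tendsto.mul h1 (Or.inr ?_) h2 (Or.inr ?_)
    · exact ENNReal.pow_ne_top enorm_ne_top
    · exact ENNReal.rpow_ne_top_of_nonneg hB.le enorm_ne_top

/-- Fatou's lemma, the limit being at least m on a set of positive measure. -/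
lemma exists_eventually_lt_lintegral {N : ℕ} {g : Space N → ℂ} {m q : ℝ} (hm : 0 < m) (hq : 0 < q)
    {A : Set (Space N)} (hA : MeasurableSet A) (hA0 : 0 < volume A) (hgA : ∀ ζ ∈ A, m ≤ ‖g ζ‖)
    {ψ : ℕ → Space N → ℂ} (hψm : ∀ n, Measurable (ψ n))
    (hlim : ∀ᵐ ξ, Tendsto (fun n => ψ n ξ) atTop (𝓝 (A.indicator g ξ))) :
    ∃ S : ENNReal, 0 < S ∧ S ≠ ⊤ ∧ ∀ᶠ n in atTop, S < ∫⁻ ξ, ‖ψ n ξ‖ₑ ^ q := by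
  have h1 : 0 < ∫⁻ ξ, liminf (fun n => ‖ψ n ξ‖ₑ ^ q) atTop := by
    have h2 : ∫⁻ ξ, liminf (fun n => ‖ψ n ξ‖ₑ ^ q) atTop = ∫⁻ ξ, ‖A.indicator g ξ‖ₑ ^ q := by
      refine lintegral_congr_ae ?_
      filter_upwards [hlim] with ξ hξ
      exact ((ENNReal.continuous_rpow_const (y := q)).tendsto _ |>.comp hξ.enorm).liminf_eq
    rw [h2]
    have h3 : ENNReal.ofReal m ^ q * volume A ≤ ∫⁻ ξ, ‖A.indicator g ξ‖ₑ ^ q := by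
      rw [← setLIntegral_const]
      refine le_trans (setLIntegral_mono' hA fun ζ hζ => ?_) (setLIntegral_le_lintegral A _)
      rw [indicator_of_mem hζ, ← ofReal_norm]
      exact ENNReal.rpow_le_rpow (ENNReal.ofReal_le_ofReal (hgA ζ hζ)) hq.le
    refine lt_of_lt_of_le (ENNReal.mul_pos ?_ hA0.ne') h3
    exact (ENNReal.rpow_pos (ENNReal.ofReal_pos.2 hm) ENNReal.ofReal_ne_top).ne'
  obtain ⟨S, hS0, hS⟩ := exists_between h1
  refine ⟨S, hS0, hS.ne_top, ?_⟩
  have h4 := lintegral_liminf_le (μ := (volume : Measure (Space N)))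
    (f := fun n ξ => ‖ψ n ξ‖ₑ ^ q) (u := atTop) (fun n => by have := hψm n; fun_prop)
  exact eventually_lt_of_lt_liminf (hS.trans_le h4)

lemma re_nonlinearity_mul {N : ℕ} (b α q : ℝ) (v ψ : Space N → ℂ) (ξ : Space N) :
    (nonlinearity b α q v ξ * (starRingEnd ℂ) (ψ ξ)).re =
      potential b α q v ξ * ‖ξ‖ ^ (-b) *
        (‖v ξ‖ ^ (q - 2) * (v ξ * (starRingEnd ℂ) (ψ ξ)).re) := by
  rw [nonlinearity, mul_assoc, Complex.re_ofReal_mul]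
  ring

/-- Pointwise lower bound of the nonlinearity tested against a profile close to the solution. -/
lemma le_re_nonlinearity_mul {N : ℕ} {b α q : ℝ} (hb : 0 < b) (hα : 0 < α)
    (hαN : 0 < (N : ℝ) - α) (hq1 : 1 < q) {r ρ : ℝ} (hr : 0 < r) (v ψ : Space N → ℂ) {ξ : Space N}
    (hξ : ψ ξ ≠ 0 → 2 * r ≤ ‖ξ‖ ∧ ‖ξ‖ ≤ ρ) :
    potential b α q v ξ * (ρ ^ (-b) * ((1 / 2) ^ q * (2 / 9)) * ‖ψ ξ‖ ^ q) ≤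
      (nonlinearity b α q v ξ * (starRingEnd ℂ) (ψ ξ)).re + potential b α q v ξ *
        ((2 * r) ^ (-b) * (2 * 3 ^ (q - 1)) * (‖v ξ - ψ ξ‖ ^ (q - 1) * ‖ψ ξ‖)) := by
  by_cases h0 : ψ ξ = 0
  · simp [h0, Real.zero_rpow (by linarith : q ≠ 0)]
  obtain ⟨h1, h2⟩ := hξ h0
  have hξ0 : 0 < ‖ξ‖ := by linarith
  have hP := potential_nonneg (b := b) (q := q) hα hαN v ξ
  have e1 : ρ ^ (-b) ≤ ‖ξ‖ ^ (-b) := Real.rpow_le_rpow_of_nonpos hξ0 h2 (by linarith)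
  have e2 : ‖ξ‖ ^ (-b) ≤ (2 * r) ^ (-b) :=
    Real.rpow_le_rpow_of_nonpos (by positivity) h1 (by linarith)
  have h3 := coercive_pairing hq1 (v ξ) (ψ ξ)
  rw [re_nonlinearity_mul, mul_assoc (potential b α q v ξ), ← mul_add]
  refine mul_le_mul_of_nonneg_left ?_ hP
  calc ρ ^ (-b) * ((1 / 2) ^ q * (2 / 9)) * ‖ψ ξ‖ ^ q
      ≤ ‖ξ‖ ^ (-b) * ((1 / 2) ^ q * (2 / 9)) * ‖ψ ξ‖ ^ q := by gcongr
    _ = ‖ξ‖ ^ (-b) * ((1 / 2) ^ q * (2 / 9) * ‖ψ ξ‖ ^ q) := by ring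
    _ ≤ ‖ξ‖ ^ (-b) * (‖v ξ‖ ^ (q - 2) * (v ξ * (starRingEnd ℂ) (ψ ξ)).re +
          2 * 3 ^ (q - 1) * (‖v ξ - ψ ξ‖ ^ (q - 1) * ‖ψ ξ‖)) := by gcongr
    _ = ‖ξ‖ ^ (-b) * (‖v ξ‖ ^ (q - 2) * (v ξ * (starRingEnd ℂ) (ψ ξ)).re) +
          ‖ξ‖ ^ (-b) * (2 * 3 ^ (q - 1)) * (‖v ξ - ψ ξ‖ ^ (q - 1) * ‖ψ ξ‖) := by ring
    _ ≤ _ := by gcongr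

/-- A lower bound for the real part of an integral from bounds of lower integrals. -/
lemma toReal_le_integral_of_lintegral {X : Type*} [MeasurableSpace X] {μ : Measure X}
    {F A₁ A₂ : X → ℝ} {p : X → ENNReal} (hF : Integrable F μ) (hp : AEMeasurable p μ)
    (hA₂ : Measurable A₂) (hA₁0 : 0 ≤ A₁) (hA₂0 : 0 ≤ A₂) (hpt : ∀ᵐ x ∂μ, p x ≠ ⊤)
    (hle : ∀ᵐ x ∂μ, (p x).toReal * A₁ x ≤ F x + (p x).toReal * A₂ x) {Y : ENNReal} (hY : Y ≠ ⊤)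
    (h₁ : 2 * Y ≤ ∫⁻ x, p x * ENNReal.ofReal (A₁ x) ∂μ)
    (h₂ : ∫⁻ x, p x * ENNReal.ofReal (A₂ x) ∂μ ≤ Y) :
    Y.toReal ≤ ∫ x, F x ∂μ := by
  have hof : ∀ A : X → ℝ, 0 ≤ A → ∀ᵐ x ∂μ, ENNReal.ofReal ((p x).toReal * A x) =
      p x * ENNReal.ofReal (A x) := fun A _ => by
    filter_upwards [hpt] with x hx
    rw [ENNReal.ofReal_mul ENNReal.toReal_nonneg, ENNReal.ofReal_toReal hx]
  have m2 : AEStronglyMeasurable (fun x => (p x).toReal * A₂ x) μ :=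
    (hp.ennreal_toReal.mul hA₂.aemeasurable).aestronglyMeasurable
  have nn2 : 0 ≤ᵐ[μ] fun x => (p x).toReal * A₂ x :=
    Eventually.of_forall fun x => mul_nonneg ENNReal.toReal_nonneg (hA₂0 x)
  have i2 : ∫⁻ x, ENNReal.ofReal ((p x).toReal * A₂ x) ∂μ ≤ Y := by
    rw [lintegral_congr_ae (hof A₂ hA₂0)]; exact h₂
  have int2 : Integrable (fun x => (p x).toReal * A₂ x) μ :=
    (lintegral_ofReal_ne_top_iff_integrable m2 nn2).1 (i2.trans_lt hY.lt_top).ne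
  have b2 : ∫ x, (p x).toReal * A₂ x ∂μ ≤ Y.toReal := by
    rw [integral_eq_lintegral_of_nonneg_ae nn2 m2]
    exact ENNReal.toReal_mono hY i2
  have nn3 : 0 ≤ᵐ[μ] fun x => F x + (p x).toReal * A₂ x := by
    filter_upwards [hle] with x hx
    exact (mul_nonneg ENNReal.toReal_nonneg (hA₁0 x)).trans hx
  -- Only F and pA₂ are known to be integrable; the main term pA₁ enters through its lower integral
  -- alone.
  have b3 : 2 * Y ≤ ENNReal.ofReal (∫ x, F x + (p x).toReal * A₂ x ∂μ) := by
    rw [ofReal_integral_eq_lintegral_ofReal (hF.fun_add int2) nn3]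
    refine h₁.trans (lintegral_mono_ae ?_)
    filter_upwards [hof A₁ hA₁0, hle] with x h1 h2
    rw [← h1]
    exact ENNReal.ofReal_le_ofReal h2
  rw [integral_add hF int2] at b3
  have b4 := ENNReal.toReal_mono ENNReal.ofReal_ne_top b3
  rw [ENNReal.toReal_mul, ENNReal.toReal_ofNat] at b4
  rcases le_total 0 (∫ x, F x ∂μ + ∫ x, (p x).toReal * A₂ x ∂μ) with h | h
  · rw [ENNReal.toReal_ofReal h] at b4
    linarith
  · rw [ENNReal.ofReal_of_nonpos h] at b4
    have : 0 ≤ ∫ x, (p x).toReal * A₂ x ∂μ := integral_nonneg_of_ae nn2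
    have hY0 : 0 ≤ Y.toReal := ENNReal.toReal_nonneg
    have b5 : 0 ≤ ∫ x, F x + (p x).toReal * A₂ x ∂μ := integral_nonneg_of_ae nn3
    rw [integral_add hF int2] at b5
    have b6 : Y.toReal = 0 := by simp at b4; linarith
    rw [b6] at b2 ⊢
    linarith

/-- The exponent 2/(q-1) turns |v-ψ|^{q-1} into a square, which is split through g. The weight
|ψ|^{2/(q-1)} is kept on g-ψ, where it is needed for smallness, and bounded by its supremum on v-g.
-/
lemma lintegral_error_rpow_le {N : ℕ} {q R : ℝ} (hq1 : 1 < q)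
    {κ : ℝ} (hκ : 0 ≤ κ) {g v ψ : Space N → ℂ} (hg : Measurable g) (hψ : Measurable ψ)
    (hv : Measurable v) (hψR : ∀ ξ, ‖ψ ξ‖ ≤ R) :
    ∫⁻ ξ, ENNReal.ofReal (κ * (‖v ξ - ψ ξ‖ ^ (q - 1) * ‖ψ ξ‖)) ^ ((q - 1) / 2)⁻¹ ≤
      ENNReal.ofReal κ ^ ((q - 1) / 2)⁻¹ * 2 * (ENNReal.ofReal R ^ ((q - 1) / 2)⁻¹ *
        ∫⁻ ξ, ‖v ξ - g ξ‖ₑ ^ 2) + ENNReal.ofReal κ ^ ((q - 1) / 2)⁻¹ * 2 *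
        ∫⁻ ξ, ‖ψ ξ‖ₑ ^ ((q - 1) / 2)⁻¹ * ‖g ξ - ψ ξ‖ₑ ^ 2 := by
  have hB : 0 < ((q - 1) / 2)⁻¹ := inv_pos.2 (by linarith)
  rw [← lintegral_const_mul _ (by fun_prop), ← lintegral_const_mul _ (by fun_prop),
    ← lintegral_const_mul _ (by fun_prop), ← lintegral_add_left (by fun_prop)]
  refine lintegral_mono fun ξ => ?_
  rw [ENNReal.ofReal_mul hκ, ENNReal.mul_rpow_of_nonneg _ _ hB.le,
    ENNReal.ofReal_mul (by positivity), ENNReal.mul_rpow_of_nonneg _ _ hB.le,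
    ENNReal.ofReal_rpow_of_nonneg (Real.rpow_nonneg (norm_nonneg _) _) hB.le,
    ← Real.rpow_mul (norm_nonneg _)]
  have e1 : (q - 1) * ((q - 1) / 2)⁻¹ = 2 := by
    have : q - 1 ≠ 0 := by linarith
    field_simp
  rw [e1, Real.rpow_two, ENNReal.ofReal_pow (norm_nonneg _), ofReal_norm, ofReal_norm, mul_assoc _ 2,
    mul_assoc _ 2, ← mul_add]
  refine mul_le_mul_right ?_ _
  have h1 : ‖ψ ξ‖ₑ ^ ((q - 1) / 2)⁻¹ ≤ ENNReal.ofReal R ^ ((q - 1) / 2)⁻¹ := by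
    rw [← ofReal_norm]
    exact ENNReal.rpow_le_rpow (ENNReal.ofReal_le_ofReal (hψR ξ)) hB.le
  calc ‖v ξ - ψ ξ‖ₑ ^ 2 * ‖ψ ξ‖ₑ ^ ((q - 1) / 2)⁻¹
      ≤ 2 * (‖v ξ - g ξ‖ₑ ^ 2 + ‖g ξ - ψ ξ‖ₑ ^ 2) * ‖ψ ξ‖ₑ ^ ((q - 1) / 2)⁻¹ :=
        mul_le_mul_left (enorm_sub_sq_le _ _ _) _
    _ = 2 * (‖ψ ξ‖ₑ ^ ((q - 1) / 2)⁻¹ * ‖v ξ - g ξ‖ₑ ^ 2) +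
          2 * (‖ψ ξ‖ₑ ^ ((q - 1) / 2)⁻¹ * ‖g ξ - ψ ξ‖ₑ ^ 2) := by ring
    _ ≤ _ := by gcongr

/-- The nonlinearity of every function close in `L²` to a nonzero profile `g` has a definite real
part when tested against a suitable smooth function. -/
theorem exists_lower_bound {N : ℕ} (hN : 2 ≤ N) {b α q : ℝ} (hb : 0 < b) (hα : 0 < α)
    (hαN : 0 < (N : ℝ) - α) (hq1 : 1 < q) (hq₂ : q < 1 + (1 + α - 2 * b) / (N : ℝ))
    {g : Space N → ℂ} (hg : Measurable g) (hg2 : ∫⁻ ζ, ‖g ζ‖ₑ ^ 2 ≠ ⊤)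
    (hne : ¬ g =ᵐ[volume] 0) :
    ∃ (ψ : Space N → ℂ) (c₀ : ℝ) (η : ENNReal), ContDiff ℝ ∞ ψ ∧ HasCompactSupport ψ ∧ 0 < c₀ ∧
      0 < η ∧ ∀ v : Space N → ℂ, Measurable v → ∫⁻ ζ, ‖v ζ - g ζ‖ₑ ^ 2 ≤ η →
        (∀ᵐ ξ, PotentialExistsAt b α q v ξ) →
        Integrable (fun ξ => nonlinearity b α q v ξ * (starRingEnd ℂ) (ψ ξ)) →
        c₀ ≤ (∫ ξ, nonlinearity b α q v ξ * (starRingEnd ℂ) (ψ ξ)).re := by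
  obtain ⟨r, ρ, m, R, A, ψ, hr, hρ, hm, hR, hAm, hA0, hAr, hgA, hψd, hψs, hψR, hlim⟩ :=
    exists_smooth_approx (by omega) hg hne
  have hψm : ∀ n, Measurable (ψ n) := fun n => (hψd n).continuous.measurable
  set B := ((q - 1) / 2)⁻¹ with hBdef
  have hβ : 0 < (q - 1) / 2 := by linarith
  have hB : 0 < B := inv_pos.2 hβ
  obtain ⟨S, hS0, hSt, hS⟩ := exists_eventually_lt_lintegral hm (by linarith : 0 < q) hAm hA0
    (fun ζ hζ => (hgA ζ hζ).1) hψm hlim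
  have herr := tendsto_lintegral_approx hg hg2 hB hψm (fun n ξ h => (hψs n ξ h).2) hψR hlim
  have hAt : volume A ≠ ⊤ := (lt_of_le_of_lt (measure_mono fun ζ hζ => hAr ζ hζ)
    (volume_annulus_lt_top (2 * r) ρ)).ne
  obtain ⟨C, hC, hup⟩ := exists_potential_bound hN hb hα hαN hq1 hq₂ hr hρ
    (Q := 2 * (1 + ∫⁻ ζ, ‖g ζ‖ₑ ^ 2)) (ENNReal.mul_ne_top (by norm_num)
      (ENNReal.add_ne_top.2 ⟨by norm_num, hg2⟩))
  -- constants
  set κ₁ := ρ ^ (-b) * ((1 / 2) ^ q * (2 / 9)) with hκ₁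
  set κ₂ := (2 * r) ^ (-b) * (2 * 3 ^ (q - 1)) with hκ₂
  have hκ₁0 : 0 < κ₁ := by positivity
  have hκ₂0 : 0 < κ₂ := by positivity
  set cL := rieszConst N α * (1 + ρ) ^ (α - (N : ℝ)) with hcL
  have hcL0 : 0 < cL := by have := rieszConst_pos hα hαN; positivity
  set c₂ := ENNReal.ofReal ((m / 4) ^ (1 - q) * (ρ ^ b * (1 + ρ) ^ ((N : ℝ) - α))) with hc₂
  have hc₂0 : c₂ ≠ 0 := (ENNReal.ofReal_pos.2 (by positivity)).ne'
  -- Half of the left side of `le_weightedMass` is reserved for the quadratic error; the other half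
  -- bounds the weighted mass below by M₀.
  set M₀ := ENNReal.ofReal (m / 4) * volume A / c₂ with hM₀
  have hM₀0 : M₀ ≠ 0 := by
    refine (ENNReal.div_pos (mul_ne_zero ?_ hA0.ne') ENNReal.ofReal_ne_top).ne'
    exact (ENNReal.ofReal_pos.2 (by positivity)).ne'
  have hM₀t : M₀ ≠ ⊤ := ENNReal.div_ne_top (ENNReal.mul_ne_top ENNReal.ofReal_ne_top hAt) hc₂0
  set T := ENNReal.ofReal cL * ENNReal.ofReal κ₁ * S with hT
  have hT0 : T ≠ 0 := mul_ne_zero (mul_ne_zero (ENNReal.ofReal_pos.2 hcL0).ne'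
    (ENNReal.ofReal_pos.2 hκ₁0).ne') hS0.ne'
  have hTt : T ≠ ⊤ := ENNReal.mul_ne_top (ENNReal.mul_ne_top ENNReal.ofReal_ne_top
    ENNReal.ofReal_ne_top) hSt
  -- For M ≥ M₀ this gives C(M+1) ≤ C'M; the added 1 keeps C' nonzero, so that it can be divided by.
  set C' := (C + 1) * (1 + M₀⁻¹) with hC'
  have hC't : C' ≠ ⊤ := ENNReal.mul_ne_top (ENNReal.add_ne_top.2 ⟨hC, by norm_num⟩)
    (ENNReal.add_ne_top.2 ⟨by norm_num, ENNReal.inv_ne_top.2 hM₀0⟩)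
  have hC'0 : C' ≠ 0 := by simp [hC']
  -- The main term is at least MT, and an error of L^{2/(q-1)} norm at most τ costs at most C'Mτ =
  -- MT/2.
  set τ := T / 2 / C' with hτ
  have hτ0 : 0 < τ := ENNReal.div_pos (ENNReal.div_pos hT0 (by norm_num)).ne' hC't
  have hτB : 0 < τ ^ B / 2 := by
    refine ENNReal.div_pos (ENNReal.rpow_pos hτ0 ?_).ne' (by norm_num)
    exact ENNReal.div_ne_top (ENNReal.div_ne_top hTt (by norm_num)) hC'0
  set K₁ := ENNReal.ofReal κ₂ ^ B * 2 with hK₁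
  have hK₁t : K₁ ≠ ⊤ := ENNReal.mul_ne_top
    (ENNReal.rpow_ne_top_of_nonneg hB.le ENNReal.ofReal_ne_top) (by norm_num)
  -- choice of the profile
  have herr2 : Tendsto (fun n => K₁ * ∫⁻ ξ, ‖ψ n ξ‖ₑ ^ B * ‖g ξ - ψ n ξ‖ₑ ^ 2) atTop (𝓝 0) := by
    simpa using ENNReal.Tendsto.const_mul herr (Or.inr hK₁t)
  obtain ⟨n, hn1, hn2⟩ := (hS.and (ENNReal.tendsto_nhds_zero.1 herr2 _ hτB)).exists
  set K₂ := K₁ * ENNReal.ofReal R ^ B with hK₂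
  have hK₂t : K₂ ≠ ⊤ := ENNReal.mul_ne_top hK₁t
    (ENNReal.rpow_ne_top_of_nonneg hB.le ENNReal.ofReal_ne_top)
  have hK₂1 : K₂ + 1 ≠ ⊤ := ENNReal.add_ne_top.2 ⟨hK₂t, by norm_num⟩
  -- The three bounds serve, in order, the uniform L² bound on v, the inequality M₀ ≤ M, and the
  -- half of the error budget τ^B left over by the choice of n.
  set η := min 1 (min (ENNReal.ofReal m * (ENNReal.ofReal (m / 4) * volume A))
    (τ ^ B / 2 / (K₂ + 1))) with hη
  have hη0 : 0 < η := by
    refine lt_min (by norm_num) (lt_min ?_ (ENNReal.div_pos hτB.ne' hK₂1))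
    refine ENNReal.mul_pos (ENNReal.ofReal_pos.2 hm).ne' (mul_ne_zero ?_ hA0.ne')
    exact (ENNReal.ofReal_pos.2 (by positivity)).ne'
  refine ⟨ψ n, (M₀ * T / 2).toReal, η, hψd n, ?_, ?_, hη0, fun v hv hvg hpot hint => ?_⟩
  · exact HasCompactSupport.of_support_subset_isCompact (isCompact_closedBall (0 : Space N) ρ)
      fun ξ hξ => mem_closedBall_zero_iff.2 (hψs n ξ hξ).2
  · refine ENNReal.toReal_pos ?_ (ENNReal.div_ne_top (ENNReal.mul_ne_top hM₀t hTt) (by norm_num))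
    exact (ENNReal.div_pos (mul_ne_zero hM₀0 hT0) (by norm_num)).ne'
  set M := weightedMass b α q v with hM
  obtain ⟨ξ₀, hξ₀⟩ := hpot.exists
  have hMt : M ≠ ⊤ := weightedMass_ne_top hα hαN (by omega) hv hξ₀
  have hM₀M : M₀ ≤ M := by
    have h := le_weightedMass (v := v) hb hαN hq1 hr hρ hm hAm hAr hg (fun ζ hζ => (hgA ζ hζ).1) hv
    have h2 : ENNReal.ofReal m⁻¹ * ∫⁻ ζ, ‖v ζ - g ζ‖ₑ ^ 2 ≤ ENNReal.ofReal (m / 4) * volume A := by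
      calc _ ≤ ENNReal.ofReal m⁻¹ * (ENNReal.ofReal m * (ENNReal.ofReal (m / 4) * volume A)) :=
            mul_le_mul_right (hvg.trans ((min_le_right _ _).trans (min_le_left _ _))) _
        _ = _ := by
            rw [← mul_assoc, ← ENNReal.ofReal_mul (by positivity), inv_mul_cancel₀ hm.ne']
            simp
    have h3 : ENNReal.ofReal (m / 2) * volume A = ENNReal.ofReal (m / 4) * volume A +
        ENNReal.ofReal (m / 4) * volume A := by
      rw [← add_mul, ← ENNReal.ofReal_add (by positivity) (by positivity)]
      congr 2; ring
    rw [h3] at h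
    have h4 := (ENNReal.add_le_add_iff_right (ENNReal.mul_ne_top ENNReal.ofReal_ne_top hAt)).1
      (h.trans (add_le_add le_rfl h2))
    exact ENNReal.div_le_of_le_mul' h4
  have hvQ : ∫⁻ ζ, ‖v ζ‖ₑ ^ 2 ≤ 2 * (1 + ∫⁻ ζ, ‖g ζ‖ₑ ^ 2) := by
    calc ∫⁻ ζ, ‖v ζ‖ₑ ^ 2 ≤ ∫⁻ ζ, 2 * (‖v ζ - g ζ‖ₑ ^ 2 + ‖g ζ‖ₑ ^ 2) := by
          refine lintegral_mono fun ζ => ?_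
          simpa using enorm_sub_sq_le (v ζ) (g ζ) 0
      _ = 2 * ((∫⁻ ζ, ‖v ζ - g ζ‖ₑ ^ 2) + ∫⁻ ζ, ‖g ζ‖ₑ ^ 2) := by
          rw [lintegral_const_mul _ (by fun_prop), lintegral_add_right _ (by fun_prop)]
      _ ≤ _ := by
          gcongr
          exact hvg.trans (min_le_left _ _)
  have hMT : M * T / 2 ≠ ⊤ := ENNReal.div_ne_top (ENNReal.mul_ne_top hMt hTt) (by norm_num)
  have hfin := toReal_le_integral_of_lintegral (μ := (volume : Measure (Space N)))
    (F := fun ξ => (nonlinearity b α q v ξ * (starRingEnd ℂ) (ψ n ξ)).re)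
    (A₁ := fun ξ => κ₁ * ‖ψ n ξ‖ ^ q)
    (A₂ := fun ξ => κ₂ * (‖v ξ - ψ n ξ‖ ^ (q - 1) * ‖ψ n ξ‖)) (p := potentialE b α q v)
    hint.re (measurable_potentialE b α q hv).aemeasurable
    (by have := hψm n; fun_prop) (fun ξ => by positivity) (fun ξ => by positivity)
    (hpot.mono fun ξ hξ => potentialE_ne_top hα hαN hξ)
    (hpot.mono fun ξ hξ => by
      rw [← ofReal_potential hα hαN hξ, ENNReal.toReal_ofReal (potential_nonneg hα hαN v ξ)]
      exact le_re_nonlinearity_mul hb hα hαN hq1 hr v (ψ n) (hψs n ξ))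
    (Y := M * T / 2) hMT ?_ ?_
  · have e : (∫ ξ, nonlinearity b α q v ξ * (starRingEnd ℂ) (ψ n ξ)).re =
        ∫ ξ, (nonlinearity b α q v ξ * (starRingEnd ℂ) (ψ n ξ)).re := (integral_re hint).symm
    rw [e]
    refine le_trans (ENNReal.toReal_mono hMT ?_) hfin
    gcongr
  · calc 2 * (M * T / 2) = M * T := ENNReal.mul_div_cancel (by norm_num) (by norm_num)
      _ = ENNReal.ofReal cL * M * (ENNReal.ofReal κ₁ * S) := by rw [hT]; ring
      _ ≤ ENNReal.ofReal cL * M * (ENNReal.ofReal κ₁ * ∫⁻ ξ, ‖ψ n ξ‖ₑ ^ q) := by gcongr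
      _ = ∫⁻ ξ, ENNReal.ofReal cL * M * ENNReal.ofReal (κ₁ * ‖ψ n ξ‖ ^ q) := by
          have := hψm n
          rw [lintegral_const_mul _ (by fun_prop), ← lintegral_const_mul _ (by fun_prop)]
          congr 1
          refine lintegral_congr fun ξ => ?_
          rw [ENNReal.ofReal_mul hκ₁0.le, ← ofReal_norm,
            ENNReal.ofReal_rpow_of_nonneg (norm_nonneg _) (by linarith)]
      _ ≤ _ := by
          refine lintegral_mono fun ξ => ?_
          by_cases hξ : ψ n ξ = 0
          · simp [hξ, Real.zero_rpow (by linarith : q ≠ 0)]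
          · exact mul_le_mul_left (mul_weightedMass_le hα hαN (by omega) hv (hψs n ξ hξ).2) _
  · have hE : (∫⁻ ξ, ENNReal.ofReal (κ₂ * (‖v ξ - ψ n ξ‖ ^ (q - 1) * ‖ψ n ξ‖)) ^ B) ^ ((q - 1) / 2)
        ≤ τ := by
      have h1 : K₂ * ∫⁻ ξ, ‖v ξ - g ξ‖ₑ ^ 2 ≤ τ ^ B / 2 := by
        calc _ ≤ (K₂ + 1) * (τ ^ B / 2 / (K₂ + 1)) := by
              gcongr
              · exact le_self_add
              · exact hvg.trans ((min_le_right _ _).trans (min_le_right _ _))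
          _ = _ := ENNReal.mul_div_cancel (by simp) hK₂1
      have h2 : ∫⁻ ξ, ENNReal.ofReal (κ₂ * (‖v ξ - ψ n ξ‖ ^ (q - 1) * ‖ψ n ξ‖)) ^ B ≤ τ ^ B := by
        refine (lintegral_error_rpow_le hq1 hκ₂0.le hg (hψm n) hv (hψR n)).trans ?_
        rw [← mul_assoc]
        exact (add_le_add h1 hn2).trans (le_of_eq (ENNReal.add_halves _))
      calc _ ≤ (τ ^ B) ^ ((q - 1) / 2) := ENNReal.rpow_le_rpow h2 hβ.le
        _ = τ := by rw [← ENNReal.rpow_mul, hBdef, inv_mul_cancel₀ hβ.ne', ENNReal.rpow_one]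
    have h := hup v hv hvQ (fun ξ => ENNReal.ofReal (κ₂ * (‖v ξ - ψ n ξ‖ ^ (q - 1) * ‖ψ n ξ‖)))
      (by have := hψm n; fun_prop) (fun ξ hξ => hψs n ξ fun h0 => hξ (by simp [h0]))
    calc _ ≤ C * (M + 1) * τ := h.trans (mul_le_mul_right hE _)
      _ ≤ (C + 1) * (M * (1 + M₀⁻¹)) * τ := by
          gcongr
          · exact le_self_add
          · rw [mul_add, mul_one]
            gcongr
            rw [← div_eq_mul_inv, ENNReal.le_div_iff_mul_le (Or.inl hM₀0) (Or.inl hM₀t), one_mul]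
            exact hM₀M
      _ = M * (C' * (T / 2 / C')) := by rw [hC', hτ]; ring
      _ = M * T / 2 := by rw [ENNReal.mul_div_cancel hC'0 hC't]; exact (mul_div_assoc M T 2).symm

/-! ### Scaling of the nonlinearity under the pseudoconformal transform -/

lemma rieszKernel_smul {N : ℕ} (α : ℝ) {l : ℝ} (hl : 0 < l) (x : Space N) :
    rieszKernel N α x = l ^ ((N : ℝ) - α) * rieszKernel N α (l • x) := by
  rw [rieszKernel, rieszKernel, norm_smul, Real.norm_of_nonneg hl.le,
    Real.mul_rpow hl.le (norm_nonneg _)]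
  have : l ^ ((N : ℝ) - α) * l ^ (α - (N : ℝ)) = 1 := by rw [← Real.rpow_add hl]; simp
  linear_combination (-(rieszConst N α * ‖x‖ ^ (α - (N : ℝ)))) * this

lemma density_pconf {N : ℕ} (b q : ℝ) {t : ℝ} (ht : 0 < t) (h : Space N → ℂ) (ξ : Space N) :
    density b q (pconf t h) ξ = (4 * Real.pi * t) ^ ((N : ℝ) / 2 * q + b) *
      density b q h ((4 * Real.pi * t) • ξ) := by
  have hl : 0 < 4 * Real.pi * t := by positivity
  rw [density, density, norm_pconf ht, norm_smul, Real.norm_of_nonneg hl.le,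
    Real.mul_rpow hl.le (norm_nonneg _), Real.mul_rpow (by positivity) (norm_nonneg _),
    ← Real.rpow_mul hl.le, Real.rpow_add hl]
  have : (4 * Real.pi * t) ^ b * (4 * Real.pi * t) ^ (-b) = 1 := by
    rw [← Real.rpow_add hl]; simp
  linear_combination (-((4 * Real.pi * t) ^ ((N : ℝ) / 2 * q) * ‖ξ‖ ^ (-b) *
    ‖h ((4 * Real.pi * t) • ξ)‖ ^ q)) * this

lemma kernel_mul_density_pconf {N : ℕ} (b α q : ℝ) {t : ℝ} (ht : 0 < t) (h : Space N → ℂ)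
    (ξ s : Space N) :
    rieszKernel N α s * density b q (pconf t h) (ξ - s) =
      (4 * Real.pi * t) ^ ((N : ℝ) - α + ((N : ℝ) / 2 * q + b)) *
        (rieszKernel N α ((4 * Real.pi * t) • s) *
          density b q h ((4 * Real.pi * t) • ξ - (4 * Real.pi * t) • s)) := by
  have hl : 0 < 4 * Real.pi * t := by positivity
  rw [rieszKernel_smul α hl, density_pconf b q ht, Real.rpow_add hl ((N : ℝ) - α), smul_sub]
  ring

lemma potentialExistsAt_pconf {N : ℕ} {b α q : ℝ} {t : ℝ} (ht : 0 < t) {h : Space N → ℂ}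
    {ξ : Space N} (hp : PotentialExistsAt b α q h ((4 * Real.pi * t) • ξ)) :
    PotentialExistsAt b α q (pconf t h) ξ := by
  have hl : 0 < 4 * Real.pi * t := by positivity
  have h1 : Integrable (fun s => rieszKernel N α s *
    density b q h ((4 * Real.pi * t) • ξ - s)) := hp
  have h2 := (h1.comp_smul hl.ne').const_mul
    ((4 * Real.pi * t) ^ ((N : ℝ) - α + ((N : ℝ) / 2 * q + b)))
  simp only [← kernel_mul_density_pconf b α q ht h ξ] at h2
  exact h2

lemma potential_pconf {N : ℕ} (b α q : ℝ) {t : ℝ} (ht : 0 < t) (h : Space N → ℂ) (ξ : Space N) :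
    potential b α q (pconf t h) ξ = (4 * Real.pi * t) ^ ((N : ℝ) / 2 * q + b - α) *
      potential b α q h ((4 * Real.pi * t) • ξ) := by
  have hl : 0 < 4 * Real.pi * t := by positivity
  simp only [potential, convolution, ContinuousLinearMap.mul_apply', kernel_mul_density_pconf b α q ht]
  rw [integral_const_mul, Measure.integral_comp_smul volume
    (fun s => rieszKernel N α s * density b q h ((4 * Real.pi * t) • ξ - s)), smul_eq_mul,
    finrank_euclideanSpace_fin, abs_of_pos (by positivity), ← mul_assoc, ← Real.rpow_natCast,
    ← Real.rpow_neg hl.le, ← Real.rpow_add hl]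
  congr 2
  ring

lemma nonlinearity_pconf {N : ℕ} (b α q : ℝ) {t : ℝ} (ht : 0 < t) (h : Space N → ℂ)
    (ξ : Space N) :
    nonlinearity b α q (pconf t h) ξ =
      (((4 * Real.pi * t) ^ ((N : ℝ) * (q - 1) + 2 * b - α + (N : ℝ) / 2) : ℝ) : ℂ) *
        (Complex.exp (-Complex.I * ((4 * Real.pi ^ 2 * t * ‖ξ‖ ^ 2 : ℝ) : ℂ)) *
          nonlinearity b α q h ((4 * Real.pi * t) • ξ)) := by
  have hl : 0 < 4 * Real.pi * t := by positivity
  have e : (4 * Real.pi * t) ^ ((N : ℝ) * (q - 1) + 2 * b - α + (N : ℝ) / 2) =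
      (4 * Real.pi * t) ^ ((N : ℝ) / 2 * (q - 2)) * (4 * Real.pi * t) ^ ((N : ℝ) / 2 * q + b - α) *
        (4 * Real.pi * t) ^ b * (4 * Real.pi * t) ^ ((N : ℝ) / 2) := by
    rw [← Real.rpow_add hl, ← Real.rpow_add hl, ← Real.rpow_add hl]
    congr 1; ring
  have e1 : ‖(4 * Real.pi * t) • ξ‖ ^ (-b) = (4 * Real.pi * t) ^ (-b) * ‖ξ‖ ^ (-b) := by
    rw [norm_smul, Real.norm_of_nonneg hl.le, Real.mul_rpow hl.le (norm_nonneg _)]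
  have e2 : (4 * Real.pi * t) ^ b * (4 * Real.pi * t) ^ (-b) = 1 := by
    rw [← Real.rpow_add hl]; simp
  have e3 : ‖ξ‖ ^ (-b) = (4 * Real.pi * t) ^ b * ‖(4 * Real.pi * t) • ξ‖ ^ (-b) := by
    rw [e1, ← mul_assoc, e2, one_mul]
  rw [nonlinearity, nonlinearity, norm_pconf ht, potential_pconf b α q ht, pconf,
    Real.mul_rpow (by positivity) (norm_nonneg _), ← Real.rpow_mul hl.le, e, e3]
  push_cast
  ring

lemma wavePacket_smul {N : ℕ} (θ : ℝ → ℝ) (χ : Space N → ℂ) (L : ℝ) {t : ℝ} (ht : 0 < t)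
    (ξ : Space N) :
    wavePacket θ χ L (t, (4 * Real.pi * t) • ξ) =
      ((θ (t / L) * (4 * Real.pi * t) ^ (-(N : ℝ) / 2) : ℝ) : ℂ) *
        (Complex.exp (-Complex.I * ((4 * Real.pi ^ 2 * t * ‖ξ‖ ^ 2 : ℝ) : ℂ)) * χ ξ) := by
  have hl : 0 < 4 * Real.pi * t := by positivity
  have htc : (t : ℂ) ≠ 0 := by exact_mod_cast ht.ne'
  rw [wavePacket]
  simp only
  rw [inv_smul_smul₀ hl.ne', norm_smul, Real.norm_of_nonneg hl.le]
  congr 3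
  push_cast
  field_simp

/-- The packet carries exactly the phase that `pconf` puts on h, and the nonlinearity is gauge
covariant, so only a power of 4πt remains. -/
lemma nonlinearity_mul_wavePacket {N : ℕ} (b α q : ℝ) (θ : ℝ → ℝ) (χ : Space N → ℂ) (L : ℝ)
    {t : ℝ} (ht : 0 < t) (h : Space N → ℂ) (ξ : Space N) :
    nonlinearity b α q h ((4 * Real.pi * t) • ξ) * wavePacket θ χ L (t, (4 * Real.pi * t) • ξ) =
      ((θ (t / L) * (4 * Real.pi * t) ^ (-((N : ℝ) * (q - 1) + 2 * b - α + N)) : ℝ) : ℂ) *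
        (nonlinearity b α q (pconf t h) ξ * χ ξ) := by
  have hl : 0 < 4 * Real.pi * t := by positivity
  rw [wavePacket_smul θ χ L ht, nonlinearity_pconf b α q ht]
  have e : (4 * Real.pi * t) ^ (-(N : ℝ) / 2) =
      (4 * Real.pi * t) ^ (-((N : ℝ) * (q - 1) + 2 * b - α + N)) *
        (4 * Real.pi * t) ^ ((N : ℝ) * (q - 1) + 2 * b - α + (N : ℝ) / 2) := by
    rw [← Real.rpow_add hl]; congr 1; ring
  rw [e]
  push_cast
  ring

/-- The Jacobian (4πt)^N leaves the decay rate t^{-P}, P = N(q-1)+2b-α, which is not integrable at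
infinity when P < 1. -/
lemma integral_nonlinearity_mul_wavePacket {N : ℕ} (b α q : ℝ) (θ : ℝ → ℝ) (χ : Space N → ℂ)
    (L : ℝ) {t : ℝ} (ht : 0 < t) (h : Space N → ℂ) :
    ∫ x, nonlinearity b α q h x * wavePacket θ χ L (t, x) =
      ((θ (t / L) * (4 * Real.pi * t) ^ (-((N : ℝ) * (q - 1) + 2 * b - α)) : ℝ) : ℂ) *
        ∫ ξ, nonlinearity b α q (pconf t h) ξ * χ ξ := by
  have hl : 0 < 4 * Real.pi * t := by positivity
  have h1 := Measure.integral_comp_smul (volume : Measure (Space N))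
    (fun x => nonlinearity b α q h x * wavePacket θ χ L (t, x)) (4 * Real.pi * t)
  simp only [nonlinearity_mul_wavePacket b α q θ χ L ht] at h1
  rw [integral_const_mul, finrank_euclideanSpace_fin, abs_of_pos (by positivity),
    Complex.real_smul] at h1
  have e : (4 * Real.pi * t) ^ (-((N : ℝ) * (q - 1) + 2 * b - α)) =
      (4 * Real.pi * t) ^ N * (4 * Real.pi * t) ^ (-((N : ℝ) * (q - 1) + 2 * b - α + N)) := by
    rw [← Real.rpow_natCast, ← Real.rpow_add hl]; congr 1; ring
  have e2 : (((4 * Real.pi * t) ^ N : ℝ) : ℂ) * ((((4 * Real.pi * t) ^ N)⁻¹ : ℝ) : ℂ) = 1 := by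
    rw [← Complex.ofReal_mul, mul_inv_cancel₀ (by positivity)]; simp
  calc ∫ x, nonlinearity b α q h x * wavePacket θ χ L (t, x)
      = (((4 * Real.pi * t) ^ N : ℝ) : ℂ) * (((((4 * Real.pi * t) ^ N)⁻¹ : ℝ) : ℂ) *
          ∫ x, nonlinearity b α q h x * wavePacket θ χ L (t, x)) := by
        rw [← mul_assoc, e2, one_mul]
    _ = _ := by
        rw [← h1, e]; push_cast; ring

lemma integrable_nonlinearity_pconf_mul {N : ℕ} {b α q : ℝ} {θ : ℝ → ℝ} {χ : Space N → ℂ} {L : ℝ}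
    {t : ℝ} (ht : 0 < t) (hθ : θ (t / L) ≠ 0) {h : Space N → ℂ}
    (hi : Integrable (fun x => nonlinearity b α q h x * wavePacket θ χ L (t, x))) :
    Integrable (fun ξ => nonlinearity b α q (pconf t h) ξ * χ ξ) := by
  have hl : 0 < 4 * Real.pi * t := by positivity
  have h1 := hi.comp_smul hl.ne'
  simp only [nonlinearity_mul_wavePacket b α q θ χ L ht] at h1
  set c : ℂ := ((θ (t / L) * (4 * Real.pi * t) ^ (-((N : ℝ) * (q - 1) + 2 * b - α + N)) : ℝ) : ℂ)
  have hc : c ≠ 0 := by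
    refine Complex.ofReal_ne_zero.2 (mul_ne_zero hθ ?_)
    positivity
  have h2 := h1.const_mul c⁻¹
  refine h2.congr (Eventually.of_forall fun ξ => ?_)
  simp only
  rw [← mul_assoc, inv_mul_cancel₀ hc, one_mul]

/-! ### Bounds for the two sides of the tested equation -/

lemma integrable_nonlinearity_mul_test {N : ℕ} {F φ : ℝ × Space N → ℂ}
    (hF : LocallyIntegrableOn F (Ioi 0 ×ˢ univ) volume) (hφ : IsTestFunction φ) :
    Integrable (fun p => F p * φ p) := by
  have h1 : IntegrableOn F (tsupport φ) :=
    hF.integrableOn_compact_subset hφ.support hφ.compact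
  have h2 := h1.mul_continuousOn hφ.smooth.continuous.continuousOn hφ.compact
  refine (integrableOn_iff_integrable_of_support_subset fun p hp => ?_).1 h2
  refine subset_tsupport _ ?_
  intro h0
  exact hp (by simp [h0])

lemma continuous_laplacian {N : ℕ} {χ : Space N → ℂ} (hχ : ContDiff ℝ ∞ χ) :
    Continuous (Laplacian.laplacian χ) := by
  have h2 : ContDiff ℝ 2 χ := hχ.of_le (by norm_cast)
  have e : Laplacian.laplacian χ = fun x => ∑ i, fderiv ℝ (fun y => fderiv ℝ χ y
      (EuclideanSpace.basisFun _ ℝ i)) x (EuclideanSpace.basisFun (Fin N) ℝ i) := by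
    ext x; exact laplacian_eq_sum_fderiv h2 x
  rw [e]
  refine continuous_finsetSum _ fun i _ => ?_
  have h3 : ContDiff ℝ 1 (fun y => fderiv ℝ χ y (EuclideanSpace.basisFun (Fin N) ℝ i)) :=
    (h2.fderiv_right (m := 1) (by norm_num)).clm_apply contDiff_const
  exact (h3.continuous_fderiv (by norm_num)).clm_apply continuous_const

lemma laplacian_eq_zero_of_notMem_tsupport {N : ℕ} {χ : Space N → ℂ} {x : Space N}
    (hx : x ∉ tsupport χ) : Laplacian.laplacian χ x = 0 := by
  have h : χ =ᶠ[𝓝 x] fun _ => 0 := by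
    filter_upwards [(isClosed_tsupport χ).isOpen_compl.mem_nhds hx] with y hy
    exact image_eq_zero_of_notMem_tsupport hy
  rw [(InnerProductSpace.laplacian_congr_nhds h).eq_of_nhds]
  simp

/-- Uniform bound of the transposed operator on wave packets. -/
lemma exists_transpose_wavePacket_bound {N : ℕ} {θ : ℝ → ℝ} {χ : Space N → ℂ}
    (hθ : ContDiff ℝ ∞ θ) (hχ : ContDiff ℝ ∞ χ) (hχc : HasCompactSupport χ)
    (hθ1 : ∀ s < 1, θ s = 0) (hθ3 : ∀ s, 3 < s → θ s = 0) :
    ∃ S ρ : ℝ, 0 ≤ S ∧ ∀ L : ℝ, 1 ≤ L → ∀ p : ℝ × Space N,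
      ‖transposeSchrodinger (wavePacket θ χ L) p‖ₑ ≤
        (Icc L (3 * L)).indicator (fun t => ENNReal.ofReal (L⁻¹ * S * (4 * Real.pi * t) ^ (-(N : ℝ) / 2))) p.1 *
          (Metric.closedBall (0 : Space N) ρ).indicator 1 ((4 * Real.pi * p.1)⁻¹ • p.2) := by
  have hθc : HasCompactSupport θ := HasCompactSupport.of_support_subset_isCompact
    (isCompact_Icc (a := (1 : ℝ)) (b := 3)) fun s hs =>
      ⟨not_lt.1 fun h => hs (hθ1 s h), not_lt.1 fun h => hs (hθ3 s h)⟩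
  obtain ⟨a₀, ha₀⟩ := hθc.exists_bound_of_continuous hθ.continuous
  obtain ⟨a₁, ha₁⟩ := hθc.deriv.exists_bound_of_continuous (hθ.continuous_deriv (by simp))
  obtain ⟨a₂, ha₂⟩ := hχc.exists_bound_of_continuous hχ.continuous
  have hΔc : HasCompactSupport (Laplacian.laplacian χ) :=
    HasCompactSupport.of_support_subset_isCompact hχc.isCompact fun x hx => by
      by_contra h; exact hx (laplacian_eq_zero_of_notMem_tsupport h)
  obtain ⟨a₃, ha₃⟩ := hΔc.exists_bound_of_continuous (continuous_laplacian hχ)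
  obtain ⟨ρ, hρ⟩ := hχc.isCompact.isBounded.subset_closedBall (0 : Space N)
  have n0 : 0 ≤ a₀ := (norm_nonneg _).trans (ha₀ 0)
  have n1 : 0 ≤ a₁ := (norm_nonneg _).trans (ha₁ 0)
  have n2 : 0 ≤ a₂ := (norm_nonneg _).trans (ha₂ 0)
  have n3 : 0 ≤ a₃ := (norm_nonneg _).trans (ha₃ 0)
  refine ⟨a₁ * a₂ + a₀ * a₃, ρ, by positivity, fun L hL p => ?_⟩
  obtain ⟨t, x⟩ := p
  have hL0 : 0 < L := by linarith
  by_cases htL : t < L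
  · rw [transposeSchrodinger_wavePacket_eq_zero hL0 hθ1 htL]
    simp
  push Not at htL
  have ht : 0 < t := hL0.trans_le htL
  have hl : 0 < 4 * Real.pi * t := by positivity
  rw [transposeSchrodinger_wavePacket hθ hχ ht]
  by_cases ht3 : 3 * L < t
  · have h3 : 3 < t / L := by rw [lt_div_iff₀ hL0]; exact ht3
    have hd : deriv θ (t / L) = 0 := by
      have : θ =ᶠ[𝓝 (t / L)] fun _ => 0 := by
        filter_upwards [Ioi_mem_nhds h3] with s hs using hθ3 s hs
      rw [this.deriv_eq]; simp
    rw [hd, hθ3 _ h3]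
    simp
  push Not at ht3
  by_cases hx : (4 * Real.pi * t)⁻¹ • x ∈ tsupport χ
  swap
  · rw [laplacian_eq_zero_of_notMem_tsupport hx, image_eq_zero_of_notMem_tsupport hx]
    simp
  rw [indicator_of_mem (show (t, x).1 ∈ Icc L (3 * L) from ⟨htL, ht3⟩),
    indicator_of_mem (hρ hx), Pi.one_apply, mul_one, ← ofReal_norm]
  refine ENNReal.ofReal_le_ofReal ?_
  have hexp : ‖Complex.exp ((-Complex.I / (4 * (t : ℂ))) * ((‖x‖ ^ 2 : ℝ) : ℂ))‖ = 1 := by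
    have : (-Complex.I / (4 * (t : ℂ))) * ((‖x‖ ^ 2 : ℝ) : ℂ) =
        ((-(‖x‖ ^ 2) / (4 * t) : ℝ) : ℂ) * Complex.I := by push_cast; ring
    rw [this, Complex.norm_exp_ofReal_mul_I]
  rw [norm_mul, norm_mul, hexp, one_mul, Complex.norm_of_nonneg (by positivity), mul_comm]
  refine mul_le_mul_of_nonneg_right ?_ (by positivity)
  -- Since t ≥ L ≥ 1, (4πt)² ≥ L² ≥ L, so the Laplacian term is no larger than the cutoff term.
  have hl2 : ((4 * Real.pi * t)⁻¹) ^ 2 ≤ L⁻¹ := by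
    rw [inv_pow]
    refine inv_anti₀ hL0 ?_
    have hπ := Real.pi_gt_three
    have h4 : L ≤ 4 * Real.pi * t := by nlinarith
    nlinarith
  refine (norm_add_le _ _).trans ?_
  rw [norm_mul, norm_mul, norm_mul, norm_mul, norm_neg, Complex.norm_I, one_mul, norm_pow,
    Complex.norm_real, Complex.norm_real, Complex.norm_real, norm_div, Real.norm_of_nonneg hL0.le,
    Real.norm_of_nonneg (inv_pos.2 hl).le]
  have i1 : ‖deriv θ (t / L)‖ / L * ‖χ ((4 * Real.pi * t)⁻¹ • x)‖ ≤ a₁ / L * a₂ := by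
    gcongr
    · exact ha₁ _
    · exact ha₂ _
  have i2 : ‖θ (t / L)‖ * ((4 * Real.pi * t)⁻¹) ^ 2 *
      ‖Laplacian.laplacian χ ((4 * Real.pi * t)⁻¹ • x)‖ ≤ a₀ * L⁻¹ * a₃ := by
    gcongr
    · exact ha₀ _
    · exact ha₃ _
  calc _ ≤ a₁ / L * a₂ + a₀ * L⁻¹ * a₃ := add_le_add i1 i2
    _ = _ := by ring

/-- The profile `e^{-iπN/4} 𝓕 f`, the limit of the pseudo-conformal transform of `e^{itΔ} f`. -/
noncomputable def asymptoticProfile {N : ℕ} (f : L2 N) (ξ : Space N) : ℂ :=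
  (-Complex.I) ^ (N / 2 : ℂ) * (𝓕 f : L2 N) ξ

lemma measurable_asymptoticProfile {N : ℕ} (f : L2 N) : Measurable (asymptoticProfile f) :=
  (Lp.stronglyMeasurable (𝓕 f : L2 N)).measurable.const_mul _

lemma lintegral_asymptoticProfile_ne_top {N : ℕ} (f : L2 N) :
    ∫⁻ ξ, ‖asymptoticProfile f ξ‖ₑ ^ 2 ≠ ⊤ := by
  rw [← eLpNorm_two_sq]
  exact ENNReal.pow_ne_top ((Lp.memLp (𝓕 f : L2 N)).const_mul _).2.ne

lemma asymptoticProfile_not_ae_zero {N : ℕ} {f : L2 N} (hf : f ≠ 0) :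
    ¬ asymptoticProfile f =ᵐ[volume] 0 := by
  intro h
  have hphase : (-Complex.I) ^ (N / 2 : ℂ) ≠ 0 := by
    rw [← norm_ne_zero_iff, norm_phase]; exact one_ne_zero
  have h0 : (𝓕 f : L2 N) = 0 := by
    refine Lp.ext ?_
    filter_upwards [h, Lp.coeFn_zero ℂ 2 (volume : Measure (Space N))] with ξ h1 h2
    rw [h2]
    exact (mul_eq_zero.1 h1).resolve_left hphase
  apply hf
  have h1 : ‖f‖ = ‖(𝓕 f : L2 N)‖ :=
    ((Lp.fourierTransformₗᵢ (Space N) ℂ).norm_map f).symm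
  rw [← norm_eq_zero, h1, h0, norm_zero]

/-- The transform `pconf t` preserves L² norms, so the scattering error carries over unchanged and
adds to the free asymptotics. -/
lemma tendsto_pconf_sub_asymptoticProfile {N : ℕ} {w : ℝ → L2 N} {f : L2 N}
    (h : Tendsto (fun t : ℝ => ‖w t - freeSchrodinger t f‖) atTop (𝓝 0)) :
    Tendsto (fun t : ℝ => ∫⁻ ξ, ‖pconf t (w t) ξ - asymptoticProfile f ξ‖ₑ ^ 2) atTop (𝓝 0) := by
  have h1 : Tendsto (fun t : ℝ => ENNReal.ofReal ‖w t - freeSchrodinger t f‖ +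
      eLpNorm (fun ξ => pconf t (freeSchrodinger t f) ξ - asymptoticProfile f ξ) 2 volume)
      atTop (𝓝 0) := by
    have := (ENNReal.tendsto_ofReal h).add (tendsto_pconf_freeSchrodinger f)
    rwa [ENNReal.ofReal_zero, add_zero] at this
  have h2 : Tendsto (fun t : ℝ =>
      eLpNorm (fun ξ => pconf t (w t) ξ - asymptoticProfile f ξ) 2 volume) atTop (𝓝 0) := by
    refine tendsto_of_tendsto_of_tendsto_of_le_of_le' tendsto_const_nhds h1
      (Eventually.of_forall fun _ => zero_le) ?_
    filter_upwards [eventually_gt_atTop 0] with t ht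
    rw [← eLpNorm_coe_sub, ← eLpNorm_pconf ht (fun x => w t x - freeSchrodinger t f x), pconf_sub]
    have e : (fun ξ => pconf t (w t) ξ - asymptoticProfile f ξ) =
        (fun ξ => pconf t (w t) ξ - pconf t (freeSchrodinger t f) ξ) +
          fun ξ => pconf t (freeSchrodinger t f) ξ - asymptoticProfile f ξ := by
      ext ξ; simp
    rw [e]
    have m1 := aestronglyMeasurable_pconf ht (Lp.aestronglyMeasurable (w t))
    have m2 := aestronglyMeasurable_pconf ht (Lp.aestronglyMeasurable (freeSchrodinger t f))
    exact eLpNorm_add_le (m1.sub m2)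
      (m2.sub (measurable_asymptoticProfile f).aestronglyMeasurable) (by norm_num)
  have h3 := ENNReal.Tendsto.pow (n := 2) h2
  simpa [eLpNorm_two_sq] using h3

/-- The bound a ≤ 1 + a² on s stands in for Cauchy–Schwarz, since only finiteness matters. -/
lemma mul_indicator_one_le {X : Type*} (s : Set X) (a : ENNReal) (x : X) :
    a * s.indicator 1 x ≤ s.indicator 1 x + a ^ 2 := by
  by_cases hx : x ∈ s
  · rw [indicator_of_mem hx, Pi.one_apply, mul_one]
    rcases le_total a 1 with h | h
    · exact h.trans le_self_add
    · exact (le_self_pow₀ h two_ne_zero).trans le_add_self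
  · simp [hx]

/-- The pairing of a slice with the wave packet bound, in pseudo-conformal coordinates. -/
lemma lintegral_enorm_mul_bound_le {N : ℕ} {t c : ℝ} (ht : 0 < t) (hc : 0 ≤ c) (ρ : ℝ)
    {h : Space N → ℂ} :
    ∫⁻ x, ‖h x‖ₑ * (ENNReal.ofReal (c * (4 * Real.pi * t) ^ (-(N : ℝ) / 2)) *
        (Metric.closedBall (0 : Space N) ρ).indicator 1 ((4 * Real.pi * t)⁻¹ • x)) ≤
      ENNReal.ofReal c * (volume (Metric.closedBall (0 : Space N) ρ) +
        ∫⁻ ξ, ‖pconf t h ξ‖ₑ ^ 2) := by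
  have hr : 0 < 4 * Real.pi * t := by positivity
  rw [← lintegral_comp_smul hr, ← lintegral_const_mul' _ _ ENNReal.ofReal_ne_top]
  calc _ ≤ ∫⁻ ξ, ENNReal.ofReal c * ((Metric.closedBall (0 : Space N) ρ).indicator 1 ξ +
        ‖pconf t h ξ‖ₑ ^ 2) := by
        refine lintegral_mono fun ξ => ?_
        refine le_trans (le_of_eq ?_)
          (mul_le_mul_right (mul_indicator_one_le (Metric.closedBall (0 : Space N) ρ) ‖pconf t h ξ‖ₑ ξ)
            (ENNReal.ofReal c))
        rw [inv_smul_smul₀ hr.ne', ← ofReal_norm, ← ofReal_norm, norm_pconf ht]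
        rw [← mul_assoc, ← mul_assoc, ← mul_assoc, ← ENNReal.ofReal_mul (by positivity),
          ← ENNReal.ofReal_mul (by positivity), ← ENNReal.ofReal_mul hc]
        congr 2
        have e : (4 * Real.pi * t) ^ N * (4 * Real.pi * t) ^ (-(N : ℝ) / 2) =
            (4 * Real.pi * t) ^ ((N : ℝ) / 2) := by
          rw [← Real.rpow_natCast, ← Real.rpow_add hr]; congr 1; ring
        rw [← e]; ring
    _ = _ := by
        rw [lintegral_const_mul' _ _ ENNReal.ofReal_ne_top, lintegral_add_left,
          lintegral_indicator_one measurableSet_closedBall]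
        exact measurable_one.indicator measurableSet_closedBall

/-- Each time slice contributes at most a multiple of L⁻¹, and the window [L, 3L] has length 2L, so
the bound does not depend on L. -/
lemma enorm_integral_mul_le {N : ℕ} {u T : ℝ × Space N → ℂ} {S ρ L : ℝ} {Q : ENNReal}
    (hu : Measurable u) (hS : 0 ≤ S) (hL : 0 < L)
    (hT : ∀ p, ‖T p‖ₑ ≤ (Icc L (3 * L)).indicator
        (fun t => ENNReal.ofReal (L⁻¹ * S * (4 * Real.pi * t) ^ (-(N : ℝ) / 2))) p.1 *
          (Metric.closedBall (0 : Space N) ρ).indicator 1 ((4 * Real.pi * p.1)⁻¹ • p.2))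
    (hQ : ∀ᵐ t : ℝ, L ≤ t → ∫⁻ ξ, ‖pconf t (fun x => u (t, x)) ξ‖ₑ ^ 2 ≤ Q) :
    ‖∫ p, u p * T p‖ₑ ≤
      ENNReal.ofReal (2 * S) * (volume (Metric.closedBall (0 : Space N) ρ) + Q) := by
  set B : ENNReal := volume (Metric.closedBall (0 : Space N) ρ) + Q
  calc ‖∫ p, u p * T p‖ₑ ≤ ∫⁻ p, ‖u p * T p‖ₑ := enorm_integral_le_lintegral_enorm _
    _ ≤ ∫⁻ p : ℝ × Space N, ‖u p‖ₑ * ((Icc L (3 * L)).indicator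
        (fun t => ENNReal.ofReal (L⁻¹ * S * (4 * Real.pi * t) ^ (-(N : ℝ) / 2))) p.1 *
          (Metric.closedBall (0 : Space N) ρ).indicator 1 ((4 * Real.pi * p.1)⁻¹ • p.2)) := by
        refine lintegral_mono fun p => ?_
        rw [enorm_mul]
        gcongr
        exact hT p
    _ = ∫⁻ t : ℝ, ∫⁻ x : Space N, ‖u (t, x)‖ₑ * ((Icc L (3 * L)).indicator
        (fun t => ENNReal.ofReal (L⁻¹ * S * (4 * Real.pi * t) ^ (-(N : ℝ) / 2))) t *
          (Metric.closedBall (0 : Space N) ρ).indicator 1 ((4 * Real.pi * t)⁻¹ • x)) := by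
        rw [Measure.volume_eq_prod, lintegral_prod]
        refine (hu.enorm.mul (Measurable.mul ?_ ?_)).aemeasurable
        · refine Measurable.comp (Measurable.indicator ?_ measurableSet_Icc) measurable_fst
          fun_prop
        · refine Measurable.comp (g := (Metric.closedBall (0 : Space N) ρ).indicator 1)
            (measurable_one.indicator measurableSet_closedBall) ?_
          fun_prop
    _ ≤ ∫⁻ t : ℝ, (Icc L (3 * L)).indicator (fun _ => ENNReal.ofReal (L⁻¹ * S) * B) t := by
        refine lintegral_mono_ae ?_
        filter_upwards [hQ] with t hQt
        by_cases htL : t ∈ Icc L (3 * L)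
        · simp only [indicator_of_mem htL]
          refine (lintegral_enorm_mul_bound_le (hL.trans_le htL.1) (by positivity) ρ).trans ?_
          gcongr
          exact add_le_add le_rfl (hQt htL.1)
        · simp [indicator_of_notMem htL]
    _ = ENNReal.ofReal (2 * S) * B := by
        rw [lintegral_indicator_const measurableSet_Icc, Real.volume_Icc, mul_right_comm,
          ← ENNReal.ofReal_mul (by positivity)]
        congr 2
        field_simp
        ring

/-- On the window 4πt ≤ 12πL, so with P ≥ 0 every slice contributes at least a multiple of L^{-P},
and the window supplies a factor L. The slice bound may assume integrability because Fubini provides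
it for almost every t. -/
lemma le_re_integral_nonlinearity_mul_wavePacket {N : ℕ} {b α q : ℝ} {θ : ℝ → ℝ}
    {χ : Space N → ℂ} {L c₀ : ℝ} {u : ℝ × Space N → ℂ}
    (hθc : Continuous θ) (hθ0 : ∀ s, 0 ≤ θ s) (hθ1 : ∀ s < 1, θ s = 0) (hθ3 : ∀ s, 3 < s → θ s = 0)
    (hL : 0 < L) (hc₀ : 0 ≤ c₀) (hp : 0 ≤ (N : ℝ) * (q - 1) + 2 * b - α)
    (hi : Integrable (fun p : ℝ × Space N =>
      nonlinearity b α q (fun x => u (p.1, x)) p.2 * wavePacket θ χ L p))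
    (hlow : ∀ᵐ t : ℝ, L ≤ t →
      Integrable (fun ξ => nonlinearity b α q (pconf t (fun x => u (t, x))) ξ * χ ξ) →
      c₀ ≤ (∫ ξ, nonlinearity b α q (pconf t (fun x => u (t, x))) ξ * χ ξ).re) :
    c₀ * (12 * Real.pi * L) ^ (-((N : ℝ) * (q - 1) + 2 * b - α)) * (L * ∫ s, θ s) ≤
      (∫ p : ℝ × Space N,
        nonlinearity b α q (fun x => u (p.1, x)) p.2 * wavePacket θ χ L p).re := by
  set P : ℝ := (N : ℝ) * (q - 1) + 2 * b - α
  have hθcs : HasCompactSupport θ := HasCompactSupport.of_support_subset_isCompact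
    (isCompact_Icc (a := (1 : ℝ)) (b := 3)) fun s hs =>
      ⟨not_lt.1 fun h => hs (hθ1 s h), not_lt.1 fun h => hs (hθ3 s h)⟩
  have hθi : Integrable (fun t => θ (t / L)) :=
    (hθc.integrable_of_hasCompactSupport hθcs).comp_div hL.ne'
  have e1 : L * ∫ s, θ s = ∫ t, θ (t / L) := by
    rw [Measure.integral_comp_div, abs_of_pos hL, smul_eq_mul]
  rw [Measure.volume_eq_prod] at hi ⊢
  rw [integral_prod _ hi, e1, ← integral_const_mul]
  have hre := Complex.reCLM.integral_comp_comm hi.integral_prod_left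
  simp only [Complex.reCLM_apply] at hre
  rw [← hre]
  refine integral_mono_ae (hθi.const_mul _) hi.integral_prod_left.re ?_
  filter_upwards [hlow, hi.prod_right_ae] with t hlt hit
  by_cases h0 : θ (t / L) = 0
  · have hz : ∀ x, wavePacket θ χ L (t, x) = 0 := fun x => by simp [wavePacket, h0]
    simp [h0, hz]
  have htL : L ≤ t := by
    by_contra h
    exact h0 (hθ1 _ ((div_lt_one hL).2 (not_le.1 h)))
  have ht3 : t ≤ 3 * L := by
    by_contra h
    exact h0 (hθ3 _ ((lt_div_iff₀ hL).2 (not_le.1 h)))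
  have ht : 0 < t := hL.trans_le htL
  rw [integral_nonlinearity_mul_wavePacket b α q θ χ L ht, Complex.re_ofReal_mul]
  have hlt' := hlt htL (integrable_nonlinearity_pconf_mul ht h0 hit)
  have hpow : (12 * Real.pi * L) ^ (-P) ≤ (4 * Real.pi * t) ^ (-P) := by
    refine Real.rpow_le_rpow_of_nonpos (by positivity) ?_ (by linarith)
    nlinarith [Real.pi_pos]
  calc c₀ * (12 * Real.pi * L) ^ (-P) * θ (t / L)
      = θ (t / L) * (12 * Real.pi * L) ^ (-P) * c₀ := by ring
    _ ≤ _ := by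
      have := hθ0 (t / L)
      gcongr

lemma exists_time_cutoff : ∃ θ : ℝ → ℝ, ContDiff ℝ ∞ θ ∧ (∀ s, 0 ≤ θ s) ∧ (∀ s < 1, θ s = 0) ∧
    (∀ s, 3 < s → θ s = 0) ∧ 0 < ∫ s, θ s := by
  let f : ContDiffBump (2 : ℝ) := ⟨1 / 2, 1, by norm_num, by norm_num⟩
  have h0 : ∀ s : ℝ, 1 ≤ |s - 2| → f s = 0 := fun s hs => f.zero_of_le_dist (by simpa [Real.dist_eq] using hs)
  refine ⟨f, f.contDiff, fun s => f.nonneg, fun s hs => h0 s ?_, fun s hs => h0 s ?_, f.integral_pos⟩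
  · rw [abs_of_neg (by linarith)]; linarith
  · rw [abs_of_pos (by linarith)]; linarith

end Hartree

/-! ### The contradiction -/

open Hartree

theorem theorem2p3 (N : ℕ) (hN : 2 ≤ N) (b α q : ℝ)
    (hb : 0 < b) (hα : 0 < α) (hαN : 0 < (N : ℝ) - α) (hbN : 0 < (N : ℝ) - b)
    (hbα : 0 < 1 - 2 * b + α)
    (hq₁ : max 1 (1 + (α - 2 * b) / (N : ℝ)) < q)
    (hq₂ : q < 1 + (1 + α - 2 * b) / (N : ℝ))
    (w : ℝ → Hartree.L2 N) (hw : Hartree.IsGlobalSolution b α q w)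
    (wplus : Hartree.L2 N)
    (hscat : Tendsto (fun t : ℝ => ‖w t - Hartree.freeSchrodinger t wplus‖) atTop (𝓝 0)) :
    wplus = 0 := by
  by_contra hne
  obtain ⟨-, u, hum, huw, hpot, hloc, heq⟩ := hw
  have hN0 : (0 : ℝ) < N := by exact_mod_cast (by omega : 0 < N)
  have hq1 : 1 < q := (le_max_left _ _).trans_lt hq₁
  -- The two N-dependent bounds on q say exactly that 0 < P < 1.
  set P : ℝ := (N : ℝ) * (q - 1) + 2 * b - α with hP
  have hP0 : 0 < P := by
    have h1 : (α - 2 * b) / (N : ℝ) < q - 1 := by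
      linarith [(le_max_right 1 (1 + (α - 2 * b) / (N : ℝ))).trans_lt hq₁]
    rw [div_lt_iff₀ hN0] at h1
    rw [hP]; linarith
  have hP1 : P < 1 := by
    have h1 : q - 1 < (1 + α - 2 * b) / (N : ℝ) := by linarith
    rw [lt_div_iff₀ hN0] at h1
    rw [hP]; linarith
  have hgm := measurable_asymptoticProfile wplus
  have hg2 := lintegral_asymptoticProfile_ne_top wplus
  obtain ⟨ψ, c₀, η, hψ, hψc, hc₀, hη, hlow⟩ := exists_lower_bound hN hb hα hαN hq1 hq₂ hgm hg2
    (asymptoticProfile_not_ae_zero hne)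
  obtain ⟨θ, hθ, hθ0, hθ1, hθ3, hθi⟩ := exists_time_cutoff
  -- The distributional pairing is bilinear, whereas the lower bound pairs with the conjugate of ψ.
  set χ : Space N → ℂ := fun ξ => (starRingEnd ℂ) (ψ ξ)
  have hχ : ContDiff ℝ ∞ χ := Complex.conjCLE.contDiff.comp hψ
  have hχc : HasCompactSupport χ := hψc.comp_left (map_zero _)
  obtain ⟨S, ρ, hS, hT⟩ := exists_transpose_wavePacket_bound hθ hχ hχc hθ1 hθ3
  -- Closeness η is for the lower bound on the nonlinear pairing, closeness 1 for the uniform L²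
  -- bound Q.
  have hev := (ENNReal.tendsto_nhds_zero.1 (tendsto_pconf_sub_asymptoticProfile hscat)) (min η 1)
    (lt_min hη one_pos)
  obtain ⟨T₀, hT₀⟩ := eventually_atTop.1 hev
  rw [ae_restrict_iff' measurableSet_Ioi] at huw
  have hclose : ∀ᵐ t : ℝ, 0 < t → T₀ ≤ t →
      ∫⁻ ξ, ‖pconf t (fun x => u (t, x)) ξ - asymptoticProfile wplus ξ‖ₑ ^ 2 ≤ min η 1 := by
    filter_upwards [huw] with t htu ht htT
    refine le_trans (le_of_eq ?_) (hT₀ t htT)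
    refine lintegral_congr_ae ?_
    filter_upwards [pconf_congr_ae ht (htu ht)] with ξ hξ
    rw [hξ]
  have hexist : ∀ᵐ t : ℝ, 0 < t →
      ∀ᵐ ξ, PotentialExistsAt b α q (pconf t (fun x => u (t, x))) ξ := by
    rw [ae_restrict_iff' (measurableSet_Ioi.prod MeasurableSet.univ), Measure.volume_eq_prod] at hpot
    filter_upwards [Measure.ae_ae_of_ae_prod hpot] with t htp ht
    have hr : 0 < 4 * Real.pi * t := by positivity
    filter_upwards [(Measure.quasiMeasurePreserving_smul (volume : Measure (Space N)) hr.ne').ae htp]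
      with ξ hξ
    exact potentialExistsAt_pconf ht (hξ ⟨ht, mem_univ _⟩)
  have hvm : ∀ t, Measurable (pconf t (fun x => u (t, x))) := fun t => by
    unfold pconf; fun_prop
  set Q : ENNReal := 2 * (1 + ∫⁻ ξ, ‖asymptoticProfile wplus ξ‖ₑ ^ 2)
  have hQtop : Q ≠ ⊤ := ENNReal.mul_ne_top (by norm_num) (ENNReal.add_ne_top.2 ⟨by norm_num, hg2⟩)
  have hQ : ∀ᵐ t : ℝ, 0 < t → T₀ ≤ t → ∫⁻ ξ, ‖pconf t (fun x => u (t, x)) ξ‖ₑ ^ 2 ≤ Q := by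
    filter_upwards [hclose] with t hct ht htT
    calc ∫⁻ ξ, ‖pconf t (fun x => u (t, x)) ξ‖ₑ ^ 2
        ≤ ∫⁻ ξ, 2 * (‖pconf t (fun x => u (t, x)) ξ - asymptoticProfile wplus ξ‖ₑ ^ 2 +
            ‖asymptoticProfile wplus ξ‖ₑ ^ 2) := by
          refine lintegral_mono fun ξ => ?_
          simpa using enorm_sub_sq_le (pconf t (fun x => u (t, x)) ξ) (asymptoticProfile wplus ξ) 0
      _ ≤ Q := by
          rw [lintegral_const_mul' _ _ (by norm_num), lintegral_add_right _ (hgm.enorm.pow_const 2)]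
          refine mul_le_mul' le_rfl (add_le_add ?_ le_rfl)
          exact (hct ht htT).trans (min_le_right _ _)
  set K : ENNReal := ENNReal.ofReal (2 * S) * (volume (Metric.closedBall (0 : Space N) ρ) + Q)
  have hK : K ≠ ⊤ := ENNReal.mul_ne_top ENNReal.ofReal_ne_top
    (ENNReal.add_ne_top.2 ⟨measure_closedBall_lt_top.ne, hQtop⟩)
  have key : ∀ L : ℝ, max T₀ 1 ≤ L →
      c₀ * (12 * Real.pi) ^ (-P) * (∫ s, θ s) * L ^ (1 - P) ≤ K.toReal := by
    intro L hL
    have hL1 : 1 ≤ L := (le_max_right _ _).trans hL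
    have hL0 : 0 < L := by linarith
    have hLT : T₀ ≤ L := (le_max_left _ _).trans hL
    have htest : IsTestFunction (wavePacket θ χ L) :=
      isTestFunction_wavePacket hθ hχ hχc hθ1 hθ3 hL0
    have hlower := le_re_integral_nonlinearity_mul_wavePacket (u := u) hθ.continuous hθ0 hθ1 hθ3 hL0
      hc₀.le hP0.le (integrable_nonlinearity_mul_test hloc htest) (by
        filter_upwards [hclose, hexist] with t hct het htL hit
        have ht : 0 < t := hL0.trans_le htL
        exact hlow _ (hvm t) ((hct ht (hLT.trans htL)).trans (min_le_left _ _)) (het ht) hit)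
    -- The equation turns the growing nonlinear side into the linear side, which is bounded
    -- independently of L.
    rw [← heq _ htest] at hlower
    have hupper := enorm_integral_mul_le hum hS hL0 (hT L hL1) (by
      filter_upwards [hQ] with t hQt htL
      exact hQt (hL0.trans_le htL) (hLT.trans htL))
    have hnorm : ‖∫ p, u p * transposeSchrodinger (wavePacket θ χ L) p‖ ≤ K.toReal := by
      rw [← toReal_enorm]
      exact ENNReal.toReal_mono hK hupper
    refine le_trans (le_of_eq ?_) (hlower.trans ((Complex.re_le_norm _).trans hnorm))
    rw [Real.mul_rpow (by positivity) hL0.le, sub_eq_add_neg, Real.rpow_add hL0, Real.rpow_one]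
    ring
  have hA : 0 < c₀ * (12 * Real.pi) ^ (-P) * ∫ s, θ s := by positivity
  have hlim : Tendsto (fun L : ℝ => c₀ * (12 * Real.pi) ^ (-P) * (∫ s, θ s) * L ^ (1 - P))
      atTop atTop := (tendsto_rpow_atTop (by linarith)).const_mul_atTop hA
  obtain ⟨L, hL1, hL2⟩ := ((hlim.eventually_gt_atTop K.toReal).and
    (eventually_ge_atTop (max T₀ 1))).exists
  exact (key L hL2).not_gt hL1
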